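/- **Problem.** Let $n,N\ge1$, $\mathcal C=\mathbb R^{n}$, $M\in\mathbb R^{n\times n}$ symmetric positive definite, $g,\theta_0,\theta_{-1}\in\mathcal C$, $\delta>0$, and let $\sigma_{\min}$ denote the smallest singular value. Let $p$ be a potential energy, $h^e_j=0$ and $h^i_j\ge0$ finitely many scalar constraints, and let finitely many nine-entry sub-vectors of $\theta$ be constrained to be matrices $R\in SO(3)$; each contributes the equality constraint $\|R^TR-I\|_F=0$ to the family $h^e$ and the (unpenalized) constraint $\det R=1$. Relaxations $\bar p(\theta,L_2)$, $\bar h^e_j(x,L_2)$, $\bar h^i_j(x,L_2)$ are given for $L_2>0$, a control set $\mathcal X\subset\mathbb R^{m}$, and a control energy $b(\theta,u)$ of one of three types: force, $b=-\theta^TJu$; cables, $b=\sum_l u_l\sqrt{\|(X^a_l\theta+t^a_l)-(X^b_l\theta+t^b_l)\|^2+\epsilon_r}$; PD control, $b=-\sum_l \mathrm{tr}((R^a_l)^TR^b_lR_x(u_l)^T)/(\sqrt{\|R^a_l\|_F^2+\epsilon_r}\sqrt{\|R^b_l\|_F^2+\epsilon_r})$, where $\epsilon_r>0$, $R^{a,b}_l$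 are $3\times3$ sub-matrices of $\theta$ and $R_x$ is the rotation about the $x$-axis. The number $\|J\|$ is respectively $\|J\|$, $\sum_l\|X^a_l-X^b_l\|$, $\sum_l4/\sqrt{\epsilon_r}$, and $L_{15}$ is any bound over $u\in\mathcal X$ of $\|u\|$ (force, cables), or of the operator norms of $R\mapsto R\,R_x(u_l)^T$ for all $l$ (PD). A *grid* is a finite set $D\subset(0,N]$ of time indices containing $1,\dots,N$; $\gamma(i)$ is the predecessor of $i$ in $D\cup\{0,-1\}$, $\delta_i=\delta\,(i-\gamma(i))$, $\iota(i)=\lceil i\rceil$. For each grid a cost $O(\theta,u)$ of $\theta=(\theta_i)_{i\in D}$, $u=(u_1,\dots,u_N)$ is given. Put $$\bar P^g(\theta,L_2)=\bar p(\theta,L_2)+\sum_j\bar h^e_j(h^e_j(\theta),L_2)+\sum_j\bar h^i_j(h^i_j(\theta),L_2),\qquad \bar P(\theta,u,L_2)=\bar P^g(\theta,L_2)-g^T\theta+b(\theta,u),$$ $$\bar E_i=\tfrac1{2\delta_i^2}\big\|\theta_i-(1+\tfrac{\delta_i}{\delta_{\gamma(i)}})\theta_{\gamma(i)}+\tfrac{\delta_i}{\delta_{\gamma(i)}}\theta_{\gamma^2(i)}\big\|_M^2+\bar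 P(\theta_i,u_{\iota(i)},L_2),\qquad H^g_i=\tfrac12\Big\|\tfrac{\theta_i-\theta_{\gamma(i)}}{\delta_i}\Big\|_M^2+\bar P^g(\theta_i,L_2),$$ $r=(\partial\bar E_i/\partial\theta_i)_{i\in D}$, $A=\partial r/\partial\theta$ with diagonal blocks $A_{ii}$, $B=\partial r/\partial u$, $\Lambda=\frac12\|r\|^2$, $\psi_\rho=O+\rho\|r\|_1$, $H^g_0=\frac12\|(\theta_0-\theta_{-1})/\delta\|_M^2+p(\theta_0)$ and $c=(\|g\|+\|J\|L_{15})^2+\epsilon^2$. A function $f$ is $L$-curvature bounded if $f+\frac L2\|\cdot\|^2$ is convex and $\nabla f$ is $L$-Lipschitz. **Assumptions.** (1) For every grid, $O\ge0$ is $C^1$, $\partial O/\partial\theta$ and $\partial O/\partial u$ are locally Lipschitz, $\|\partial O/\partial\theta\|+\|\partial O/\partial u\|$ is bounded; $\mathcal X$ is compact, convex and non-empty. (2) For $L_2>0$ the functions $\bar p(\theta,L_2)$, $\bar h^e_j(h^e_j(\theta),L_2)$, $\bar h^i_j(h^i_j(\theta),L_2)$ of $\theta$ are curvature bounded with a bound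 polynomial in $L_2$, and twice differentiable with locally Lipschitz second derivatives; $p\ge0$, and $\bar p=p$ wherever $\bar p\le L_2$ or $p\le L_2$; $\bar h^e_j(x,L_2)$ is non-decreasing in $|x|$, has minimum $0$, and equals $L_2$ for $|x|=1/L_2$; $\bar h^i_j(x,L_2)$ is non-decreasing in $\max(1/L_2-x,0)$, has minimum $0$, and equals $L_2$ at $x=0$. (3) For $u\in\mathcal X$, $b(\cdot,u)$ is curvature bounded with a bound independent of $u$; $\partial b/\partial\theta$ exists and is differentiable in $(\theta,u)$ with locally Lipschitz derivative, and $\partial^2b/\partial\theta\partial u$ is bounded. (4) $h^e(\theta_0)=0$ (including $R^TR=I$, $\det R=1$ for all rotations) and $h^i(\theta_0)>0$. **Algorithm.** Parameters: $L_3,L_4,L_{10}>0$, $L_5\ge1$, $\epsilon,\eta,\alpha\in(0,1)$, and any $L_2>\max(1/\min_jh^i_j(\theta_0),\,p(\theta_0),\,1/\epsilon,\,L_{14}^N)$ where $L_{14}^N=e^{6N\delta/\sigma_{\min}(M)}[H^g_0+cN\delta]$. Let $\epsilon'=2^{2/3}\epsilon/9$ if there are rotations and $\epsilon'=\epsilon$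 otherwise. To subdivide at $i$ means to add $(i+\gamma(i))/2$ to the grid with configuration $(\theta_i+\theta_{\gamma(i)})/2$. Start from $D=\{1,\dots,N\}$, arbitrary $\theta$, arbitrary $u_k\in\mathcal X$ and $\rho=0$, and repeat: call SQP; then, if for some $i\in D$ either $H^g_i>e^{6\delta_i/\sigma_{\min}(M)}(H^g_{\gamma(i)}+c\,\delta_i)$ or $\mathrm{sgn}\det R(\theta_i)\ne\mathrm{sgn}\det R(\theta_{\gamma(i)})$ for some rotation, subdivide at the first such $i$ and go on with the next call; otherwise return. *SQP:* while $\|r\|_1\ge L_4$ run Constraint-Solve, otherwise run SQP-Inner; when either of them returns an index $i$, subdivide at $i$ and continue; when SQP-Inner returns normally, return. *Constraint-Solve:* repeat: if $\sigma_{\min}(A_{ii})<L_3$ for some $i$, return the first such $i$; if $\|r\|_1<L_4$, return; let $d=-A^{-1}r$ and replace $\theta$ by $\theta+\eta^jd$ with the smallest $j\ge1$ such that $\Lambda(\theta+\eta^jd)<(1-2\alpha\eta^j)\Lambda(\theta)$. *SQP-Inner:* repeat: if $\sigma_{\min}(A_{ii})<L_3$ for some $i$, return the first such $i$; choose any symmetric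 positive definite $H_\theta,H_u$ with all singular values in $[1/L_5,L_5]$; let $d=(d_\theta,d_u)$ be the solution of $\min d_\theta^T\frac{\partial O}{\partial\theta}+d_u^T\frac{\partial O}{\partial u}+\frac12d_\theta^TH_\theta d_\theta+\frac12d_u^TH_ud_u$ subject to $r+Ad_\theta+Bd_u=0$, $u_k+d_{u_k}\in\mathcal X$, with multiplier $\mu$ of the equality constraint; if $\|d\|<\epsilon'/L_5$ and $\|r\|_1<\epsilon'$, return normally; set $\rho\leftarrow\max(\rho,\max_i\|\mu_i\|+L_{10})$ and replace $(\theta,u)$ by $(\theta,u)+\eta^jd$ with the smallest $j\ge1$ such that $\psi_\rho$ at the new point is less than $\psi_\rho-\alpha\eta^j(\frac1{L_5}\|d\|^2+L_{10}\|r\|_1)$ and, if $\|r\|_1>L_4$, $\|r\|_1$ does not increase. **Theorem.** Assume (1)–(4). Then $\bar P(\cdot,u,L_2)$, $u\in\mathcal X$, has a positive curvature bound that is a polynomial of $L_2$. For all parameters as above: (i) From every initial guess the algorithm is well defined (each step can be carried out) and terminates after finitely many iterations, whatever choices of $H_\theta,H_u$ are made. If $L>0$ is a curvature bound of $\bar P(\cdot,u,L_2)$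 for all $u\in\mathcal X$ and $$L_{16}=\min\Big[\sqrt{\tfrac{\sigma_{\min}(M)}{L_3+L}},\ \tfrac1L,\ \tfrac{\sigma_{\min}(M)}6,\ \sqrt{\tfrac{2\sigma_{\min}(M)}{L_{14}^N}}(1-\epsilon)\Big],$$ then $L_{16}>0$ and at most $\big(2^{\max(0,\lceil\log_2(\delta/L_{16})\rceil)}-1\big)N+1$ calls to SQP are made. (ii) The sequence of all penalty coefficients $\rho$ generated is bounded, by a constant that depends on the problem and the parameters but not on the initial guess or on the choices made. -/

import Mathlib

open scoped InnerProductSpace Kronecker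

noncomputable section

namespace WhiteBoxTO

/-! ### Elementary notions -/

/-- The configuration space `ℝⁿ` (also used for the space of one control signal). -/
abbrev Vec (n : ℕ) := EuclideanSpace ℝ (Fin n)

/-- Concatenated variables: `m` blocks from `ℝⁿ`, with the Euclidean norm. -/
abbrev Blocks (m n : ℕ) := PiLp 2 (fun _ : Fin m => Vec n)

/-- Smallest singular value of a linear operator, `min_{‖x‖ = 1} ‖A x‖`. -/
def sigmaMin {n : ℕ} (A : Vec n →L[ℝ] Vec n) : ℝ :=
  sInf ((fun x => ‖A x‖) '' Metric.sphere (0 : Vec n) 1)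

/-- `f` is `L`-curvature bounded: `L`-weakly convex and with `L`-Lipschitz gradient. -/
def CurvatureBounded {n : ℕ} (L : ℝ) (f : Vec n → ℝ) : Prop :=
  ConvexOn ℝ Set.univ (fun x => f x + L / 2 * ‖x‖ ^ 2) ∧
    ∀ x y, ‖gradient f x - gradient f y‖ ≤ L * ‖x - y‖

/-- `f` is twice differentiable and its second derivative is locally Lipschitz. -/
def TwiceDiffLip {n : ℕ} (f : Vec n → ℝ) : Prop :=
  Differentiable ℝ f ∧ Differentiable ℝ (fderiv ℝ f) ∧
    LocallyLipschitz (fderiv ℝ (fderiv ℝ f))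

/-- The normal cone of `X` at `x`, written `∂X(x)`. -/
def normalCone {n : ℕ} (X : Set (Vec n)) (x : Vec n) : Set (Vec n) :=
  {μ | ∀ y ∈ X, ⟪μ, y - x⟫_ℝ ≤ 0}

/-- `before x f i` is the predecessor of the `i`-th entry in the sequence `x, f 0, f 1, …`. -/
def before {α : Type*} {m : ℕ} (x : α) (f : Fin m → α) (i : Fin m) : α :=
  (Fin.cons x f : Fin (m + 1) → α) i.castSucc

/-- The `3 × 3` matrix that sits in `θ` as a sub-vector of nine entries. -/
def subMatrix {n : ℕ} (e : Fin 3 × Fin 3 ↪ Fin n) (θ : Vec n) : Matrix (Fin 3) (Fin 3) ℝ :=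
  Matrix.of fun a c => θ (e (a, c))

/-- Frobenius norm. -/
def frob (A : Matrix (Fin 3) (Fin 3) ℝ) : ℝ := Real.sqrt (∑ a, ∑ c, A a c ^ 2)

/-- Rotation about the `X`-axis. -/
def rotX (t : ℝ) : Matrix (Fin 3) (Fin 3) ℝ :=
  !![1, 0, 0; 0, Real.cos t, -Real.sin t; 0, Real.sin t, Real.cos t]

/-! ### Time grids -/

/-- The ordered set of time indices `t 0 < t 1 < … ⊂ (0, N]` of the decision variables. It contains
the integers `1, …, N`; the index `t` stands for the time instance `δ t`. -/
structure Grid (N : ℕ) where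
  m : ℕ
  t : Fin m → ℝ
  strictMono : StrictMono t
  pos : ∀ i, 0 < t i
  le : ∀ i, t i ≤ N
  nodes : ∀ k : Fin N, ∃ i, t i = (k : ℝ) + 1

namespace Grid

variable {N : ℕ}

/-- The user's grid `1, …, N`. -/
def uniform (N : ℕ) : Grid N where
  m := N
  t := fun k => (k : ℝ) + 1
  strictMono := fun a c h => by
    have : (a : ℝ) < (c : ℝ) := by exact_mod_cast h
    linarith
  pos := fun i => by positivity
  le := fun i => by exact_mod_cast i.isLt
  nodes := fun k => ⟨k, rfl⟩

theorem before_nonneg (G : Grid N) (i : Fin G.m) : 0 ≤ before 0 G.t i := by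
  obtain ⟨i, hi⟩ := i
  cases i with
  | zero => simp [before]
  | succ k => exact (G.pos ⟨k, by omega⟩).le

theorem before_lt (G : Grid N) (i : Fin G.m) : before 0 G.t i < G.t i := by
  obtain ⟨i, hi⟩ := i
  cases i with
  | zero => simpa [before] using G.pos ⟨0, hi⟩
  | succ k => exact G.strictMono (a := ⟨k, by omega⟩) (b := ⟨k + 1, hi⟩) (by simp)

theorem le_before (G : Grid N) {i j : Fin G.m} (h : j < i) : G.t j ≤ before 0 G.t i := by
  obtain ⟨i, hi⟩ := i
  cases i with
  | zero => exact absurd h (Nat.not_lt_zero _)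
  | succ k =>
    refine G.strictMono.monotone (a := j) (b := ⟨k, by omega⟩) ?_
    have : (j : ℕ) < k + 1 := h
    exact Fin.mk_le_mk.2 (by omega)

/-- Midpoint of the `i`-th time index and its predecessor. -/
def mid (G : Grid N) (i : Fin G.m) : ℝ := (G.t i + before 0 G.t i) / 2

/-- Insert the midpoint in front of the `i`-th time index. -/
def subdivide (G : Grid N) (i : Fin G.m) : Grid N where
  m := G.m + 1
  t := i.castSucc.insertNth (G.mid i) G.t
  strictMono := by
    have h1 := G.before_lt i
    intro a c hac
    refine Fin.succAboveCases i.castSucc (fun hac => ?_) (fun a hac => ?_) a hac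
    · revert hac
      refine Fin.succAboveCases i.castSucc (fun hac => absurd hac (lt_irrefl _)) (fun c hac => ?_) c
      rw [Fin.insertNth_apply_same, Fin.insertNth_apply_succAbove]
      have hic : i ≤ c := by
        by_contra hlt
        push Not at hlt
        rw [Fin.succAbove_of_castSucc_lt _ _ (by simpa using hlt)] at hac
        exact absurd hac (by simpa using hlt.le)
      have := G.strictMono.monotone hic
      unfold mid
      linarith
    · revert hac
      refine Fin.succAboveCases i.castSucc (fun hac => ?_) (fun c hac => ?_) c
      · rw [Fin.insertNth_apply_same, Fin.insertNth_apply_succAbove]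
        have hai : a < i := by
          by_contra hle
          push Not at hle
          rw [Fin.succAbove_of_le_castSucc _ _ (by simpa using hle)] at hac
          have h2 : (a : ℕ) + 1 < i := hac
          have h3 : (i : ℕ) ≤ a := hle
          omega
        have := G.le_before hai
        unfold mid
        linarith
      · rw [Fin.insertNth_apply_succAbove, Fin.insertNth_apply_succAbove]
        exact G.strictMono ((Fin.strictMono_succAbove _).lt_iff_lt.1 hac)
  pos := fun j => by
    refine Fin.succAboveCases i.castSucc ?_ (fun j => ?_) j
    · rw [Fin.insertNth_apply_same]
      have := G.before_nonneg i
      have := G.pos i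
      unfold mid
      linarith
    · rw [Fin.insertNth_apply_succAbove]
      exact G.pos j
  le := fun j => by
    refine Fin.succAboveCases i.castSucc ?_ (fun j => ?_) j
    · rw [Fin.insertNth_apply_same]
      have := G.before_lt i
      have := G.le i
      unfold mid
      linarith
    · rw [Fin.insertNth_apply_succAbove]
      exact G.le j
  nodes := fun k => by
    obtain ⟨j, hj⟩ := G.nodes k
    exact ⟨i.castSucc.succAbove j, by rw [Fin.insertNth_apply_succAbove, hj]⟩

/-- The index `ι(i) = ⌈t_i⌉ ∈ {1, …, N}` of the control signal in force, shifted to start at `0`. -/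
def ctrlIdx (G : Grid N) (i : Fin G.m) : Fin N :=
  ⟨⌈G.t i⌉₊ - 1, by
    have h1 : 0 < ⌈G.t i⌉₊ := Nat.ceil_pos.2 (G.pos i)
    have h2 : ⌈G.t i⌉₊ ≤ N := Nat.ceil_le.2 (G.le i)
    omega⟩

/-- The timestep sizes `δ_i`. -/
def step (G : Grid N) (δ : ℝ) (i : Fin G.m) : ℝ := δ * (G.t i - before 0 G.t i)

end Grid

/-! ### Control methods -/

/-- The three control methods. For cables and PD control there is one scalar signal per cable or
joint. -/
inductive Controller (n mu : ℕ)
  /-- `b(θ,u) = -θᵀ J u`. -/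
  | force (J : Vec mu →L[ℝ] Vec n)
  /-- `b(θ,u) = ∑ₗ uₗ √(‖(Xᵃₗ θ + tᵃₗ) - (Xᵇₗ θ + tᵇₗ)‖² + ε_r)`. -/
  | cable (Xa Xb : Fin mu → Vec n →L[ℝ] Vec 3) (ta tb : Fin mu → Vec 3) (εr : ℝ) (hεr : 0 < εr)
  /-- `b(θ,u) = -∑ₗ tr((Rᵃₗ)ᵀ Rᵇₗ R_x(uₗ)ᵀ) / (√(‖Rᵃₗ‖²+ε_r) √(‖Rᵇₗ‖²+ε_r))`. -/
  | pd (Ra Rb : Fin mu → (Fin 3 × Fin 3 ↪ Fin n)) (εr : ℝ) (hεr : 0 < εr)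

namespace Controller

variable {n mu : ℕ}

/-- The control energy `b(θ,u)`. -/
def b : Controller n mu → Vec n → Vec mu → ℝ
  | force J, θ, u => -⟪θ, J u⟫_ℝ
  | cable Xa Xb ta tb εr _, θ, u =>
      ∑ l, u l * Real.sqrt (‖(Xa l θ + ta l) - (Xb l θ + tb l)‖ ^ 2 + εr)
  | pd Ra Rb εr _, θ, u =>
      -∑ l, ((subMatrix (Ra l) θ).transpose * subMatrix (Rb l) θ * (rotX (u l)).transpose).trace /
        (Real.sqrt (frob (subMatrix (Ra l) θ) ^ 2 + εr) *
          Real.sqrt (frob (subMatrix (Rb l) θ) ^ 2 + εr))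

/-- The norm `‖J‖` of the control matrix of the method (`J`, `Xᵃ - Xᵇ`, or `4 I / √ε_r`). -/
def normJ : Controller n mu → ℝ
  | force J => ‖J‖
  | cable Xa Xb _ _ _ _ => ∑ l, ‖Xa l - Xb l‖
  | pd _ _ εr _ => ∑ _l : Fin mu, 4 / Real.sqrt εr

/-- `L₁₅` bounds the size of the control over `X`: `‖u‖` for forces and cables; for PD control the
operator norm of the `9 × 9` matrix `A(u)` with `tr(Rᵃᵀ Rᵇ R_x(u)ᵀ) = ⟨Rᵃ, A(u) Rᵇ⟩`. -/
def IsSizeBound : Controller n mu → Set (Vec mu) → ℝ → Prop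
  | force _, X, L15 => ∀ u ∈ X, ‖u‖ ≤ L15
  | cable _ _ _ _ _ _, X, L15 => ∀ u ∈ X, ‖u‖ ≤ L15
  | pd _ _ _ _, X, L15 => ∀ u ∈ X, ∀ l,
      ‖Matrix.toEuclideanCLM (𝕜 := ℝ) ((1 : Matrix (Fin 3) (Fin 3) ℝ) ⊗ₖ rotX (u l))‖ ≤ L15

end Controller

/-! ### The trajectory optimization problem -/

/-- Data of a problem: `n = |𝒞|`, control signals in `ℝ^mu`, `N` frames, `me` (resp. `mi`) equality
(resp. inequality) constraints and, in addition, `nR` sub-matrices of `θ` constrained to `SO(3)`. -/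
structure Problem (n mu N me mi nR : ℕ) where
  /-- generalized mass matrix -/
  M : Matrix (Fin n) (Fin n) ℝ
  /-- constant external force -/
  g : Vec n
  /-- initial configuration -/
  θ₀ : Vec n
  /-- the configuration `θ_{-1}`, one timestep `δ` before `θ₀` -/
  θprev : Vec n
  /-- user's timestep size -/
  δ : ℝ
  /-- potential energy -/
  p : Vec n → ℝ
  /-- its relaxation `p̄(θ, L₂)` -/
  pbar : Vec n → ℝ → ℝ
  /-- general equality constraints `h = 0` -/
  he : Fin me → Vec n → ℝ
  /-- inequality constraints `h ≥ 0` -/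
  hi : Fin mi → Vec n → ℝ
  /-- positions of the rotation matrices in `θ` -/
  rot : Fin nR → (Fin 3 × Fin 3 ↪ Fin n)
  /-- penalties `h̄(x, L₂)` for the general equality and for the rotation constraints -/
  heBar : Fin me ⊕ Fin nR → ℝ → ℝ → ℝ
  /-- penalties `h̄(x, L₂)` for the inequality constraints -/
  hiBar : Fin mi → ℝ → ℝ → ℝ
  /-- control method -/
  ctrl : Controller n mu
  /-- feasible control signals -/
  X : Set (Vec mu)
  /-- cost of a discrete trajectory; its arguments are all configurations on the current grid and
  the `N` control signals -/
  O : (G : Grid N) → Blocks G.m n → Blocks N mu → ℝ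

namespace Problem

variable {n mu N me mi nR : ℕ} (P : Problem n mu N me mi nR)

/-- The penalized equality constraints: the general ones and `‖RᵀR - I‖_F = 0` for every rotation
(`det R = 1` is not penalized). -/
def heAll : Fin me ⊕ Fin nR → Vec n → ℝ
  | .inl j, θ => P.he j θ
  | .inr r, θ => frob ((subMatrix (P.rot r) θ).transpose * subMatrix (P.rot r) θ - 1)

/-- Assumption on the objective and the control space. -/
structure ObjectiveAssumption : Prop where
  nonneg : ∀ G θ u, (∀ k, u k ∈ P.X) → 0 ≤ P.O G θ u
  contDiff : ∀ G, ContDiff ℝ 1 (fun z : Blocks G.m n × Blocks N mu => P.O G z.1 z.2)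
  lipθ : ∀ G, LocallyLipschitz (fun z : Blocks G.m n × Blocks N mu =>
    gradient (fun θ => P.O G θ z.2) z.1)
  lipu : ∀ G, LocallyLipschitz (fun z : Blocks G.m n × Blocks N mu =>
    gradient (fun u => P.O G z.1 u) z.2)
  bounded : ∀ G, ∃ L1 : ℝ, ∀ θ u, (∀ k, u k ∈ P.X) →
    ‖gradient (fun θ => P.O G θ u) θ‖ + ‖gradient (fun u => P.O G θ u) u‖ ≤ L1
  compact : IsCompact P.X
  convex : Convex ℝ P.X
  nonempty : P.X.Nonempty

/-- A family `f(θ, L₂)`, `L₂ > 0`, is `poly(L₂)`-curvature bounded and twice differentiable in `θ`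
with locally Lipschitz second derivatives. -/
def RelaxedTerm (f : Vec n → ℝ → ℝ) : Prop :=
  (∃ q : Polynomial ℝ, ∀ L2 : ℝ, 0 < L2 → CurvatureBounded (q.eval L2) (fun θ => f θ L2)) ∧
    ∀ L2 : ℝ, 0 < L2 → TwiceDiffLip (fun θ => f θ L2)

/-- Assumption on the curvature-bounded relaxation. -/
structure RelaxationAssumption : Prop where
  pbar_term : RelaxedTerm P.pbar
  he_term : ∀ j, RelaxedTerm (fun θ L2 => P.heBar j (P.heAll j θ) L2)
  hi_term : ∀ j, RelaxedTerm (fun θ L2 => P.hiBar j (P.hi j θ) L2)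
  p_nonneg : ∀ θ, 0 ≤ P.p θ
  pbar_eq : ∀ L2 : ℝ, 0 < L2 → ∀ θ, (P.pbar θ L2 ≤ L2 ∨ P.p θ ≤ L2) → P.pbar θ L2 = P.p θ
  he_mono : ∀ j, ∀ L2 : ℝ, 0 < L2 → ∀ x y, |x| ≤ |y| → P.heBar j x L2 ≤ P.heBar j y L2
  he_min : ∀ j, ∀ L2 : ℝ, 0 < L2 → IsLeast (Set.range fun x => P.heBar j x L2) 0
  he_val : ∀ j, ∀ L2 : ℝ, 0 < L2 → ∀ x, |x| = 1 / L2 → P.heBar j x L2 = L2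
  hi_mono : ∀ j, ∀ L2 : ℝ, 0 < L2 → ∀ x y, max (1 / L2 - x) 0 ≤ max (1 / L2 - y) 0 →
    P.hiBar j x L2 ≤ P.hiBar j y L2
  hi_min : ∀ j, ∀ L2 : ℝ, 0 < L2 → IsLeast (Set.range fun x => P.hiBar j x L2) 0
  hi_val : ∀ j, ∀ L2 : ℝ, 0 < L2 → P.hiBar j 0 L2 = L2

/-- Assumption on the control energy `b`: for controls in `X` it is curvature bounded and twice
differentiable with locally Lipschitz second derivatives `∂²b/∂θ²` and `∂²b/∂θ∂u`, and the latter
is bounded. -/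
structure ControlAssumption : Prop where
  curv : ∃ L : ℝ, ∀ u ∈ P.X, CurvatureBounded L (fun θ => P.ctrl.b θ u)
  diff : ∀ u ∈ P.X, Differentiable ℝ (fun θ => P.ctrl.b θ u)
  diff2 : ∀ θ, ∀ u ∈ P.X, DifferentiableAt ℝ
    (fun z : Vec n × Vec mu => gradient (fun x => P.ctrl.b x z.2) z.1) (θ, u)
  lip2 : LocallyLipschitzOn (Set.univ ×ˢ P.X)
    (fderiv ℝ (fun z : Vec n × Vec mu => gradient (fun x => P.ctrl.b x z.2) z.1))
  mixed : ∃ B : ℝ, ∀ θ, ∀ u ∈ P.X,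
    ‖fderiv ℝ (fun v => gradient (fun x => P.ctrl.b x v) θ) u‖ ≤ B

/-- Slater's condition: `θ₀` satisfies all equality constraints (for rotations both `RᵀR = I` and
`det R = 1`) and all inequality constraints strictly. -/
structure SlaterAssumption : Prop where
  eq : ∀ j, P.heAll j P.θ₀ = 0
  det : ∀ r, (subMatrix (P.rot r) P.θ₀).det = 1
  ineq : ∀ j, 0 < P.hi j P.θ₀

/-! #### Energies -/

/-- The mass matrix as an operator. -/
def Mop : Vec n →L[ℝ] Vec n := Matrix.toEuclideanCLM (𝕜 := ℝ) P.M

/-- `‖x‖²_M = xᵀ M x`. -/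
def normSqM (x : Vec n) : ℝ := ⟪x, P.Mop x⟫_ℝ

/-- `P̄ᵍ(θ, L₂)`: relaxed potential and penalties, without the linear and the control term. -/
def PbarG (L2 : ℝ) (θ : Vec n) : ℝ :=
  P.pbar θ L2 + ∑ j, P.heBar j (P.heAll j θ) L2 + ∑ j, P.hiBar j (P.hi j θ) L2

/-- `P̄(θ, u, L₂)`. -/
def Pbar (L2 : ℝ) (u : Vec mu) (θ : Vec n) : ℝ :=
  P.PbarG L2 θ - ⟪P.g, θ⟫_ℝ + P.ctrl.b θ u

/-- `Ē(x, y, z, u, L₂)` with step sizes `d = δ_i` and `d' = δ_{γ(i)}`. -/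
def Ebar (L2 d d' : ℝ) (u : Vec mu) (y z x : Vec n) : ℝ :=
  1 / (2 * d ^ 2) * P.normSqM (x - (1 + d / d') • y + (d / d') • z) + P.Pbar L2 u x

variable (G : Grid N)

/-- The objective of the `i`-th timestep as a function of `θ_i`. -/
def stepEnergy (L2 : ℝ) (θ : Blocks G.m n) (u : Blocks N mu) (i : Fin G.m) : Vec n → ℝ :=
  P.Ebar L2 (G.step P.δ i) (before P.δ (G.step P.δ) i) (u (G.ctrlIdx i))
    (before P.θ₀ θ i) (before P.θprev (before P.θ₀ θ) i)

/-- `∇_{θ⋆}Λ`: the stacked gradients `∂Ē_i/∂θ_i`. -/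
def res (L2 : ℝ) (θ : Blocks G.m n) (u : Blocks N mu) : Blocks G.m n :=
  WithLp.toLp 2 fun i => gradient (P.stepEnergy G L2 θ u i) (θ i)

/-- `∇_{θ⋆θ}Λ`. -/
def jacθ (L2 : ℝ) (θ : Blocks G.m n) (u : Blocks N mu) : Blocks G.m n →L[ℝ] Blocks G.m n :=
  fderiv ℝ (fun θ => P.res G L2 θ u) θ

/-- `∇_{θ⋆u}Λ`. -/
def jacu (L2 : ℝ) (θ : Blocks G.m n) (u : Blocks N mu) : Blocks N mu →L[ℝ] Blocks G.m n :=
  fderiv ℝ (fun u => P.res G L2 θ u) u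

/-- The diagonal block `∂²Ē_i/∂θ_i²` of `∇_{θ⋆θ}Λ`. -/
def diagBlock (L2 : ℝ) (θ : Blocks G.m n) (u : Blocks N mu) (i : Fin G.m) :
    Vec n →L[ℝ] Vec n :=
  fderiv ℝ (gradient (P.stepEnergy G L2 θ u i)) (θ i)

/-- The constraint violation `‖∇_{θ⋆}Λ‖₁`. -/
def viol (L2 : ℝ) (θ : Blocks G.m n) (u : Blocks N mu) : ℝ :=
  ∑ i, ∑ j, |P.res G L2 θ u i j|

/-- `Λ = ∑_i ‖∂Ē_i/∂θ_i‖² / 2`. -/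
def Lam (L2 : ℝ) (θ : Blocks G.m n) (u : Blocks N mu) : ℝ :=
  ∑ i, ‖P.res G L2 θ u i‖ ^ 2 / 2

/-- The merit function `ψ_ρ = O + ρ ‖∇_{θ⋆}Λ‖₁`. -/
def merit (L2 ρ : ℝ) (θ : Blocks G.m n) (u : Blocks N mu) : ℝ :=
  P.O G θ u + ρ * P.viol G L2 θ u

/-- The Hamiltonian without linear and control terms,
`H^g = ½ ‖(x - y)/d‖²_M + P̄ᵍ(x, L₂)`. -/
def Hg (L2 d : ℝ) (x y : Vec n) : ℝ :=
  1 / 2 * P.normSqM (d⁻¹ • (x - y)) + P.PbarG L2 x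

/-- The value `½ ‖(θ₀ - θ_{-1})/δ‖²_M + p(θ₀)` of `H₀^g`, which does not depend on `L₂`. -/
def Hg₀ : ℝ := 1 / 2 * P.normSqM (P.δ⁻¹ • (P.θ₀ - P.θprev)) + P.p P.θ₀

end Problem

/-! ### The algorithm -/

/-- Parameters of the solver. -/
structure Params where
  L2 : ℝ
  L3 : ℝ
  L4 : ℝ
  L5 : ℝ
  L10 : ℝ
  L15 : ℝ
  ε : ℝ
  η : ℝ
  α : ℝ

namespace Problem

variable {n mu N me mi nR : ℕ} (P : Problem n mu N me mi nR) (S : Params)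

/-- The rate `(‖g‖ + ‖J‖ L₁₅)² + ε²` at which the energy may grow. -/
def growth : ℝ := (‖P.g‖ + P.ctrl.normJ * S.L15) ^ 2 + S.ε ^ 2

/-- `L₁₄^N = e^{6Nδ/σ_min(M)} [H₀^g + ((‖g‖ + ‖J‖ L₁₅)² + ε²) N δ]`. -/
def L14 : ℝ :=
  Real.exp (6 * N * P.δ / sigmaMin P.Mop) * (P.Hg₀ + P.growth S * (N * P.δ))

/-- `L₁₆`, for a curvature bound `L` of `P̄`. -/
def L16 (L : ℝ) : ℝ :=
  min (min (Real.sqrt (sigmaMin P.Mop / (S.L3 + L))) (1 / L))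
    (min (sigmaMin P.Mop / 6) (Real.sqrt (2 * sigmaMin P.Mop / P.L14 S) * (1 - S.ε)))

/-- Admissible parameters; in particular `L₂ > max(L₁₃, 1/ε, L₁₄^N)` where
`L₁₃ = max(1 / min_j h^i_j(θ₀), p(θ₀))`. -/
structure Admissible : Prop where
  L3_pos : 0 < S.L3
  L4_pos : 0 < S.L4
  one_le_L5 : 1 ≤ S.L5
  L10_pos : 0 < S.L10
  L15_bound : P.ctrl.IsSizeBound P.X S.L15
  ε_pos : 0 < S.ε
  ε_lt : S.ε < 1
  η_pos : 0 < S.η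
  η_lt : S.η < 1
  α_pos : 0 < S.α
  α_lt : S.α < 1
  L2_hi : ∀ j, 1 / P.hi j P.θ₀ < S.L2
  L2_p : P.p P.θ₀ < S.L2
  L2_ε : 1 / S.ε < S.L2
  L2_L14 : P.L14 S < S.L2

/-- The tolerance `ε'` for the SQP solver: `2^{2/3} ε / 9` if there are rotations, else `ε`. -/
def εSQP : ℝ := if nR = 0 then S.ε else (2 : ℝ) ^ (2 / 3 : ℝ) * S.ε / 9

variable (G : Grid N)

/-- The configurations after subdivision in front of the `i`-th one. -/
def subdivθ (θ : Blocks G.m n) (i : Fin G.m) : Blocks (G.subdivide i).m n :=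
  WithLp.toLp 2 (i.castSucc.insertNth ((1 / 2 : ℝ) • (θ i + before P.θ₀ θ i)) θ)

/-- The `i`-th diagonal block fails the singularity check. -/
def Singular (θ : Blocks G.m n) (u : Blocks N mu) (i : Fin G.m) : Prop :=
  sigmaMin (P.diagBlock G S.L2 θ u i) < S.L3

/-- Sufficient decrease of `Λ` for the step size `s` in the constraint solver. -/
def Wolfe (θ d : Blocks G.m n) (u : Blocks N mu) (s : ℝ) : Prop :=
  P.Lam G S.L2 (θ + s • d) u < (1 - 2 * S.α * s) * P.Lam G S.L2 θ u

/-- `H` is symmetric with all singular values in `[1/L₅, L₅]` and positive definite. -/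
def HessianOK {E : Type*} [NormedAddCommGroup E] [InnerProductSpace ℝ E]
    (L5 : ℝ) (H : E →L[ℝ] E) : Prop :=
  (H : E →ₗ[ℝ] E).IsSymmetric ∧ ∀ x, 1 / L5 * ‖x‖ ^ 2 ≤ ⟪x, H x⟫_ℝ ∧ ⟪x, H x⟫_ℝ ≤ L5 * ‖x‖ ^ 2

/-- Objective of the quadratic program. -/
def qpObj (θ : Blocks G.m n) (u : Blocks N mu) (Hθ : Blocks G.m n →L[ℝ] Blocks G.m n)
    (Hu : Blocks N mu →L[ℝ] Blocks N mu) (dθ : Blocks G.m n) (du : Blocks N mu) : ℝ :=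
  ⟪dθ, gradient (fun θ => P.O G θ u) θ⟫_ℝ + ⟪du, gradient (fun u => P.O G θ u) u⟫_ℝ +
    1 / 2 * ⟪dθ, Hθ dθ⟫_ℝ + 1 / 2 * ⟪du, Hu du⟫_ℝ

/-- Feasible points of the quadratic program. -/
def QPFeasible (θ : Blocks G.m n) (u : Blocks N mu) (dθ : Blocks G.m n) (du : Blocks N mu) :
    Prop :=
  P.res G S.L2 θ u + P.jacθ G S.L2 θ u dθ + P.jacu G S.L2 θ u du = 0 ∧ ∀ k, u k + du k ∈ P.X

/-- `(dθ, du)` solves the quadratic program, and `μθ` is a multiplier of its equality constraint. -/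
def QPSolution (θ : Blocks G.m n) (u : Blocks N mu) (Hθ : Blocks G.m n →L[ℝ] Blocks G.m n)
    (Hu : Blocks N mu →L[ℝ] Blocks N mu) (dθ : Blocks G.m n) (du : Blocks N mu)
    (μθ : Blocks G.m n) : Prop :=
  P.QPFeasible S G θ u dθ du ∧
  (∀ eθ eu, P.QPFeasible S G θ u eθ eu →
    P.qpObj G θ u Hθ Hu dθ du ≤ P.qpObj G θ u Hθ Hu eθ eu) ∧
  gradient (fun θ => P.O G θ u) θ + Hθ dθ +
    ContinuousLinearMap.adjoint (P.jacθ G S.L2 θ u) μθ = 0 ∧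
  ∃ μu : Blocks N mu,
    gradient (fun u => P.O G θ u) u + Hu du +
      ContinuousLinearMap.adjoint (P.jacu G S.L2 θ u) μθ + μu = 0 ∧
    ∀ k, μu k ∈ normalCone P.X (u k + du k)

/-- `‖d_{θu}‖`. -/
def normD (dθ : Blocks G.m n) (du : Blocks N mu) : ℝ := Real.sqrt (‖dθ‖ ^ 2 + ‖du‖ ^ 2)

/-- The termination test of the inner solver. -/
def Converged (θ : Blocks G.m n) (u : Blocks N mu) (dθ : Blocks G.m n) (du : Blocks N mu) :
    Prop :=
  normD G dθ du < εSQP (nR := nR) S / S.L5 ∧ P.viol G S.L2 θ u < εSQP (nR := nR) S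

/-- The line search condition of the inner solver for the step size `s`. -/
def LineSearch (ρ : ℝ) (θ : Blocks G.m n) (u : Blocks N mu) (dθ : Blocks G.m n)
    (du : Blocks N mu) (s : ℝ) : Prop :=
  P.merit G S.L2 ρ (θ + s • dθ) (u + s • du) <
      P.merit G S.L2 ρ θ u +
        S.α * s * (-(1 / S.L5) * normD G dθ du ^ 2 - S.L10 * P.viol G S.L2 θ u) ∧
    (S.L4 < P.viol G S.L2 θ u →
      P.viol G S.L2 (θ + s • dθ) (u + s • du) ≤ P.viol G S.L2 θ u)

/-- The final checks of the solver fail at the `i`-th configuration: the energy grew too much, or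
the determinant of some rotation changed its sign. -/
def CheckFails (θ : Blocks G.m n) (i : Fin G.m) : Prop :=
  P.Hg S.L2 (G.step P.δ i) (θ i) (before P.θ₀ θ i) >
      Real.exp (6 * G.step P.δ i / sigmaMin P.Mop) *
        (P.Hg S.L2 (before P.δ (G.step P.δ) i) (before P.θ₀ θ i) (before P.θprev (before P.θ₀ θ) i) +
          P.growth S * G.step P.δ i) ∨
    ∃ r, SignType.sign (subMatrix (P.rot r) (θ i)).det ≠
      SignType.sign (subMatrix (P.rot r) (before P.θ₀ θ i)).det

end Problem

/-- Program counter: head of the loop of SQP, head of the loop of Constraint-Solve, head of the loop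
of SQP-Inner, checks after SQP has returned, and termination of the whole solver. -/
inductive Phase
  | sqp
  | solve
  | inner
  | check
  | done

/-- State of a run: program counter, grid, configurations, controls, penalty coefficient `ρ`, and
the number of calls to SQP made so far (including the one under way). -/
structure State (n mu N : ℕ) where
  phase : Phase
  G : Grid N
  θ : Blocks G.m n
  u : Blocks N mu
  ρ : ℝ
  calls : ℕ

namespace Problem

variable {n mu N me mi nR : ℕ} (P : Problem n mu N me mi nR) (S : Params)

/-- One iteration of the loop that the program counter points to. The choice of `Hθ`, `Hu` is free;
`IsLeast` selects the first index in a `for` loop and the smallest exponent in a line search. -/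
inductive Step : State n mu N → State n mu N → Prop
  /-- SQP: the violation is too large, call Constraint-Solve. -/
  | toSolve {G θ u ρ K} (hv : S.L4 ≤ P.viol G S.L2 θ u) :
      Step ⟨.sqp, G, θ, u, ρ, K⟩ ⟨.solve, G, θ, u, ρ, K⟩
  /-- SQP: otherwise call SQP-Inner. -/
  | toInner {G θ u ρ K} (hv : P.viol G S.L2 θ u < S.L4) :
      Step ⟨.sqp, G, θ, u, ρ, K⟩ ⟨.inner, G, θ, u, ρ, K⟩
  /-- Constraint-Solve returns an index, where SQP subdivides. -/
  | solveSubdivide {G θ u ρ K} (i : Fin G.m) (hs : IsLeast {i | P.Singular S G θ u i} i) :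
      Step ⟨.solve, G, θ, u, ρ, K⟩ ⟨.sqp, G.subdivide i, P.subdivθ G θ i, u, ρ, K⟩
  /-- Constraint-Solve returns normally. -/
  | solveReturn {G θ u ρ K} (hs : ∀ i, ¬ P.Singular S G θ u i)
      (hv : P.viol G S.L2 θ u < S.L4) :
      Step ⟨.solve, G, θ, u, ρ, K⟩ ⟨.sqp, G, θ, u, ρ, K⟩
  /-- Constraint-Solve makes a Newton step. -/
  | solveNewton {G θ u ρ K} (hs : ∀ i, ¬ P.Singular S G θ u i)
      (hv : S.L4 ≤ P.viol G S.L2 θ u) (d : Blocks G.m n)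
      (hd : P.jacθ G S.L2 θ u d = -P.res G S.L2 θ u) (j : ℕ)
      (hj : IsLeast {j : ℕ | 1 ≤ j ∧ P.Wolfe S G θ d u (S.η ^ j)} j) :
      Step ⟨.solve, G, θ, u, ρ, K⟩ ⟨.solve, G, θ + S.η ^ j • d, u, ρ, K⟩
  /-- SQP-Inner returns an index, where SQP subdivides. -/
  | innerSubdivide {G θ u ρ K} (i : Fin G.m) (hs : IsLeast {i | P.Singular S G θ u i} i) :
      Step ⟨.inner, G, θ, u, ρ, K⟩ ⟨.sqp, G.subdivide i, P.subdivθ G θ i, u, ρ, K⟩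
  /-- SQP-Inner, and with it SQP, returns normally. -/
  | innerReturn {G θ u ρ K} (hs : ∀ i, ¬ P.Singular S G θ u i)
      (Hθ : Blocks G.m n →L[ℝ] Blocks G.m n) (Hu : Blocks N mu →L[ℝ] Blocks N mu)
      (hHθ : HessianOK S.L5 Hθ) (hHu : HessianOK S.L5 Hu)
      (dθ : Blocks G.m n) (du : Blocks N mu) (μ : Blocks G.m n)
      (hqp : P.QPSolution S G θ u Hθ Hu dθ du μ) (hc : P.Converged S G θ u dθ du) :
      Step ⟨.inner, G, θ, u, ρ, K⟩ ⟨.check, G, θ, u, ρ, K⟩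
  /-- SQP-Inner updates the penalty coefficient and makes a step. -/
  | innerStep {G θ u ρ K} (hs : ∀ i, ¬ P.Singular S G θ u i)
      (Hθ : Blocks G.m n →L[ℝ] Blocks G.m n) (Hu : Blocks N mu →L[ℝ] Blocks N mu)
      (hHθ : HessianOK S.L5 Hθ) (hHu : HessianOK S.L5 Hu)
      (dθ : Blocks G.m n) (du : Blocks N mu) (μ : Blocks G.m n)
      (hqp : P.QPSolution S G θ u Hθ Hu dθ du μ) (hc : ¬ P.Converged S G θ u dθ du)
      (ρ' : ℝ) (hρ : ρ' = max ρ ((⨆ i, ‖μ i‖) + S.L10)) (j : ℕ)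
      (hj : IsLeast {j : ℕ | 1 ≤ j ∧ P.LineSearch S G ρ' θ u dθ du (S.η ^ j)} j) :
      Step ⟨.inner, G, θ, u, ρ, K⟩ ⟨.inner, G, θ + S.η ^ j • dθ, u + S.η ^ j • du, ρ', K⟩
  /-- A check fails: subdivide there and call SQP again. -/
  | checkFail {G θ u ρ K} (i : Fin G.m) (hi : IsLeast {i | P.CheckFails S G θ i} i) :
      Step ⟨.check, G, θ, u, ρ, K⟩ ⟨.sqp, G.subdivide i, P.subdivθ G θ i, u, ρ, K + 1⟩
  /-- All checks pass: return. -/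
  | checkPass {G θ u ρ K} (h : ∀ i, ¬ P.CheckFails S G θ i) :
      Step ⟨.check, G, θ, u, ρ, K⟩ ⟨.done, G, θ, u, ρ, K⟩

/-- The state at the first call to SQP: the user's grid and initial guess, `ρ = 0`. -/
def start (θ : Blocks N n) (u : Blocks N mu) : State n mu N :=
  ⟨.sqp, Grid.uniform N, θ, u, 0, 1⟩

/-- `s` occurs in some run of the solver from the initial guess `θ`, `u`. -/
def Reachable (θ : Blocks N n) (u : Blocks N mu) (s : State n mu N) : Prop :=
  Relation.ReflTransGen (P.Step S) (start θ u) s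

end Problem

end WhiteBoxTO

end

namespace WhiteBoxTO

open Filter Topology

/-! ### Smallest singular values -/

section SigmaMin
variable {n : ℕ}

/-! The proof combines a lower bound on the timesteps that are ever subdivided, termination of both
inner loops on a fixed grid, and finiteness of the set of grids.

Subdivision occurs only at steps longer than `L16`. A diagonal block is `M/δᵢ²` plus the Hessian of
`P̄`, which is at least `-L`; so a short step passes the singularity test (`lt_step_of_singular`).
For the final checks (`lt_step_of_checkFails`), pair the residual, of norm at most `ε`, with the
velocity. Weak convexity of `P̄` and the Lipschitz bound `‖J‖ L₁₅` for `b` then give a discrete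
Gronwall step (`Hg_le_of_residual`), so the energy test cannot fail at a short step. At the first
failing index all energy tests up to there hold, hence `Hᵍ ≤ L₁₄ < L₂`. The penalties therefore keep
`RᵀR` within `ε` of the identity, and the kinetic energy keeps neighbouring configurations within
`2(1-ε)`. Then no matrix on the segment joining the two rotation blocks is singular, and their
determinants have the same sign (`sign_det_eq_of_frob`).

Starting from unit gaps, all gaps are thus `2^{-k}` with `k ≤ K = ⌈log₂(δ/L₁₆)⌉₊`. The grid has at
most `N·2^K` points, so at most `(2^K - 1)N` subdivisions occur. Every SQP call but the first is
paid for by one of them, and only finitely many grids can arise.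

On a fixed grid the Jacobian is block lower triangular with constant off-diagonal blocks. Where the
singularity test passes, its inverse is bounded uniformly in the state (`exists_norm_le_norm_jacθ`),
and so are search directions and multipliers as long as the violation is bounded. If a loop ran for
ever, sufficient decrease would make its step sizes summable, and its iterates would converge. Near
the limit, continuity of the derivative makes all small steps acceptable, even the rejected trial
just before the accepted one (`false_of_backtracking`). The potential is `Λ` for Constraint-Solve
and `ψ_ρ + V(B - ρ)` for SQP-Inner, where the second term compensates for increases of `ρ`. A
natural number `rank` that no step increases, and that all steps except loop iterations decrease,
excludes infinite runs.

For `ρ`: SQP-Inner starts with violation below `L₄`. One step from a violation of at most `L₄` adds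
a bounded amount, and above `L₄` the line search forbids growth. This bounds the multipliers on each
grid, and finitely many grids give one bound. -/

theorem sphere_nonempty (hn : 0 < n) : (Metric.sphere (0 : Vec n) 1).Nonempty :=
  ⟨EuclideanSpace.single ⟨0, hn⟩ 1, by simp⟩

theorem sigmaMin_mul_norm_le (A : Vec n →L[ℝ] Vec n) (x : Vec n) : sigmaMin A * ‖x‖ ≤ ‖A x‖ := by
  rcases eq_or_ne x 0 with rfl | hx
  · simp
  have hx' : 0 < ‖x‖ := norm_pos_iff.2 hx
  have h : sigmaMin A ≤ ‖A (‖x‖⁻¹ • x)‖ := by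
    refine csInf_le ⟨0, ?_⟩ ⟨_, ?_, rfl⟩
    · rintro _ ⟨y, -, rfl⟩
      positivity
    · simp [norm_smul, hx'.ne']
  rw [map_smul, norm_smul, norm_inv, norm_norm] at h
  calc sigmaMin A * ‖x‖ ≤ ‖x‖⁻¹ * ‖A x‖ * ‖x‖ := by gcongr
    _ = ‖A x‖ := by field_simp

/-- Cauchy–Schwarz on the unit sphere; `A` need not be symmetric. Positivity of `n` matters because
`sInf ∅ = 0`. -/
theorem le_sigmaMin (hn : 0 < n) {A : Vec n →L[ℝ] Vec n} {c : ℝ}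
    (h : ∀ x, c * ‖x‖ ^ 2 ≤ ⟪x, A x⟫_ℝ) : c ≤ sigmaMin A := by
  refine le_csInf ((sphere_nonempty hn).image _) ?_
  rintro _ ⟨x, hx, rfl⟩
  have hx : ‖x‖ = 1 := by simpa using hx
  have h1 := h x
  have h2 := real_inner_le_norm x (A x)
  simp only [hx] at h1 h2
  linarith

/-- For a symmetric positive semidefinite operator the smallest singular value bounds the Rayleigh
quotient from below. -/
theorem sigmaMin_mul_sq_le (hn : 0 < n) {A : Vec n →L[ℝ] Vec n} (hA : (A : Vec n →ₗ[ℝ] Vec n).IsSymmetric)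
    (hpos : ∀ x, 0 ≤ ⟪x, A x⟫_ℝ) (x : Vec n) : sigmaMin A * ‖x‖ ^ 2 ≤ ⟪x, A x⟫_ℝ := by
  -- A minimizer of the quadratic form on the sphere is an eigenvector. Its eigenvalue `lam` is the
  -- minimum, and `sigmaMin A ≤ ‖A x₀‖ = lam`.
  obtain ⟨x₀, hx₀, hmin⟩ := (isCompact_sphere (0 : Vec n) 1).exists_isMinOn (sphere_nonempty hn)
    (f := fun x => ⟪x, A x⟫_ℝ) (by fun_prop)
  have hx₀1 : ‖x₀‖ = 1 := by simpa using hx₀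
  have hsa : IsSelfAdjoint A := hA.isSelfAdjoint
  have hx₀0 : x₀ ≠ 0 := by
    rintro rfl
    simp at hx₀1
  have hmin' : IsMinOn A.reApplyInnerSelf (Metric.sphere (0 : Vec n) ‖x₀‖) x₀ := by
    rw [hx₀1]
    intro y hy
    have := hmin hy
    simpa [ContinuousLinearMap.reApplyInnerSelf, real_inner_comm] using this
  have hev := hsa.hasEigenvector_of_isMinOn hx₀0 hmin'
  have heq := hev.apply_eq_smul
  set lam := (⨅ x : { x : Vec n // x ≠ 0 }, A.rayleighQuotient x) with hlam
  have hAx : A x₀ = lam • x₀ := by simpa using heq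
  have hval : ⟪x₀, A x₀⟫_ℝ = lam := by
    rw [hAx, real_inner_smul_right, real_inner_self_eq_norm_sq, hx₀1]
    ring
  have hlam0 : 0 ≤ lam := hval ▸ hpos x₀
  have hs : sigmaMin A ≤ lam := by
    have := sigmaMin_mul_norm_le A x₀
    rw [hAx, norm_smul, hx₀1, Real.norm_of_nonneg hlam0] at this
    linarith
  rcases eq_or_ne x 0 with rfl | hx
  · simp
  have hx' : 0 < ‖x‖ := norm_pos_iff.2 hx
  have h1 : ⟪x₀, A x₀⟫_ℝ ≤ ⟪‖x‖⁻¹ • x, A (‖x‖⁻¹ • x)⟫_ℝ :=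
    hmin (show ‖x‖⁻¹ • x ∈ Metric.sphere (0 : Vec n) 1 by simp [norm_smul, hx'.ne'])
  rw [hval, map_smul, real_inner_smul_left, real_inner_smul_right] at h1
  calc sigmaMin A * ‖x‖ ^ 2 ≤ (‖x‖⁻¹ * (‖x‖⁻¹ * ⟪x, A x⟫_ℝ)) * ‖x‖ ^ 2 := by
        gcongr
        linarith
    _ = _ := by field_simp

theorem sigmaMin_pos (hn : 0 < n) {A : Vec n →L[ℝ] Vec n} (h : ∀ x, A x = 0 → x = 0) :
    0 < sigmaMin A := by
  obtain ⟨x₀, hx₀, hmin⟩ := (isCompact_sphere (0 : Vec n) 1).exists_isMinOn (sphere_nonempty hn)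
    (f := fun x => ‖A x‖) (by fun_prop)
  have hx₀1 : ‖x₀‖ = 1 := by simpa using hx₀
  have hpos : 0 < ‖A x₀‖ := by
    rw [norm_pos_iff]
    intro h0
    rw [h x₀ h0] at hx₀1
    simp at hx₀1
  refine hpos.trans_le (le_csInf ((sphere_nonempty hn).image _) ?_)
  rintro _ ⟨x, hx, rfl⟩
  exact hmin hx

end SigmaMin

/-! ### Curvature bounds -/

section Curvature
variable {n : ℕ}

theorem CurvatureBounded.nonneg (hn : 0 < n) {L : ℝ} {f : Vec n → ℝ} (h : CurvatureBounded L f) :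
    0 ≤ L := by
  obtain ⟨x, hx⟩ := sphere_nonempty hn
  have hx1 : ‖x‖ = 1 := by simpa using hx
  have := h.2 x 0
  rw [sub_zero, hx1, mul_one] at this
  exact (norm_nonneg _).trans this

theorem convexOn_normSq (c : ℝ) (hc : 0 ≤ c) : ConvexOn ℝ Set.univ (fun x : Vec n => c * ‖x‖ ^ 2) :=
  ((convexOn_norm convex_univ).pow (fun _ _ => norm_nonneg _) 2).smul hc

theorem CurvatureBounded.mono {L L' : ℝ} {f : Vec n → ℝ} (h : CurvatureBounded L f) (hL : L ≤ L') :
    CurvatureBounded L' f := by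
  refine ⟨?_, fun x y => (h.2 x y).trans (by gcongr)⟩
  have e : (fun x : Vec n => f x + L' / 2 * ‖x‖ ^ 2) =
      (fun x => f x + L / 2 * ‖x‖ ^ 2) + fun x => (L' - L) / 2 * ‖x‖ ^ 2 := by
    ext x
    simp only [Pi.add_apply]
    ring
  rw [e]
  exact h.1.add (convexOn_normSq ((L' - L) / 2) (by linarith))

theorem gradient_add {f g : Vec n → ℝ} {x : Vec n} (hf : DifferentiableAt ℝ f x)
    (hg : DifferentiableAt ℝ g x) :
    gradient (fun x => f x + g x) x = gradient f x + gradient g x := by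
  refine HasGradientAt.gradient ?_
  rw [hasGradientAt_iff_hasFDerivAt, map_add]
  exact hf.hasGradientAt.hasFDerivAt.add hg.hasGradientAt.hasFDerivAt

theorem gradient_inner (c : Vec n) (x : Vec n) : gradient (fun x => ⟪c, x⟫_ℝ) x = c := by
  refine HasGradientAt.gradient ?_
  rw [hasGradientAt_iff_hasFDerivAt]
  exact (InnerProductSpace.toDual ℝ (Vec n) c).hasFDerivAt

/-- `CurvatureBounded` does not contain differentiability, and `gradient` is `0` where it fails;
additivity of gradients therefore needs the two extra hypotheses. -/
theorem CurvatureBounded.add {L L' : ℝ} {f g : Vec n → ℝ} (hf : CurvatureBounded L f)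
    (hg : CurvatureBounded L' g) (hfd : Differentiable ℝ f) (hgd : Differentiable ℝ g) :
    CurvatureBounded (L + L') (fun x => f x + g x) := by
  constructor
  · have e : (fun x : Vec n => f x + g x + (L + L') / 2 * ‖x‖ ^ 2) =
        (fun x => f x + L / 2 * ‖x‖ ^ 2) + fun x => g x + L' / 2 * ‖x‖ ^ 2 := by
      ext x
      simp only [Pi.add_apply]
      ring
    rw [e]
    exact hf.1.add hg.1
  · intro x y
    rw [gradient_add (hfd x) (hgd x), gradient_add (hfd y) (hgd y), add_sub_add_comm, add_mul]
    exact (norm_add_le _ _).trans (add_le_add (hf.2 x y) (hg.2 x y))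

theorem curvatureBounded_inner (c : Vec n) : CurvatureBounded 0 (fun x => ⟪c, x⟫_ℝ) := by
  constructor
  · simpa using (innerSL ℝ c).toLinearMap.convexOn convex_univ
  · intro x y
    simp [gradient_inner]

theorem curvatureBounded_zero : CurvatureBounded 0 (fun _ : Vec n => (0 : ℝ)) := by
  simpa using curvatureBounded_inner (0 : Vec n)

theorem CurvatureBounded.sum {ι : Type*} (s : Finset ι) {L : ι → ℝ} {f : ι → Vec n → ℝ}
    (hf : ∀ i ∈ s, CurvatureBounded (L i) (f i)) (hfd : ∀ i ∈ s, Differentiable ℝ (f i)) :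
    CurvatureBounded (∑ i ∈ s, L i) (fun x => ∑ i ∈ s, f i x) := by
  classical
  induction s using Finset.induction_on with
  | empty => simpa using curvatureBounded_zero
  | insert a s ha ih =>
    simp only [Finset.sum_insert ha]
    refine (hf a (by simp)).add (ih (fun i hi => hf i (by simp [hi])) (fun i hi => hfd i (by simp [hi])))
      (hfd a (by simp)) ?_
    exact Differentiable.fun_sum fun i hi => hfd i (by simp [hi])

/-- The first order lower bound for a weakly convex function. -/
theorem CurvatureBounded.first_order {L : ℝ} {f : Vec n → ℝ} (h : CurvatureBounded L f)
    (hd : Differentiable ℝ f) (x y : Vec n) :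
    f x + ⟪gradient f x, y - x⟫_ℝ - L / 2 * ‖y - x‖ ^ 2 ≤ f y := by
  -- Restriction of the convexified function to the line through `x` and `y`: its derivative at `0`
  -- is at most its slope over `[0, 1]`.
  set F : ℝ → ℝ := fun t => f (x + t • (y - x)) + L / 2 * ‖x + t • (y - x)‖ ^ 2 with hF
  have hconv : ConvexOn ℝ Set.univ F := by
    have := h.1.comp_affineMap (AffineMap.lineMap x y : ℝ →ᵃ[ℝ] Vec n)
    rw [Set.preimage_univ] at this
    have e : F = (fun x => f x + L / 2 * ‖x‖ ^ 2) ∘ (AffineMap.lineMap x y : ℝ →ᵃ[ℝ] Vec n) := by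
      ext t
      simp [hF, AffineMap.lineMap_apply, add_comm]
    rw [e]
    exact this
  have hderiv : HasDerivAt F (⟪gradient f x, y - x⟫_ℝ + L * ⟪x, y - x⟫_ℝ) 0 := by
    have hl : HasDerivAt (fun t : ℝ => x + t • (y - x)) (y - x) 0 := by
      simpa using ((hasDerivAt_id (0 : ℝ)).smul_const (y - x)).const_add x
    have hfx : HasFDerivAt f (fderiv ℝ f x) (x + (0 : ℝ) • (y - x)) := by
      simpa using (hd x).hasFDerivAt
    have h1 := hfx.comp_hasDerivAt (0 : ℝ) hl
    have h2 := (hl.norm_sq).const_mul (L / 2)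
    have e : ⟪gradient f x, y - x⟫_ℝ + L * ⟪x, y - x⟫_ℝ =
        fderiv ℝ f x (y - x) + L / 2 * (2 * ⟪x + (0 : ℝ) • (y - x), y - x⟫_ℝ) := by
      rw [inner_gradient_left, zero_smul, add_zero]
      ring
    rw [e]
    exact h1.add h2
  have hle := hconv.le_slope_of_hasDerivAt (Set.mem_univ 0) (Set.mem_univ 1) zero_lt_one hderiv
  simp only [slope_def_field, hF, one_smul, zero_smul, add_zero, sub_zero, div_one] at hle
  have e1 : x + (y - x) = y := by abel
  rw [e1] at hle
  have e2 : ‖y‖ ^ 2 = ‖x‖ ^ 2 + 2 * ⟪x, y - x⟫_ℝ + ‖y - x‖ ^ 2 := by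
    conv_lhs => rw [← e1]
    exact norm_add_sq_real x (y - x)
  rw [e2] at hle
  nlinarith

/-- Sum of the first order bounds at `x` and at `y`; the two halves `L/2` add up to `L`. -/
theorem CurvatureBounded.monotone_gradient {L : ℝ} {f : Vec n → ℝ} (h : CurvatureBounded L f)
    (hd : Differentiable ℝ f) (x y : Vec n) :
    -L * ‖y - x‖ ^ 2 ≤ ⟪gradient f y - gradient f x, y - x⟫_ℝ := by
  have h1 := h.first_order hd x y
  have h2 := h.first_order hd y x
  have e : x - y = -(y - x) := by abel
  rw [e, inner_neg_right, norm_neg] at h2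
  rw [inner_sub_left]
  linarith

/-- The Hessian of a weakly convex function is bounded from below. -/
theorem CurvatureBounded.hessian_ge {L : ℝ} {f : Vec n → ℝ} (h : CurvatureBounded L f)
    (hd : Differentiable ℝ f) {A : Vec n →L[ℝ] Vec n} {x : Vec n}
    (hA : HasFDerivAt (gradient f) A x) (v : Vec n) : -L * ‖v‖ ^ 2 ≤ ⟪v, A v⟫_ℝ := by
  have hl : HasDerivAt (fun t : ℝ => x + t • v) v 0 := by
    simpa using ((hasDerivAt_id (0 : ℝ)).smul_const v).const_add x
  have hA' : HasFDerivAt (gradient f) A (x + (0 : ℝ) • v) := by simpa using hA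
  have hg : HasDerivAt (fun t : ℝ => gradient f (x + t • v)) (A v) 0 :=
    HasFDerivAt.comp_hasDerivAt (l := gradient f) (0 : ℝ) hA' hl
  -- The limit from the right suffices, and there the weak monotonicity may be divided by `t`.
  have ht := (hasDerivAt_iff_tendsto_slope.1 hg).mono_left
    (nhdsWithin_mono (0 : ℝ) (s := Set.Ioi 0) (fun t ht => ne_of_gt ht))
  have ht2 := (tendsto_const_nhds (x := v)).inner (𝕜 := ℝ) ht
  refine ge_of_tendsto ht2 ?_
  filter_upwards [self_mem_nhdsWithin] with t ht
  have ht : 0 < t := ht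
  have hm := h.monotone_gradient hd x (x + t • v)
  rw [add_sub_cancel_left, norm_smul, inner_smul_right, Real.norm_of_nonneg ht.le,
    real_inner_comm] at hm
  simp only [slope_def_module, sub_zero, zero_smul, add_zero, inner_smul_right]
  rw [inv_mul_eq_div, le_div_iff₀ ht]
  have : t * (-L * ‖v‖ ^ 2 * t) ≤ t * ⟪v, gradient f (x + t • v) - gradient f x⟫_ℝ := by
    refine le_trans (le_of_eq ?_) hm
    ring
  exact le_of_mul_le_mul_left this ht

/-- The Riesz map from functionals to vectors, as a real linear map. -/
noncomputable def rieszSymm (n : ℕ) : (Vec n →L[ℝ] ℝ) →L[ℝ] Vec n :=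
  LinearMap.mkContinuous
    { toFun := fun f => (InnerProductSpace.toDual ℝ (Vec n)).symm f
      map_add' := fun f g => map_add _ f g
      map_smul' := fun c f => by simp } 1 (fun f => by simp)

theorem gradient_eq_rieszSymm_comp (f : Vec n → ℝ) : gradient f = rieszSymm n ∘ fderiv ℝ f := rfl

theorem contDiff_gradient {f : Vec n → ℝ} (h : ContDiff ℝ 2 f) : ContDiff ℝ 1 (gradient f) := by
  rw [gradient_eq_rieszSymm_comp]
  exact (rieszSymm n).contDiff.comp (h.fderiv_right (m := 1) (by norm_num))

/-- Local Lipschitz continuity enters through continuity of the second derivative. -/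
theorem TwiceDiffLip.contDiff {f : Vec n → ℝ} (h : TwiceDiffLip f) : ContDiff ℝ 2 f := by
  have h1 : ContDiff ℝ 1 (fderiv ℝ f) := contDiff_one_iff_fderiv.2 ⟨h.2.1, h.2.2.continuous⟩
  have := contDiff_succ_iff_fderiv (𝕜 := ℝ) (f := f) (n := 1)
  rw [one_add_one_eq_two] at this
  exact this.2 ⟨h.1, by simp, h1⟩

end Curvature


/-! ### The control energy -/

/-! ### Smoothed norms and smoothed normalization -/

section SmoothedNorm
variable {E : Type*} [NormedAddCommGroup E]

theorem norm_le_sqrt_normSq_add {ε : ℝ} (hε : 0 < ε) (a : E) : ‖a‖ ≤ √(‖a‖ ^ 2 + ε) :=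
  Real.le_sqrt_of_sq_le (by linarith)

/-- After squaring, the cross term `2 √(‖c‖² + ε) ‖a - c‖` dominates `2 ‖c‖ ‖a - c‖`. -/
theorem sqrt_normSq_add_le {ε : ℝ} (hε : 0 < ε) (a c : E) :
    √(‖a‖ ^ 2 + ε) ≤ √(‖c‖ ^ 2 + ε) + ‖a - c‖ := by
  have h1 := norm_le_sqrt_normSq_add hε c
  have h2 : √(‖c‖ ^ 2 + ε) ^ 2 = ‖c‖ ^ 2 + ε := Real.sq_sqrt (by positivity)
  have h3 : ‖a‖ ≤ ‖c‖ + ‖a - c‖ := by simpa using norm_add_le c (a - c)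
  refine Real.sqrt_le_iff.2 ⟨by positivity, ?_⟩
  nlinarith [norm_nonneg a, norm_nonneg c, norm_nonneg (a - c)]

theorem abs_sqrt_normSq_add_sub_le {ε : ℝ} (hε : 0 < ε) (a c : E) :
    |√(‖a‖ ^ 2 + ε) - √(‖c‖ ^ 2 + ε)| ≤ ‖a - c‖ := by
  have h1 := sqrt_normSq_add_le hε a c
  have h2 := sqrt_normSq_add_le hε c a
  rw [norm_sub_rev] at h2
  exact abs_le.2 ⟨by linarith, by linarith⟩

variable [InnerProductSpace ℝ E]

/-- The smoothed normalization `a / √(‖a‖² + ε)`. -/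
noncomputable def smoothUnit (ε : ℝ) (a : E) : E := (√(‖a‖ ^ 2 + ε))⁻¹ • a

theorem norm_smoothUnit_le {ε : ℝ} (hε : 0 < ε) (a : E) : ‖smoothUnit ε a‖ ≤ 1 := by
  have h : 0 < √(‖a‖ ^ 2 + ε) := Real.sqrt_pos.2 (by positivity)
  rw [smoothUnit, norm_smul, norm_inv, Real.norm_of_nonneg h.le, inv_mul_le_iff₀ h, mul_one]
  exact norm_le_sqrt_normSq_add hε a

/-- With `s`, `t` the smoothed norms of `a`, `c`, the difference is `s⁻¹((a - c) + (t - s) t⁻¹ c)`.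
Both summands have norm at most `‖a - c‖`, and `s⁻¹ ≤ 1/√ε`. Applied to both factors of the PD
energy, the constant `2/√ε` gives the `4/√ε_r` of `normJ`. -/
theorem norm_smoothUnit_sub_le {ε : ℝ} (hε : 0 < ε) (a c : E) :
    ‖smoothUnit ε a - smoothUnit ε c‖ ≤ 2 / √ε * ‖a - c‖ := by
  have ha : 0 < √(‖a‖ ^ 2 + ε) := Real.sqrt_pos.2 (by positivity)
  have hc : 0 < √(‖c‖ ^ 2 + ε) := Real.sqrt_pos.2 (by positivity)
  have he : 0 < √ε := Real.sqrt_pos.2 hε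
  have hea : √ε ≤ √(‖a‖ ^ 2 + ε) := Real.sqrt_le_sqrt (by nlinarith [norm_nonneg a])
  have hd := abs_sqrt_normSq_add_sub_le hε c a
  have hcn := norm_le_sqrt_normSq_add hε c
  unfold smoothUnit
  set s := √(‖a‖ ^ 2 + ε)
  set t := √(‖c‖ ^ 2 + ε)
  have e : s⁻¹ • a - t⁻¹ • c = s⁻¹ • ((a - c) + ((t - s) * t⁻¹) • c) := by
    rw [smul_add, smul_sub, smul_smul]
    have : s⁻¹ * ((t - s) * t⁻¹) = s⁻¹ - t⁻¹ := by field_simp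
    rw [this, sub_smul]
    abel
  have h2 : ‖((t - s) * t⁻¹) • c‖ ≤ ‖a - c‖ := by
    rw [norm_smul, norm_mul, norm_inv, Real.norm_of_nonneg hc.le, Real.norm_eq_abs, norm_sub_rev a c,
      mul_assoc]
    have : t⁻¹ * ‖c‖ ≤ 1 := by
      rw [inv_mul_le_iff₀ hc]
      linarith
    calc |t - s| * (t⁻¹ * ‖c‖) ≤ |t - s| * 1 := by gcongr
      _ ≤ _ := by linarith
  rw [e, norm_smul, norm_inv, Real.norm_of_nonneg ha.le]
  calc s⁻¹ * ‖(a - c) + ((t - s) * t⁻¹) • c‖ ≤ (√ε)⁻¹ * (‖a - c‖ + ‖a - c‖) := by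
        gcongr
        exact (norm_add_le _ _).trans (by gcongr)
    _ = _ := by ring

end SmoothedNorm

/-! ### Sub-matrices of a configuration as Euclidean vectors -/

section SubMatrix
variable {n : ℕ}

/-- The entries of a sub-matrix as a Euclidean vector. -/
noncomputable def subVec (e : Fin 3 × Fin 3 ↪ Fin n) (θ : Vec n) : EuclideanSpace ℝ (Fin 3 × Fin 3) :=
  WithLp.toLp 2 fun p => θ (e p)

theorem subVec_sub (e : Fin 3 × Fin 3 ↪ Fin n) (x y : Vec n) :
    subVec e x - subVec e y = subVec e (x - y) := by
  ext p
  simp [subVec]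

theorem norm_subVec_le (e : Fin 3 × Fin 3 ↪ Fin n) (θ : Vec n) : ‖subVec e θ‖ ≤ ‖θ‖ := by
  rw [EuclideanSpace.norm_eq, EuclideanSpace.norm_eq]
  refine Real.sqrt_le_sqrt ?_
  calc ∑ p, ‖subVec e θ p‖ ^ 2 = ∑ j ∈ Finset.univ.map e, ‖θ j‖ ^ 2 := by simp [subVec]
    _ ≤ ∑ j, ‖θ j‖ ^ 2 :=
      Finset.sum_le_sum_of_subset_of_nonneg (Finset.subset_univ _) fun _ _ _ => by positivity

theorem frob_subMatrix (e : Fin 3 × Fin 3 ↪ Fin n) (θ : Vec n) :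
    frob (subMatrix e θ) = ‖subVec e θ‖ := by
  rw [EuclideanSpace.norm_eq, Fintype.sum_prod_type]
  simp [frob, subMatrix, subVec]

/-- On `3 × 3` matrices flattened by index pairs, `1 ⊗ₖ R` acts as `Y ↦ Y Rᵀ`, and the trace is the
Frobenius inner product. -/
theorem trace_subMatrix (e f : Fin 3 × Fin 3 ↪ Fin n) (θ : Vec n) (R : Matrix (Fin 3) (Fin 3) ℝ) :
    ((subMatrix e θ).transpose * subMatrix f θ * R.transpose).trace =
      ⟪subVec e θ, Matrix.toEuclideanCLM (𝕜 := ℝ) ((1 : Matrix (Fin 3) (Fin 3) ℝ) ⊗ₖ R)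
        (subVec f θ)⟫_ℝ := by
  simp only [PiLp.inner_apply, Fintype.sum_prod_type, Matrix.ofLp_toEuclideanCLM, Matrix.mulVec,
    dotProduct, Matrix.kroneckerMap_apply, Matrix.one_apply]
  simp [Matrix.trace, Matrix.mul_apply, Fin.sum_univ_three, subMatrix, subVec]
  ring

end SubMatrix

/-! ### Regularity of the three control energies -/

namespace Controller
variable {n mu : ℕ}

theorem b_pd_eq (Ra Rb : Fin mu → (Fin 3 × Fin 3 ↪ Fin n)) (εr : ℝ) (hεr : 0 < εr) (θ : Vec n)
    (u : Vec mu) : (Controller.pd Ra Rb εr hεr).b θ u =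
      -∑ l, ⟪smoothUnit εr (subVec (Ra l) θ),
        Matrix.toEuclideanCLM (𝕜 := ℝ) ((1 : Matrix (Fin 3) (Fin 3) ℝ) ⊗ₖ rotX (u l))
          (smoothUnit εr (subVec (Rb l) θ))⟫_ℝ := by
  simp only [b, trace_subMatrix, frob_subMatrix, smoothUnit, map_smul, real_inner_smul_left,
    real_inner_smul_right]
  congr 1
  refine Finset.sum_congr rfl fun l _ => ?_
  rw [div_eq_mul_inv, mul_inv]
  ring

theorem differentiable_b (c : Controller n mu) (u : Vec mu) :
    Differentiable ℝ (fun θ => c.b θ u) := by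
  cases c with
  | force J =>
    exact (differentiable_id.inner ℝ (differentiable_const (J u))).neg
  | cable Xa Xb ta tb εr hεr =>
    simp only [b]
    refine Differentiable.fun_sum fun l _ => (Differentiable.sqrt ?_ ?_).const_mul _
    · exact ((by fun_prop : Differentiable ℝ fun θ => (Xa l θ + ta l) - (Xb l θ + tb l)).norm_sq ℝ).add_const _
    · intro θ
      positivity
  | pd Ra Rb εr hεr =>
    have hv : ∀ e : Fin 3 × Fin 3 ↪ Fin n, Differentiable ℝ fun θ : Vec n => subVec e θ := by
      intro e
      rw [differentiable_euclidean]
      intro p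
      simp only [subVec]
      fun_prop
    have hs : ∀ e : Fin 3 × Fin 3 ↪ Fin n, Differentiable ℝ fun θ : Vec n => smoothUnit εr (subVec e θ) := by
      intro e
      unfold smoothUnit
      refine Differentiable.smul (Differentiable.inv (Differentiable.sqrt ?_ ?_) ?_) (hv e)
      · exact ((hv e).norm_sq ℝ).add_const _
      · intro θ
        positivity
      · intro θ
        positivity
    simp only [b_pd_eq]
    refine (Differentiable.fun_sum fun l _ => ?_).neg
    exact (hs _).inner ℝ ((ContinuousLinearMap.differentiable _).comp (hs _))

/-- The control energy is Lipschitz in the configuration, with constant `‖J‖ L₁₅`. -/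
theorem abs_b_sub_le (c : Controller n mu) {X : Set (Vec mu)} {L15 : ℝ} (h : c.IsSizeBound X L15)
    {u : Vec mu} (hu : u ∈ X) (x y : Vec n) :
    |c.b x u - c.b y u| ≤ c.normJ * L15 * ‖x - y‖ := by
  cases c with
  | force J =>
    have h : ‖u‖ ≤ L15 := h u hu
    simp only [b, normJ]
    have e : -⟪x, J u⟫_ℝ - -⟪y, J u⟫_ℝ = -⟪x - y, J u⟫_ℝ := by
      rw [inner_sub_left]
      ring
    rw [e, abs_neg]
    calc |⟪x - y, J u⟫_ℝ| ≤ ‖x - y‖ * ‖J u‖ := abs_real_inner_le_norm _ _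
      _ ≤ ‖x - y‖ * (‖J‖ * L15) := by
        gcongr
        exact (J.le_opNorm u).trans (by gcongr)
      _ = _ := by ring
  | cable Xa Xb ta tb εr hεr =>
    have h : ‖u‖ ≤ L15 := h u hu
    simp only [b, normJ]
    rw [← Finset.sum_sub_distrib, Finset.sum_mul, Finset.sum_mul]
    refine (Finset.abs_sum_le_sum_abs _ _).trans (Finset.sum_le_sum fun l _ => ?_)
    rw [← mul_sub, abs_mul]
    have h1 : |u l| ≤ L15 := (PiLp.norm_apply_le u l).trans h
    have h2 := abs_sqrt_normSq_add_sub_le hεr (Xa l x + ta l - (Xb l x + tb l))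
      (Xa l y + ta l - (Xb l y + tb l))
    have e : Xa l x + ta l - (Xb l x + tb l) - (Xa l y + ta l - (Xb l y + tb l)) =
        (Xa l - Xb l) (x - y) := by
      simp only [sub_apply, map_sub]
      abel
    rw [e] at h2
    calc _ ≤ L15 * (‖Xa l - Xb l‖ * ‖x - y‖) := by
          refine mul_le_mul h1 (h2.trans ((Xa l - Xb l).le_opNorm _)) (abs_nonneg _) ?_
          exact (norm_nonneg u).trans h
      _ = _ := by ring
  | pd Ra Rb εr hεr =>
    simp only [b_pd_eq, normJ]
    rw [← neg_add', abs_neg, ← sub_eq_add_neg, ← Finset.sum_sub_distrib, Finset.sum_mul, Finset.sum_mul]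
    refine (Finset.abs_sum_le_sum_abs _ _).trans (Finset.sum_le_sum fun l _ => ?_)
    have hA := h u hu l
    set A := Matrix.toEuclideanCLM (𝕜 := ℝ) ((1 : Matrix (Fin 3) (Fin 3) ℝ) ⊗ₖ rotX (u l))
    have hL : 0 ≤ L15 := (norm_nonneg _).trans hA
    have key : ∀ e : Fin 3 × Fin 3 ↪ Fin n,
        ‖smoothUnit εr (subVec e x) - smoothUnit εr (subVec e y)‖ ≤ 2 / √εr * ‖x - y‖ := by
      intro e
      refine (norm_smoothUnit_sub_le hεr _ _).trans ?_
      rw [subVec_sub]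
      gcongr
      exact norm_subVec_le e _
    have hb := norm_smoothUnit_le hεr (subVec (Rb l) x)
    have ha := norm_smoothUnit_le hεr (subVec (Ra l) y)
    have ka := key (Ra l)
    have kb := key (Rb l)
    set a := smoothUnit εr (subVec (Ra l) x)
    set a' := smoothUnit εr (subVec (Ra l) y)
    set c := smoothUnit εr (subVec (Rb l) x)
    set c' := smoothUnit εr (subVec (Rb l) y)
    -- Only one factor of the bilinear form changes at a time. The other has norm at most `1`, so
    -- each term contributes `2 L₁₅/√ε_r` times the distance.
    have e : ⟪a, A c⟫_ℝ - ⟪a', A c'⟫_ℝ = ⟪a - a', A c⟫_ℝ + ⟪a', A (c - c')⟫_ℝ := by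
      rw [inner_sub_left, map_sub, inner_sub_right]
      ring
    rw [e]
    have i1 : |⟪a - a', A c⟫_ℝ| ≤ 2 / √εr * ‖x - y‖ * (L15 * 1) :=
      (abs_real_inner_le_norm _ _).trans (mul_le_mul ka
        ((A.le_opNorm c).trans (mul_le_mul hA hb (norm_nonneg _) hL)) (norm_nonneg _) (by positivity))
    have i2 : |⟪a', A (c - c')⟫_ℝ| ≤ 1 * (L15 * (2 / √εr * ‖x - y‖)) :=
      (abs_real_inner_le_norm _ _).trans (mul_le_mul ha
        ((A.le_opNorm _).trans (mul_le_mul hA kb (norm_nonneg _) hL)) (norm_nonneg _) (by positivity))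
    calc _ ≤ _ := abs_add_le _ _
      _ ≤ _ := add_le_add i1 i2
      _ = _ := by ring

end Controller

/-! ### Sign of the determinant of almost orthogonal matrices -/

section Det

/-- A matrix as an operator on Euclidean space. -/
noncomputable abbrev matOp (A : Matrix (Fin 3) (Fin 3) ℝ) : Vec 3 →L[ℝ] Vec 3 :=
  Matrix.toEuclideanCLM (𝕜 := ℝ) A

theorem norm_matOp_apply_le (A : Matrix (Fin 3) (Fin 3) ℝ) (w : Vec 3) :
    ‖matOp A w‖ ≤ frob A * ‖w‖ := by
  rw [EuclideanSpace.norm_eq, EuclideanSpace.norm_eq, frob, ← Real.sqrt_mul (by positivity)]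
  refine Real.sqrt_le_sqrt ?_
  simp only [Matrix.ofLp_toEuclideanCLM, Real.norm_eq_abs, sq_abs, Matrix.mulVec, dotProduct]
  rw [Finset.sum_mul]
  exact Finset.sum_le_sum fun a _ => Finset.sum_mul_sq_le_sq_mul_sq _ _ _

/-- `⟨(AᵀA - 1)w, w⟩ = ‖Aw‖² - ‖w‖²` exceeds `-ε‖w‖²`, and `1 - ε > (1 - ε)²`. The strict inequality
is what allows the non-strict distance bound in `sign_det_eq_of_frob`. -/
theorem lt_norm_matOp_apply {A : Matrix (Fin 3) (Fin 3) ℝ} {ε : ℝ} (h0 : 0 < ε) (h1 : ε < 1)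
    (h : frob (A.transpose * A - 1) < ε) {w : Vec 3} (hw : w ≠ 0) :
    (1 - ε) * ‖w‖ < ‖matOp A w‖ := by
  have hw' : 0 < ‖w‖ := norm_pos_iff.2 hw
  have e : ⟪matOp (A.transpose * A - 1) w, w⟫_ℝ = ‖matOp A w‖ ^ 2 - ‖w‖ ^ 2 := by
    have e1 : matOp (A.transpose * A - 1) w = ContinuousLinearMap.adjoint (matOp A) (matOp A w) - w := by
      have : ContinuousLinearMap.adjoint (matOp A) = matOp A.transpose := by
        have := map_star (Matrix.toEuclideanCLM (𝕜 := ℝ) (n := Fin 3)) A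
        rw [ContinuousLinearMap.star_eq_adjoint] at this
        rw [matOp, ← this]
        rfl
      rw [this, matOp, map_sub, map_mul, map_one]
      rfl
    rw [e1, inner_sub_left, ContinuousLinearMap.adjoint_inner_left, real_inner_self_eq_norm_sq,
      real_inner_self_eq_norm_sq]
  have h2 : -(ε * ‖w‖ ^ 2) < ⟪matOp (A.transpose * A - 1) w, w⟫_ℝ := by
    have := (abs_le.1 ((abs_real_inner_le_norm (matOp (A.transpose * A - 1) w) w).trans
      (mul_le_mul_of_nonneg_right (norm_matOp_apply_le _ _) (norm_nonneg _)))).1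
    nlinarith [mul_pos hw' hw']
  rw [e] at h2
  refine lt_of_pow_lt_pow_left₀ 2 (norm_nonneg _) ?_
  nlinarith [mul_pos hw' hw', mul_pos h0 (sub_pos.2 h1)]

/-- Two almost orthogonal matrices that are close to each other have determinants of the same
sign. -/
theorem sign_det_eq_of_frob {A B : Matrix (Fin 3) (Fin 3) ℝ} {ε : ℝ} (h0 : 0 < ε) (h1 : ε < 1)
    (hA : frob (A.transpose * A - 1) < ε) (hB : frob (B.transpose * B - 1) < ε)
    (hAB : frob (A - B) ≤ 2 * (1 - ε)) : SignType.sign A.det = SignType.sign B.det := by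
  -- No matrix on the segment between `A` and `B` is singular.
  have hns : ∀ t ∈ Set.Icc (0 : ℝ) 1, ((1 - t) • A + t • B).det ≠ 0 := by
    intro t ht hdet
    obtain ⟨v, hv, hv0⟩ := Matrix.exists_mulVec_eq_zero_iff.2 hdet
    set w : Vec 3 := WithLp.toLp 2 v
    have hw : w ≠ 0 := by
      intro h
      apply hv
      simpa [w] using h
    have hw0 : (1 - t) • matOp A w + t • matOp B w = 0 := by
      have : matOp ((1 - t) • A + t • B) w = 0 := by
        ext a
        rw [matOp, Matrix.ofLp_toEuclideanCLM]
        exact congrFun hv0 a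
      simpa [matOp, map_add, map_smul] using this
    have hA' := lt_norm_matOp_apply h0 h1 hA hw
    have hB' := lt_norm_matOp_apply h0 h1 hB hw
    have hd : ‖matOp A w - matOp B w‖ ≤ 2 * (1 - ε) * ‖w‖ := by
      have := (norm_matOp_apply_le (A - B) w).trans
        (mul_le_mul_of_nonneg_right hAB (norm_nonneg w))
      simpa [matOp] using this
    -- A null vector `w` of the convex combination makes `Aw` and `Bw` opposite, so that `‖Aw‖ +
    -- ‖Bw‖ = ‖Aw - Bw‖ ≤ 2(1-ε)‖w‖`, although each norm exceeds `(1-ε)‖w‖`.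
    have e1 : matOp A w = t • (matOp A w - matOp B w) := by
      have : matOp A w = ((1 - t) • matOp A w + t • matOp B w) + t • (matOp A w - matOp B w) := by
        module
      rwa [hw0, zero_add] at this
    have e2 : matOp B w = -((1 - t) • (matOp A w - matOp B w)) := by
      have : matOp B w = ((1 - t) • matOp A w + t • matOp B w)
          + -((1 - t) • (matOp A w - matOp B w)) := by
        module
      rwa [hw0, zero_add] at this
    have n1 : ‖matOp A w‖ = t * ‖matOp A w - matOp B w‖ := by
      conv_lhs => rw [e1]
      rw [norm_smul, Real.norm_of_nonneg ht.1]
    have n2 : ‖matOp B w‖ = (1 - t) * ‖matOp A w - matOp B w‖ := by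
      conv_lhs => rw [e2]
      rw [norm_neg, norm_smul, Real.norm_of_nonneg (by linarith [ht.2])]
    nlinarith
  have hcont : Continuous fun t : ℝ => ((1 - t) • A + t • B).det := by
    refine Continuous.matrix_det ?_
    fun_prop
  have hA0 := hns 0 (by simp)
  have hB0 := hns 1 (by simp)
  simp only [sub_zero, one_smul, zero_smul, add_zero, sub_self, zero_add] at hA0 hB0
  rcases lt_or_gt_of_ne hA0 with ha | ha <;> rcases lt_or_gt_of_ne hB0 with hb | hb
  · rw [sign_neg ha, sign_neg hb]
  · obtain ⟨t, ht, h⟩ := intermediate_value_Icc (zero_le_one' ℝ) hcont.continuousOn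
      (show (0 : ℝ) ∈ _ by simp [ha.le, hb.le])
    exact absurd h (hns t ht)
  · obtain ⟨t, ht, h⟩ := intermediate_value_Icc' (zero_le_one' ℝ) hcont.continuousOn
      (show (0 : ℝ) ∈ _ by simp [ha.le, hb.le])
    exact absurd h (hns t ht)
  · rw [sign_pos ha, sign_pos hb]

end Det


namespace Problem
variable {n mu N me mi nR : ℕ} (P : Problem n mu N me mi nR)

/-! ### Mass matrix -/

theorem inner_Mop_comm (hM : P.M.PosDef) (x y : Vec n) : ⟪P.Mop x, y⟫_ℝ = ⟪x, P.Mop y⟫_ℝ := by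
  have hs : star P.Mop = P.Mop := by
    rw [Mop, ← map_star, Matrix.star_eq_conjTranspose, hM.isHermitian.eq]
  have h := ContinuousLinearMap.adjoint_inner_left P.Mop y x
  rwa [← ContinuousLinearMap.star_eq_adjoint, hs] at h

theorem normSqM_pos (hM : P.M.PosDef) {x : Vec n} (hx : x ≠ 0) : 0 < P.normSqM x := by
  have h := hM.dotProduct_mulVec_pos (x := x.ofLp) (by simpa using hx)
  have e : P.normSqM x = star x.ofLp ⬝ᵥ P.M.mulVec x.ofLp := by
    rw [normSqM, Mop, EuclideanSpace.inner_eq_star_dotProduct, Matrix.ofLp_toEuclideanCLM,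
      dotProduct_comm]
  rwa [e]

theorem normSqM_nonneg (hM : P.M.PosDef) (x : Vec n) : 0 ≤ P.normSqM x := by
  rcases eq_or_ne x 0 with rfl | hx
  · simp [normSqM]
  · exact (P.normSqM_pos hM hx).le

theorem sigmaMin_Mop_pos (hn : 0 < n) (hM : P.M.PosDef) : 0 < sigmaMin P.Mop := by
  refine sigmaMin_pos hn fun x hx => ?_
  by_contra h
  have := P.normSqM_pos hM h
  simp [normSqM, hx] at this

theorem sigmaMin_mul_sq_le_normSqM (hn : 0 < n) (hM : P.M.PosDef) (x : Vec n) :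
    sigmaMin P.Mop * ‖x‖ ^ 2 ≤ P.normSqM x :=
  sigmaMin_mul_sq_le hn (P.inner_Mop_comm hM) (P.normSqM_nonneg hM) x

/-! ### The relaxed potential -/

variable {P}

theorem contDiff_PbarG (hR : P.RelaxationAssumption) {L2 : ℝ} (hL2 : 0 < L2) :
    ContDiff ℝ 2 (P.PbarG L2) := by
  unfold PbarG
  refine ((hR.pbar_term.2 L2 hL2).contDiff.add ?_).add ?_
  · exact ContDiff.sum fun j _ => ((hR.he_term j).2 L2 hL2).contDiff
  · exact ContDiff.sum fun j _ => ((hR.hi_term j).2 L2 hL2).contDiff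

theorem differentiable_PbarG (hR : P.RelaxationAssumption) {L2 : ℝ} (hL2 : 0 < L2) :
    Differentiable ℝ (P.PbarG L2) := (contDiff_PbarG hR hL2).differentiable (by norm_num)

theorem differentiable_Pbar (hR : P.RelaxationAssumption) {L2 : ℝ} (hL2 : 0 < L2) (u : Vec mu) :
    Differentiable ℝ (P.Pbar L2 u) :=
  ((differentiable_PbarG hR hL2).sub ((differentiable_const _).inner ℝ differentiable_id)).add
    (P.ctrl.differentiable_b u)

theorem exists_poly_curvatureBounded_PbarG (hR : P.RelaxationAssumption) :
    ∃ q : Polynomial ℝ, ∀ L2 : ℝ, 0 < L2 → CurvatureBounded (q.eval L2) (P.PbarG L2) := by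
  obtain ⟨qp, hqp⟩ := hR.pbar_term.1
  choose qe hqe using fun j => (hR.he_term j).1
  choose qi hqi using fun j => (hR.hi_term j).1
  refine ⟨qp + ∑ j, qe j + ∑ j, qi j, fun L2 hL2 => ?_⟩
  have de := fun j => ((hR.he_term j).2 L2 hL2).1
  have di := fun j => ((hR.hi_term j).2 L2 hL2).1
  have hp := (hqp L2 hL2).add (CurvatureBounded.sum Finset.univ (fun j _ => hqe j L2 hL2)
    (fun j _ => de j)) (hR.pbar_term.2 L2 hL2).1 (Differentiable.fun_sum fun j _ => de j)
  have := hp.add (CurvatureBounded.sum Finset.univ (fun j _ => hqi j L2 hL2)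
    (fun j _ => di j)) ((hR.pbar_term.2 L2 hL2).1.add (Differentiable.fun_sum fun j _ => de j))
    (Differentiable.fun_sum fun j _ => di j)
  rw [Polynomial.eval_add, Polynomial.eval_add, Polynomial.eval_finsetSum,
    Polynomial.eval_finsetSum]
  exact this

/-- `P̄` has a positive curvature bound that is polynomial in `L₂`. -/
theorem exists_poly_curvatureBounded_Pbar (hn : 0 < n) (hO : P.ObjectiveAssumption)
    (hR : P.RelaxationAssumption) (hC : P.ControlAssumption) :
    ∃ q : Polynomial ℝ, ∀ L2 : ℝ, 0 < L2 → 0 < q.eval L2 ∧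
      ∀ u ∈ P.X, CurvatureBounded (q.eval L2) (P.Pbar L2 u) := by
  obtain ⟨q, hq⟩ := exists_poly_curvatureBounded_PbarG hR
  obtain ⟨L, hL⟩ := hC.curv
  obtain ⟨u₀, hu₀⟩ := hO.nonempty
  have hL0 := (hL u₀ hu₀).nonneg hn
  -- The summand `1` makes the bound positive: `L` and `q.eval L2` are nonnegative because they
  -- bound Lipschitz constants.
  refine ⟨q + Polynomial.C (L + 1), fun L2 hL2 => ?_⟩
  have hq0 := (hq L2 hL2).nonneg hn
  rw [Polynomial.eval_add, Polynomial.eval_C]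
  refine ⟨by linarith, fun u hu => ?_⟩
  have h1 := (hq L2 hL2).add (curvatureBounded_inner (-P.g)) (differentiable_PbarG hR hL2)
    ((differentiable_const _).inner ℝ differentiable_id)
  have h2 := h1.add (hL u hu) ((differentiable_PbarG hR hL2).add
    ((differentiable_const _).inner ℝ differentiable_id)) (P.ctrl.differentiable_b u)
  have e : (fun x => P.PbarG L2 x + ⟪-P.g, x⟫_ℝ + P.ctrl.b x u) = P.Pbar L2 u := by
    ext x
    rw [Pbar, inner_neg_left, sub_eq_add_neg]
  rw [e] at h2
  exact h2.mono (by linarith)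

/-- Where `p̄ ≤ L₂` it equals `p ≥ 0`; elsewhere it exceeds `L₂ > 0`. -/
theorem pbar_nonneg (hR : P.RelaxationAssumption) {L2 : ℝ} (hL2 : 0 < L2) (θ : Vec n) :
    0 ≤ P.pbar θ L2 := by
  rcases le_or_gt (P.pbar θ L2) L2 with h | h
  · rw [hR.pbar_eq L2 hL2 θ (Or.inl h)]
    exact hR.p_nonneg θ
  · exact (hL2.trans h).le

theorem heBar_nonneg (hR : P.RelaxationAssumption) {L2 : ℝ} (hL2 : 0 < L2) (j) (x : ℝ) :
    0 ≤ P.heBar j x L2 := (hR.he_min j L2 hL2).2 ⟨x, rfl⟩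

theorem hiBar_nonneg (hR : P.RelaxationAssumption) {L2 : ℝ} (hL2 : 0 < L2) (j) (x : ℝ) :
    0 ≤ P.hiBar j x L2 := (hR.hi_min j L2 hL2).2 ⟨x, rfl⟩

theorem PbarG_nonneg (hR : P.RelaxationAssumption) {L2 : ℝ} (hL2 : 0 < L2) (θ : Vec n) :
    0 ≤ P.PbarG L2 θ :=
  add_nonneg (add_nonneg (pbar_nonneg hR hL2 θ)
    (Finset.sum_nonneg fun j _ => heBar_nonneg hR hL2 j _))
    (Finset.sum_nonneg fun j _ => hiBar_nonneg hR hL2 j _)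

theorem heBar_le_PbarG (hR : P.RelaxationAssumption) {L2 : ℝ} (hL2 : 0 < L2) (θ : Vec n) (j) :
    P.heBar j (P.heAll j θ) L2 ≤ P.PbarG L2 θ := by
  have h1 := Finset.single_le_sum (f := fun j => P.heBar j (P.heAll j θ) L2)
    (fun j _ => heBar_nonneg hR hL2 j _) (Finset.mem_univ j)
  have h2 := pbar_nonneg hR hL2 θ
  have h3 := Finset.sum_nonneg (s := Finset.univ) (f := fun j => P.hiBar j (P.hi j θ) L2)
    fun j _ => hiBar_nonneg hR hL2 j _
  unfold PbarG
  linarith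

/-- The penalty already equals `L₂` at `|x| = 1/L₂` and is monotone in `|x|`. An energy below the
barrier thus turns soft penalties into a hard bound. -/
theorem abs_heAll_lt (hR : P.RelaxationAssumption) {L2 : ℝ} (hL2 : 0 < L2) {θ : Vec n}
    (h : P.PbarG L2 θ < L2) (j) : |P.heAll j θ| < 1 / L2 := by
  by_contra! hlt
  have hpos : (0 : ℝ) ≤ 1 / L2 := by positivity
  have h1 := hR.he_mono j L2 hL2 (1 / L2) (P.heAll j θ) (by rwa [abs_of_nonneg hpos])
  rw [hR.he_val j L2 hL2 _ (abs_of_nonneg hpos)] at h1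
  linarith [heBar_le_PbarG hR hL2 θ j]

/-- At the initial configuration no penalty is active. -/
theorem PbarG_θ₀ (hR : P.RelaxationAssumption) (hS : P.SlaterAssumption) {L2 : ℝ} (hL2 : 0 < L2)
    (hhi : ∀ j, 1 / P.hi j P.θ₀ < L2) (hp : P.p P.θ₀ < L2) : P.PbarG L2 P.θ₀ = P.p P.θ₀ := by
  have h1 : ∀ j, P.heBar j (P.heAll j P.θ₀) L2 = 0 := by
    intro j
    obtain ⟨x, hx⟩ := (hR.he_min j L2 hL2).1
    refine le_antisymm ?_ (heBar_nonneg hR hL2 j _)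
    rw [hS.eq j]
    exact (hR.he_mono j L2 hL2 0 x (by simp)).trans hx.le
  have h2 : ∀ j, P.hiBar j (P.hi j P.θ₀) L2 = 0 := by
    intro j
    obtain ⟨x, hx⟩ := (hR.hi_min j L2 hL2).1
    refine le_antisymm ?_ (hiBar_nonneg hR hL2 j _)
    refine (hR.hi_mono j L2 hL2 _ x ?_).trans hx.le
    -- Beyond the margin `1/L₂` the quantity in which the penalty is monotone is `0`, its least
    -- value.
    have : 1 / L2 < P.hi j P.θ₀ := by
      have h := hhi j
      have h0 := hS.ineq j
      rw [div_lt_iff₀ h0] at h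
      rw [div_lt_iff₀ hL2]
      linarith
    rw [max_eq_right (by linarith)]
    exact le_max_right _ _
  rw [PbarG, hR.pbar_eq L2 hL2 _ (Or.inr hp.le)]
  simp [h1, h2]

theorem Hg_zero (hR : P.RelaxationAssumption) (hS : P.SlaterAssumption) {L2 : ℝ} (hL2 : 0 < L2)
    (hhi : ∀ j, 1 / P.hi j P.θ₀ < L2) (hp : P.p P.θ₀ < L2) :
    P.Hg L2 P.δ P.θ₀ P.θprev = P.Hg₀ := by
  rw [Hg, Hg₀, PbarG_θ₀ hR hS hL2 hhi hp]

/-! ### Residual of one timestep -/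

theorem gradient_Pbar (hR : P.RelaxationAssumption) {L2 : ℝ} (hL2 : 0 < L2) (u : Vec mu)
    (x : Vec n) : gradient (P.Pbar L2 u) x =
      gradient (P.PbarG L2) x - P.g + gradient (fun θ => P.ctrl.b θ u) x := by
  have e : P.Pbar L2 u = fun x => (P.PbarG L2 x + ⟪-P.g, x⟫_ℝ) + P.ctrl.b x u := by
    ext x
    rw [Pbar, inner_neg_left, sub_eq_add_neg]
  have hi : DifferentiableAt ℝ (fun x => ⟪-P.g, x⟫_ℝ) x :=
    ((differentiable_const _).inner ℝ differentiable_id) x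
  rw [e, gradient_add ((differentiable_PbarG hR hL2 x).fun_add hi) (P.ctrl.differentiable_b u x),
    gradient_add (differentiable_PbarG hR hL2 x) hi, gradient_inner, sub_eq_add_neg]

theorem hasGradientAt_normSqM (hM : P.M.PosDef) (w x : Vec n) (c : ℝ) :
    HasGradientAt (fun x => c * P.normSqM (x + w)) ((2 * c) • P.Mop (x + w)) x := by
  rw [hasGradientAt_iff_hasFDerivAt]
  have h1 : HasFDerivAt (fun x : Vec n => x + w) (ContinuousLinearMap.id ℝ (Vec n)) x :=
    (hasFDerivAt_id x).add_const w
  have h2 : HasFDerivAt (fun x : Vec n => P.Mop (x + w)) P.Mop x := by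
    have h := P.Mop.hasFDerivAt.comp x h1
    rwa [ContinuousLinearMap.comp_id] at h
  have h3 := (h1.inner ℝ h2).const_mul c
  refine h3.congr_fderiv ?_
  ext v
  simp only [smul_apply, ContinuousLinearMap.comp_apply, ContinuousLinearMap.prod_apply,
    fderivInnerCLM_apply, ContinuousLinearMap.id_apply, InnerProductSpace.toDual_apply_apply,
    smul_eq_mul, real_inner_smul_left]
  rw [← P.inner_Mop_comm hM, real_inner_comm (P.Mop (x + w)) v]
  ring

theorem gradient_Ebar (hM : P.M.PosDef) (hR : P.RelaxationAssumption) {L2 : ℝ} (hL2 : 0 < L2)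
    (d d' : ℝ) (u : Vec mu) (y z x : Vec n) :
    gradient (P.Ebar L2 d d' u y z) x =
      (1 / d ^ 2) • P.Mop (x - (1 + d / d') • y + (d / d') • z) + gradient (P.Pbar L2 u) x := by
  have e : P.Ebar L2 d d' u y z = fun x =>
      1 / (2 * d ^ 2) * P.normSqM (x + (-((1 + d / d') • y) + (d / d') • z)) + P.Pbar L2 u x := by
    ext x
    rw [Ebar, sub_eq_add_neg, add_assoc]
  have h := hasGradientAt_normSqM hM (-((1 + d / d') • y) + (d / d') • z) x (1 / (2 * d ^ 2))
  rw [e, gradient_add h.differentiableAt (differentiable_Pbar hR hL2 u x), h.gradient,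
    sub_eq_add_neg, add_assoc]
  congr 2
  field_simp

end Problem

/-! ### Diagonal blocks of the Jacobian and the singularity test -/

theorem before_zero {α : Type*} {m : ℕ} (x : α) (f : Fin m → α) (h : 0 < m) :
    before x f ⟨0, h⟩ = x := rfl

theorem before_succ {α : Type*} {m : ℕ} (x : α) (f : Fin m → α) (k : ℕ) (h : k + 1 < m) :
    before x f ⟨k + 1, h⟩ = f ⟨k, by omega⟩ := rfl

theorem Grid.step_pos {N : ℕ} (G : Grid N) {δ : ℝ} (hδ : 0 < δ) (i : Fin G.m) : 0 < G.step δ i :=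
  mul_pos hδ (sub_pos.2 (G.before_lt i))

namespace Problem
variable {n mu N me mi nR : ℕ} {P : Problem n mu N me mi nR}

theorem differentiableAt_gradient_b (hC : P.ControlAssumption) {u : Vec mu} (hu : u ∈ P.X)
    (x : Vec n) : DifferentiableAt ℝ (gradient fun θ => P.ctrl.b θ u) x :=
  (hC.diff2 x u hu).comp x (f := fun x => (x, u)) (by fun_prop)

theorem differentiableAt_gradient_Pbar (hR : P.RelaxationAssumption) (hC : P.ControlAssumption)
    {L2 : ℝ} (hL2 : 0 < L2) {u : Vec mu} (hu : u ∈ P.X) (x : Vec n) :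
    DifferentiableAt ℝ (gradient (P.Pbar L2 u)) x := by
  rw [show gradient (P.Pbar L2 u) = _ from funext (gradient_Pbar hR hL2 u)]
  refine DifferentiableAt.add (DifferentiableAt.sub_const ?_ _) (differentiableAt_gradient_b hC hu x)
  exact (contDiff_gradient (contDiff_PbarG hR hL2)).differentiable (by norm_num) x

/-- A diagonal block of the Jacobian. -/
theorem diagBlock_eq (hM : P.M.PosDef) (hR : P.RelaxationAssumption) (hC : P.ControlAssumption)
    {L2 : ℝ} (hL2 : 0 < L2) (G : Grid N) (θ : Blocks G.m n) {u : Blocks N mu}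
    (hu : ∀ k, u k ∈ P.X) (i : Fin G.m) :
    P.diagBlock G L2 θ u i = (1 / G.step P.δ i ^ 2) • P.Mop +
      fderiv ℝ (gradient (P.Pbar L2 (u (G.ctrlIdx i)))) (θ i) := by
  unfold diagBlock stepEnergy
  rw [show gradient (P.Ebar L2 _ _ _ _ _) = _ from funext (gradient_Ebar hM hR hL2 _ _ _ _ _)]
  refine HasFDerivAt.fderiv (HasFDerivAt.add (HasFDerivAt.fun_const_smul ?_ _)
    (differentiableAt_gradient_Pbar hR hC hL2 (hu _) _).hasFDerivAt)
  have h := P.Mop.hasFDerivAt.comp (θ i) (((hasFDerivAt_id (θ i)).sub_const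
    ((1 + G.step P.δ i / before P.δ (G.step P.δ) i) • before P.θ₀ θ i)).add_const
    ((G.step P.δ i / before P.δ (G.step P.δ) i) • before P.θprev (before P.θ₀ θ) i))
  rwa [ContinuousLinearMap.comp_id] at h

/-- Small timesteps make the diagonal blocks uniformly positive definite. -/
theorem le_sigmaMin_diagBlock (hn : 0 < n) (hM : P.M.PosDef) (hR : P.RelaxationAssumption)
    (hC : P.ControlAssumption) {L2 L : ℝ} (hL2 : 0 < L2)
    (hL : ∀ v ∈ P.X, CurvatureBounded L (P.Pbar L2 v)) (G : Grid N) (θ : Blocks G.m n)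
    {u : Blocks N mu} (hu : ∀ k, u k ∈ P.X) (i : Fin G.m) :
    sigmaMin P.Mop / G.step P.δ i ^ 2 - L ≤ sigmaMin (P.diagBlock G L2 θ u i) := by
  refine le_sigmaMin hn fun x => ?_
  rw [diagBlock_eq hM hR hC hL2 G θ hu i, add_apply, inner_add_right,
    smul_apply, real_inner_smul_right]
  have h1 := (hL _ (hu (G.ctrlIdx i))).hessian_ge (differentiable_Pbar hR hL2 _)
    (differentiableAt_gradient_Pbar hR hC hL2 (hu _) (θ i)).hasFDerivAt x
  have h2 := P.sigmaMin_mul_sq_le_normSqM hn hM x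
  have h3 : 1 / G.step P.δ i ^ 2 * (sigmaMin P.Mop * ‖x‖ ^ 2) ≤
      1 / G.step P.δ i ^ 2 * ⟪x, P.Mop x⟫_ℝ := by
    gcongr
    exact h2
  calc _ = 1 / G.step P.δ i ^ 2 * (sigmaMin P.Mop * ‖x‖ ^ 2) + -L * ‖x‖ ^ 2 := by ring
    _ ≤ _ := add_le_add h3 h1

/-- If `δᵢ² ≤ σ_min(M)/(L₃ + L)`, then `σ_min(M)/δᵢ² - L ≥ L₃`, and the test passes. -/
theorem lt_step_of_singular (hn : 0 < n) (hM : P.M.PosDef) (hδ : 0 < P.δ)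
    (hR : P.RelaxationAssumption)
    (hC : P.ControlAssumption) {S : Params} {L : ℝ} (hL2 : 0 < S.L2) (hL3 : 0 < S.L3) (hL0 : 0 < L)
    (hL : ∀ v ∈ P.X, CurvatureBounded L (P.Pbar S.L2 v)) (G : Grid N) (θ : Blocks G.m n)
    {u : Blocks N mu} (hu : ∀ k, u k ∈ P.X) (i : Fin G.m) (hs : P.Singular S G θ u i) :
    P.L16 S L < G.step P.δ i := by
  by_contra! hle
  have hd := G.step_pos hδ i
  have h1 : G.step P.δ i ≤ √(sigmaMin P.Mop / (S.L3 + L)) :=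
    hle.trans ((min_le_left _ _).trans (min_le_left _ _))
  have hσ := P.sigmaMin_Mop_pos hn hM
  rw [Real.le_sqrt hd.le (by positivity), le_div_iff₀ (by positivity)] at h1
  have h2 := le_sigmaMin_diagBlock hn hM hR hC hL2 hL G θ hu i
  have h3 : S.L3 + L ≤ sigmaMin P.Mop / G.step P.δ i ^ 2 := by
    rw [le_div_iff₀ (by positivity)]
    linarith
  unfold Singular at hs
  linarith

/-! ### Growth of the energy -/

theorem growth_nonneg (S : Params) : 0 ≤ P.growth S := by
  unfold growth
  positivity

theorem Hg_nonneg (hM : P.M.PosDef) (hR : P.RelaxationAssumption) {L2 : ℝ} (hL2 : 0 < L2)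
    (d : ℝ) (x y : Vec n) : 0 ≤ P.Hg L2 d x y := by
  have h1 := P.normSqM_nonneg hM (d⁻¹ • (x - y))
  have h2 := PbarG_nonneg hR hL2 x
  unfold Hg
  positivity

/-- Convexity estimate for the energy balance of one timestep with velocities `v` and `v'`. -/
theorem energy_balance (hM : P.M.PosDef) (hR : P.RelaxationAssumption) {L2 L : ℝ} (hL2 : 0 < L2)
    {u : Vec mu} (hL : CurvatureBounded L (P.Pbar L2 u)) {d : ℝ} (hd : 0 < d) {x y : Vec n}
    {v v' : Vec n} (hv : x - y = d • v) :
    1 / 2 * P.normSqM v + P.Pbar L2 u x ≤ 1 / 2 * P.normSqM v' + P.Pbar L2 u y +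
      d * ⟪v, (1 / d) • P.Mop (v - v') + gradient (P.Pbar L2 u) x⟫_ℝ + L / 2 * d ^ 2 * ‖v‖ ^ 2 := by
  have h1 := hL.first_order (differentiable_Pbar hR hL2 u) x y
  have e1 : y - x = -(d • v) := by rw [← hv, neg_sub]
  rw [e1, inner_neg_right, real_inner_smul_right, norm_neg, norm_smul, Real.norm_of_nonneg hd.le] at h1
  have e2 : d * ⟪v, (1 / d) • P.Mop (v - v') + gradient (P.Pbar L2 u) x⟫_ℝ =
      ⟪v, P.Mop (v - v')⟫_ℝ + d * ⟪gradient (P.Pbar L2 u) x, v⟫_ℝ := by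
    rw [inner_add_right, real_inner_smul_right, real_inner_comm v (gradient _ _)]
    field_simp
  -- Polarization for the symmetric `M`. The term `½‖v - v'‖²_M` is the numerical dissipation of the
  -- implicit scheme; it has the favourable sign and is dropped.
  have e3 : ⟪v, P.Mop (v - v')⟫_ℝ = 1 / 2 * P.normSqM v - 1 / 2 * P.normSqM v'
      + 1 / 2 * P.normSqM (v - v') := by
    simp only [normSqM, map_sub, inner_sub_left, inner_sub_right]
    rw [← P.inner_Mop_comm hM v' v, real_inner_comm v]
    ring
  have h2 := P.normSqM_nonneg hM (v - v')
  rw [e2, e3]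
  nlinarith

/-- `(1 + 2t)(1 - t) = 1 + t(1 - 2t) ≥ 1`. With `t = 3d/σ` this is the origin of the exponent `6d/σ`
and of the bound `σ/6` in `L16`. -/
theorem inv_one_sub_le_exp {t : ℝ} (h0 : 0 ≤ t) (h1 : t ≤ 1 / 2) : 1 ≤ Real.exp (2 * t) * (1 - t) := by
  have h := Real.add_one_le_exp (2 * t)
  nlinarith

/-- If the timestep is small and the residual at most `ε`, the energy grows by a controlled
factor. -/
theorem Hg_le_of_residual (hn : 0 < n) (hM : P.M.PosDef) (hR : P.RelaxationAssumption) {S : Params}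
    {L : ℝ} (hL2 : 0 < S.L2) (hL0 : 0 < L) (hε : 0 < S.ε) (hL15 : P.ctrl.IsSizeBound P.X S.L15)
    {u : Vec mu} (hu : u ∈ P.X) (hL : CurvatureBounded L (P.Pbar S.L2 u)) {d d' : ℝ} (hd : 0 < d)
    (hdL : d ≤ 1 / L) (hdσ : d ≤ sigmaMin P.Mop / 6) {x y z : Vec n}
    (hr : ‖gradient (P.Ebar S.L2 d d' u y z) x‖ ≤ S.ε) :
    P.Hg S.L2 d x y ≤ Real.exp (6 * d / sigmaMin P.Mop) *
      (P.Hg S.L2 d' y z + P.growth S * d) := by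
  have hσ := P.sigmaMin_Mop_pos hn hM
  set σ := sigmaMin P.Mop
  set v : Vec n := d⁻¹ • (x - y) with hv
  set v' : Vec n := d'⁻¹ • (y - z) with hv'
  have hxy : x - y = d • v := by rw [hv, smul_smul, mul_inv_cancel₀ hd.ne', one_smul]
  have hres : gradient (P.Ebar S.L2 d d' u y z) x =
      (1 / d) • P.Mop (v - v') + gradient (P.Pbar S.L2 u) x := by
    rw [gradient_Ebar hM hR hL2]
    congr 1
    -- The inertial term is the difference of two backward velocities, so the residual is `M(v -
    -- v')/d + ∇P̄(x)`.
    have : x - (1 + d / d') • y + (d / d') • z = d • (v - v') := by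
      rw [hv, hv', smul_sub, smul_smul, smul_smul, mul_inv_cancel₀ hd.ne', one_smul,
        div_eq_mul_inv]
      module
    rw [this, map_smul, smul_smul]
    congr 1
    field_simp
  have hbal := energy_balance hM hR hL2 hL hd (v' := v') hxy
  rw [← hres] at hbal
  have hinner : ⟪v, gradient (P.Ebar S.L2 d d' u y z) x⟫_ℝ ≤ ‖v‖ * S.ε :=
    (real_inner_le_norm _ _).trans (by gcongr)
  have hb := (abs_le.1 (P.ctrl.abs_b_sub_le hL15 hu x y)).1
  have hnxy : ‖x - y‖ = d * ‖v‖ := by rw [hxy, norm_smul, Real.norm_of_nonneg hd.le]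
  have hg : ⟪P.g, x⟫_ℝ - ⟪P.g, y⟫_ℝ ≤ ‖P.g‖ * (d * ‖v‖) := by
    rw [← inner_sub_right, ← hnxy]
    exact real_inner_le_norm _ _
  rw [hnxy] at hb
  set J := P.ctrl.normJ * S.L15
  have hstep : P.Hg S.L2 d x y ≤ P.Hg S.L2 d' y z + d * (‖v‖ * S.ε) + ‖P.g‖ * (d * ‖v‖) +
      J * (d * ‖v‖) + L / 2 * d ^ 2 * ‖v‖ ^ 2 := by
    have := mul_le_mul_of_nonneg_left hinner hd.le
    unfold Pbar at hbal
    unfold Hg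
    rw [← hv, ← hv']
    linarith
  have hLd : L * d ≤ 1 := by rwa [le_div_iff₀ hL0, mul_comm] at hdL
  have hc : P.growth S = (‖P.g‖ + J) ^ 2 + S.ε ^ 2 := rfl
  have hv2 : σ * ‖v‖ ^ 2 ≤ 2 * P.Hg S.L2 d x y := by
    have h1 := P.sigmaMin_mul_sq_le_normSqM hn hM v
    have h2 := PbarG_nonneg hR hL2 x
    unfold Hg
    rw [← hv]
    linarith
  have hH' := Hg_nonneg hM hR hL2 d' y z
  set H := P.Hg S.L2 d x y
  set H' := P.Hg S.L2 d' y z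
  -- The three halves: Young's inequality for `ε‖v‖` and for `(‖g‖ + J)‖v‖`, and the curvature term
  -- with `Ld ≤ 1`, each cost `½‖v‖²`. Young produces half of the growth rate; the other half is
  -- slack.
  have hstep2 : H ≤ H' + d * (3 / 2 * ‖v‖ ^ 2) + P.growth S * d := by
    have a1 : ‖v‖ * S.ε ≤ 1 / 2 * ‖v‖ ^ 2 + 1 / 2 * S.ε ^ 2 := by nlinarith [sq_nonneg (‖v‖ - S.ε)]
    have a2 : ‖v‖ * (‖P.g‖ + J) ≤ 1 / 2 * ‖v‖ ^ 2 + 1 / 2 * (‖P.g‖ + J) ^ 2 := by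
      nlinarith [sq_nonneg (‖v‖ - (‖P.g‖ + J))]
    have a3 : L / 2 * d ^ 2 * ‖v‖ ^ 2 ≤ d * (1 / 2 * ‖v‖ ^ 2) := by
      have : L * d * (d * ‖v‖ ^ 2) ≤ 1 * (d * ‖v‖ ^ 2) := by gcongr
      nlinarith
    have a4 : d * (‖v‖ * S.ε + ‖v‖ * (‖P.g‖ + J)) ≤
        d * (1 / 2 * ‖v‖ ^ 2 + 1 / 2 * S.ε ^ 2 + (1 / 2 * ‖v‖ ^ 2 + 1 / 2 * (‖P.g‖ + J) ^ 2)) := by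
      gcongr
    have a5 : 0 ≤ d * ((‖P.g‖ + J) ^ 2 + S.ε ^ 2) := by positivity
    rw [hc]
    linarith
  have ht0 : 0 ≤ 3 * d / σ := by positivity
  have ht1 : 3 * d / σ ≤ 1 / 2 := by
    rw [div_le_iff₀ hσ]
    linarith
  have hexp := inv_one_sub_le_exp ht0 ht1
  -- Since `σ‖v‖² ≤ 2H`, the velocity term is at most `(3d/σ)H` and is absorbed on the left.
  have hfin : (1 - 3 * d / σ) * H ≤ H' + P.growth S * d := by
    have : d * (3 / 2 * ‖v‖ ^ 2) ≤ 3 * d / σ * H := by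
      have : 3 * d / σ * H = d * (3 / 2 * (2 * H / σ)) := by field_simp
      rw [this]
      gcongr
      rw [le_div_iff₀ hσ]
      linarith
    linarith
  have e6 : 6 * d / σ = 2 * (3 * d / σ) := by ring
  have hH := Hg_nonneg hM hR hL2 d x y
  rw [e6]
  calc H ≤ Real.exp (2 * (3 * d / σ)) * (1 - 3 * d / σ) * H := le_mul_of_one_le_left hH hexp
    _ = Real.exp (2 * (3 * d / σ)) * ((1 - 3 * d / σ) * H) := by ring
    _ ≤ _ := by gcongr

/-- The energy of the `i`-th configuration. -/
noncomputable def HgAt (P : Problem n mu N me mi nR) (L2 : ℝ) (G : Grid N) (θ : Blocks G.m n)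
    (i : Fin G.m) : ℝ := P.Hg L2 (G.step P.δ i) (θ i) (before P.θ₀ θ i)

/-- The energy of the predecessor of the `i`-th configuration. -/
noncomputable def HgBefore (P : Problem n mu N me mi nR) (L2 : ℝ) (G : Grid N) (θ : Blocks G.m n)
    (i : Fin G.m) : ℝ :=
  P.Hg L2 (before P.δ (G.step P.δ) i) (before P.θ₀ θ i) (before P.θprev (before P.θ₀ θ) i)

/-- The energy grew at most by the permitted amount in the `i`-th step. -/
def EnergyOK (P : Problem n mu N me mi nR) (S : Params) (G : Grid N) (θ : Blocks G.m n)
    (i : Fin G.m) : Prop :=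
  P.HgAt S.L2 G θ i ≤ Real.exp (6 * G.step P.δ i / sigmaMin P.Mop) *
    (P.HgBefore S.L2 G θ i + P.growth S * G.step P.δ i)

/-- Growth over time `T` followed by growth over time `d`: the new source `c·d` may be moved under
the factor `e^{6T/σ} ≥ 1`, after which the exponentials multiply. -/
theorem growth_step {σ c T d H₀ H H' : ℝ} (hσ : 0 < σ) (hc : 0 ≤ c) (hT : 0 ≤ T) (hd : 0 ≤ d)
    (hH' : H' ≤ Real.exp (6 * T / σ) * (H₀ + c * T)) (hH : H ≤ Real.exp (6 * d / σ) * (H' + c * d)) :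
    H ≤ Real.exp (6 * (T + d) / σ) * (H₀ + c * (T + d)) := by
  have h1 : 1 ≤ Real.exp (6 * T / σ) := Real.one_le_exp (by positivity)
  have h2 : c * d ≤ Real.exp (6 * T / σ) * (c * d) := le_mul_of_one_le_left (by positivity) h1
  calc H ≤ Real.exp (6 * d / σ) * (Real.exp (6 * T / σ) * (H₀ + c * T) +
        Real.exp (6 * T / σ) * (c * d)) := hH.trans (by gcongr)
    _ = (Real.exp (6 * T / σ) * Real.exp (6 * d / σ)) * (H₀ + c * (T + d)) := by ring
    _ = _ := by
      rw [← Real.exp_add]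
      congr 2
      ring

/-- Discrete Gronwall along the grid: the steps up to index `k` add up to the elapsed time `δ t_k`.
The start is the `L₂`-independent `Hg₀`, because no penalty is active at `θ₀`. -/
theorem HgAt_le_of_energyOK (hn : 0 < n) (hM : P.M.PosDef) (hδ : 0 < P.δ)
    (hR : P.RelaxationAssumption) (hS : P.SlaterAssumption) {S : Params} (hL2 : 0 < S.L2)
    (hhi : ∀ j, 1 / P.hi j P.θ₀ < S.L2) (hp : P.p P.θ₀ < S.L2) (G : Grid N) (θ : Blocks G.m n)
    (k : ℕ) (hk : k < G.m) (hok : ∀ j ≤ (⟨k, hk⟩ : Fin G.m), P.EnergyOK S G θ j) :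
    P.HgAt S.L2 G θ ⟨k, hk⟩ ≤ Real.exp (6 * (P.δ * G.t ⟨k, hk⟩) / sigmaMin P.Mop) *
      (P.Hg₀ + P.growth S * (P.δ * G.t ⟨k, hk⟩)) := by
  have hσ := P.sigmaMin_Mop_pos hn hM
  induction k with
  | zero =>
    have h := hok ⟨0, hk⟩ le_rfl
    have e : P.HgBefore S.L2 G θ ⟨0, hk⟩ = P.Hg₀ := Hg_zero hR hS hL2 hhi hp
    have e2 : G.step P.δ ⟨0, hk⟩ = P.δ * G.t ⟨0, hk⟩ := by
      rw [Grid.step, before_zero, sub_zero]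
    unfold EnergyOK at h
    rwa [e, e2] at h
  | succ k ih =>
    have h := hok ⟨k + 1, hk⟩ le_rfl
    have h' := ih (by omega) fun j hj => hok j (hj.trans (Fin.mk_le_mk.2 (by omega)))
    have e : P.δ * G.t ⟨k + 1, hk⟩ = P.δ * G.t ⟨k, by omega⟩ + G.step P.δ ⟨k + 1, hk⟩ := by
      rw [Grid.step, before_succ]
      ring
    rw [e]
    exact growth_step hσ (growth_nonneg S) (mul_nonneg hδ.le (G.pos _).le) (G.step_pos hδ _).le h' h

theorem Hg₀_nonneg (hM : P.M.PosDef) (hR : P.RelaxationAssumption) : 0 ≤ P.Hg₀ := by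
  have h1 := P.normSqM_nonneg hM (P.δ⁻¹ • (P.θ₀ - P.θprev))
  have h2 := hR.p_nonneg P.θ₀
  unfold Hg₀
  positivity

theorem HgAt_le_L14 (hn : 0 < n) (hM : P.M.PosDef) (hδ : 0 < P.δ)
    (hR : P.RelaxationAssumption) (hS : P.SlaterAssumption) {S : Params} (hL2 : 0 < S.L2)
    (hhi : ∀ j, 1 / P.hi j P.θ₀ < S.L2) (hp : P.p P.θ₀ < S.L2) (G : Grid N) (θ : Blocks G.m n)
    (i : Fin G.m) (hok : ∀ j ≤ i, P.EnergyOK S G θ j) :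
    P.HgAt S.L2 G θ i ≤ P.L14 S := by
  have hσ := P.sigmaMin_Mop_pos hn hM
  refine (HgAt_le_of_energyOK hn hM hδ hR hS hL2 hhi hp G θ i.1 i.2 hok).trans ?_
  have h1 : P.δ * G.t i ≤ N * P.δ := by
    rw [mul_comm]
    exact mul_le_mul_of_nonneg_right (G.le i) hδ.le
  have h2 := Hg₀_nonneg hM hR
  have h3 := growth_nonneg (P := P) S
  have h4 : 0 ≤ P.δ * G.t i := mul_nonneg hδ.le (G.pos i).le
  unfold L14
  rw [mul_assoc 6]
  gcongr

theorem L14_pos (hN : 0 < N) (hM : P.M.PosDef) (hδ : 0 < P.δ) (hR : P.RelaxationAssumption)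
    {S : Params} (hε : 0 < S.ε) : 0 < P.L14 S := by
  have h1 := Hg₀_nonneg hM hR
  have h2 : 0 < P.growth S := by
    unfold growth
    positivity
  have h3 : (0 : ℝ) < N := by exact_mod_cast hN
  unfold L14
  positivity

theorem L16_pos (hn : 0 < n) (hN : 0 < N) (hM : P.M.PosDef) (hδ : 0 < P.δ)
    (hR : P.RelaxationAssumption) {S : Params} (hS : P.Admissible S) {L : ℝ} (hL : 0 < L) :
    0 < P.L16 S L := by
  have hσ := P.sigmaMin_Mop_pos hn hM
  have h14 := L14_pos hN hM hδ hR hS.ε_pos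
  have h3 := hS.L3_pos
  have h1 : 0 < 1 - S.ε := sub_pos.2 hS.ε_lt
  unfold L16
  refine lt_min (lt_min ?_ ?_) (lt_min ?_ ?_) <;> positivity

theorem Admissible.L2_pos {S : Params} (h : P.Admissible S) : 0 < S.L2 :=
  (one_div_pos.2 h.ε_pos).trans h.L2_ε

theorem εSQP_pos {S : Params} (h : 0 < S.ε) : 0 < εSQP (nR := nR) S := by
  unfold εSQP
  split_ifs
  · exact h
  · positivity

theorem εSQP_le {S : Params} (h : 0 < S.ε) : εSQP (nR := nR) S ≤ S.ε := by
  unfold εSQP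
  split_ifs
  · exact le_rfl
  · have : (2 : ℝ) ^ (2 / 3 : ℝ) ≤ 2 ^ (1 : ℝ) :=
      Real.rpow_le_rpow_of_exponent_le (by norm_num) (by norm_num)
    rw [Real.rpow_one] at this
    rw [div_le_iff₀ (by norm_num)]
    nlinarith

theorem norm_le_sum_abs {m : ℕ} (x : Vec m) : ‖x‖ ≤ ∑ j, |x j| := by
  rw [EuclideanSpace.norm_eq]
  refine Real.sqrt_le_iff.2 ⟨Finset.sum_nonneg fun _ _ => abs_nonneg _, ?_⟩
  simp only [Real.norm_eq_abs]
  exact Finset.sum_sq_le_sq_sum_of_nonneg fun _ _ => abs_nonneg _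

theorem norm_res_le_viol (G : Grid N) (L2 : ℝ) (θ : Blocks G.m n) (u : Blocks N mu) (i : Fin G.m) :
    ‖P.res G L2 θ u i‖ ≤ P.viol G L2 θ u :=
  (norm_le_sum_abs _).trans (Finset.single_le_sum (f := fun i => ∑ j, |P.res G L2 θ u i j|)
    (fun _ _ => Finset.sum_nonneg fun _ _ => abs_nonneg _) (Finset.mem_univ i))

/-- Configurations of low energy that are close to each other have rotations of the same
orientation. -/
theorem sign_det_eq_of_PbarG_lt (hR : P.RelaxationAssumption) {S : Params} (hS : P.Admissible S)
    {x y : Vec n} (hx : P.PbarG S.L2 x < S.L2) (hy : P.PbarG S.L2 y < S.L2)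
    (hxy : ‖x - y‖ ≤ 2 * (1 - S.ε)) (r : Fin nR) :
    SignType.sign (subMatrix (P.rot r) x).det = SignType.sign (subMatrix (P.rot r) y).det := by
  have hL2 := hS.L2_pos
  have hlt : 1 / S.L2 < S.ε := by
    have := hS.L2_ε
    rwa [one_div_lt hS.ε_pos hL2] at this
  have key : ∀ x : Vec n, P.PbarG S.L2 x < S.L2 →
      frob ((subMatrix (P.rot r) x).transpose * subMatrix (P.rot r) x - 1) < S.ε := fun x hx =>
    (le_abs_self _).trans_lt ((abs_heAll_lt hR hL2 hx (Sum.inr r)).trans hlt)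
  refine sign_det_eq_of_frob hS.ε_pos hS.ε_lt (key x hx) (key y hy) ?_
  have e : subMatrix (P.rot r) x - subMatrix (P.rot r) y = subMatrix (P.rot r) (x - y) := by
    ext a c
    simp [subMatrix]
  rw [e, frob_subMatrix]
  exact (norm_subVec_le _ _).trans hxy

/-- The final checks can fail first only at a large timestep. -/
theorem lt_step_of_checkFails (hn : 0 < n) (hN : 0 < N) (hM : P.M.PosDef) (hδ : 0 < P.δ)
    (hR : P.RelaxationAssumption) (hSl : P.SlaterAssumption) {S : Params} (hS : P.Admissible S)
    {L : ℝ} (hL0 : 0 < L) (hL : ∀ v ∈ P.X, CurvatureBounded L (P.Pbar S.L2 v)) (G : Grid N)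
    (θ : Blocks G.m n) {u : Blocks N mu} (hu : ∀ k, u k ∈ P.X)
    (hviol : P.viol G S.L2 θ u < εSQP (nR := nR) S) (i : Fin G.m)
    (hi : IsLeast {i | P.CheckFails S G θ i} i) : P.L16 S L < G.step P.δ i := by
  by_contra! hle
  have hL2 := hS.L2_pos
  have hσ := P.sigmaMin_Mop_pos hn hM
  have hd := G.step_pos hδ i
  have h14 := L14_pos (P := P) hN hM hδ hR hS.ε_pos
  have hdL : G.step P.δ i ≤ 1 / L := hle.trans ((min_le_left _ _).trans (min_le_right _ _))
  have hdσ : G.step P.δ i ≤ sigmaMin P.Mop / 6 :=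
    hle.trans ((min_le_right _ _).trans (min_le_left _ _))
  have hd4 : G.step P.δ i ≤ √(2 * sigmaMin P.Mop / P.L14 S) * (1 - S.ε) :=
    hle.trans ((min_le_right _ _).trans (min_le_right _ _))
  have hres : ‖gradient (P.stepEnergy G S.L2 θ u i) (θ i)‖ ≤ S.ε :=
    (norm_res_le_viol G S.L2 θ u i).trans (hviol.le.trans (εSQP_le hS.ε_pos))
  have hok_i : P.EnergyOK S G θ i :=
    Hg_le_of_residual hn hM hR hL2 hL0 hS.ε_pos hS.L15_bound (hu _) (hL _ (hu _)) hd hdL hdσ hres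
  -- Minimality of the failing index gives the energy test at all earlier ones; at `i` itself it
  -- follows from the small residual.
  have hok : ∀ j ≤ i, P.EnergyOK S G θ j := by
    intro j hj
    rcases hj.eq_or_lt with rfl | hlt
    · exact hok_i
    · by_contra hno
      exact absurd (hi.2 (show P.CheckFails S G θ j from Or.inl (not_le.1 hno))) (not_le.2 hlt)
  have hHi := HgAt_le_L14 hn hM hδ hR hSl hL2 hS.L2_hi hS.L2_p G θ i hok
  rcases hi.1 with hE | ⟨r, hr⟩
  · exact absurd hok_i (not_le.2 hE)
  refine hr (sign_det_eq_of_PbarG_lt hR hS ?_ ?_ ?_ r)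
  · have h1 := P.normSqM_nonneg hM ((G.step P.δ i)⁻¹ • (θ i - before P.θ₀ θ i))
    have h2 := hS.L2_L14
    unfold HgAt Hg at hHi
    linarith
  -- The predecessor also lies below the barrier: it is either `θ₀`, or an earlier configuration to
  -- which the same energy bound applies.
  · obtain ⟨k, hk⟩ := i
    cases k with
    | zero =>
      rw [before_zero, PbarG_θ₀ hR hSl hL2 hS.L2_hi hS.L2_p]
      exact hS.L2_p
    | succ k =>
      rw [before_succ]
      have h3 := HgAt_le_L14 hn hM hδ hR hSl hL2 hS.L2_hi hS.L2_p G θ ⟨k, by omega⟩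
        fun j hj => hok j (hj.trans (Fin.mk_le_mk.2 (by omega)))
      have h1 := P.normSqM_nonneg hM ((G.step P.δ ⟨k, by omega⟩)⁻¹ •
        (θ ⟨k, by omega⟩ - before P.θ₀ θ ⟨k, by omega⟩))
      have h2 := hS.L2_L14
      unfold HgAt Hg at h3
      linarith
  · have h1 := P.sigmaMin_mul_sq_le_normSqM hn hM ((G.step P.δ i)⁻¹ • (θ i - before P.θ₀ θ i))
    have h2 := PbarG_nonneg hR hL2 (θ i)
    unfold HgAt Hg at hHi
    rw [norm_smul, norm_inv, Real.norm_of_nonneg hd.le, mul_pow] at h1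
    have hε1 : 0 < 1 - S.ε := sub_pos.2 hS.ε_lt
    set d := G.step P.δ i
    set σ := sigmaMin P.Mop
    -- From kinetic energy to distance: `σ‖θᵢ - θ_γ(i)‖² ≤ 2 L₁₄ d²`. The last entry of `L16` makes
    -- the right side at most `σ(2(1-ε))²`.
    have h3 : d ^ 2 ≤ 2 * σ / P.L14 S * (1 - S.ε) ^ 2 := by
      calc d ^ 2 ≤ (√(2 * σ / P.L14 S) * (1 - S.ε)) ^ 2 := by gcongr
        _ = _ := by rw [mul_pow, Real.sq_sqrt (by positivity)]
    have h4 : σ * (d⁻¹ ^ 2 * ‖θ i - before P.θ₀ θ i‖ ^ 2) ≤ 2 * P.L14 S := by linarith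
    have h5 : σ * ‖θ i - before P.θ₀ θ i‖ ^ 2 ≤ 2 * P.L14 S * d ^ 2 := by
      calc _ = σ * (d⁻¹ ^ 2 * ‖θ i - before P.θ₀ θ i‖ ^ 2) * d ^ 2 := by field_simp
        _ ≤ _ := by gcongr
    have h6 : 2 * P.L14 S * d ^ 2 ≤ σ * (2 * (1 - S.ε)) ^ 2 := by
      calc 2 * P.L14 S * d ^ 2 ≤ 2 * P.L14 S * (2 * σ / P.L14 S * (1 - S.ε) ^ 2) := by gcongr
        _ = _ := by field_simp
    exact le_of_sq_le_sq (le_of_mul_le_mul_left (h5.trans h6) hσ) (by positivity)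

end Problem

/-! ### Derivatives of predecessors, partial derivatives and block components -/

theorem hasFDerivAt_before {E F : Type*} [NormedAddCommGroup E] [NormedSpace ℝ E]
    [NormedAddCommGroup F] [NormedSpace ℝ F] {m : ℕ} {f : E → Fin m → F} {f' : Fin m → E →L[ℝ] F}
    {z : E} (x : F) (h : ∀ j, HasFDerivAt (fun z => f z j) (f' j) z) (i : Fin m) :
    HasFDerivAt (fun z => before x (f z) i) (before 0 f' i) z := by
  obtain ⟨i, hi⟩ := i
  cases i with
  | zero => exact hasFDerivAt_const _ _
  | succ k => exact h _

theorem before_clm_apply {E F : Type*} [NormedAddCommGroup E] [NormedSpace ℝ E]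
    [NormedAddCommGroup F] [NormedSpace ℝ F] {m : ℕ} (f : Fin m → E →L[ℝ] F) (v : E) (i : Fin m) :
    before 0 f i v = before 0 (fun j => f j v) i := by
  obtain ⟨i, hi⟩ := i
  cases i with
  | zero => rfl
  | succ k => rfl

section Partial
variable {E F W : Type*} [NormedAddCommGroup E] [NormedSpace ℝ E] [NormedAddCommGroup F]
  [NormedSpace ℝ F] [NormedAddCommGroup W] [NormedSpace ℝ W]

theorem hasFDerivAt_partial_fst {f : E × F → W} {f' : E × F →L[ℝ] W} {x : E} {y : F}
    (h : HasFDerivAt f f' (x, y)) :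
    HasFDerivAt (fun x => f (x, y)) (f'.comp (ContinuousLinearMap.inl ℝ E F)) x :=
  HasFDerivAt.comp (g := f) (f := fun x => (x, y)) x h (hasFDerivAt_prodMk_left x y)

theorem hasFDerivAt_partial_snd {f : E × F → W} {f' : E × F →L[ℝ] W} {x : E} {y : F}
    (h : HasFDerivAt f f' (x, y)) :
    HasFDerivAt (fun y => f (x, y)) (f'.comp (ContinuousLinearMap.inr ℝ E F)) y :=
  HasFDerivAt.comp (g := f) (f := fun y => (x, y)) y h (hasFDerivAt_prodMk_right x y)

theorem fderiv_partial_fst_apply {f : E × F → W} {f' : E × F →L[ℝ] W} {x : E} {y : F}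
    (h : HasFDerivAt f f' (x, y)) (v : E) : fderiv ℝ (fun x => f (x, y)) x v = f' (v, 0) := by
  rw [(hasFDerivAt_partial_fst h).fderiv]
  rfl

theorem fderiv_partial_snd_apply {f : E × F → W} {f' : E × F →L[ℝ] W} {x : E} {y : F}
    (h : HasFDerivAt f f' (x, y)) (w : F) : fderiv ℝ (fun y => f (x, y)) y w = f' (0, w) := by
  rw [(hasFDerivAt_partial_snd h).fderiv]
  rfl

theorem fderiv_block_apply {m n : ℕ} {f : E → Blocks m n} {f' : E →L[ℝ] Blocks m n} {z : E}
    (h : HasFDerivAt f f' z) {i : Fin m} {c : E →L[ℝ] Vec n}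
    (hc : HasFDerivAt (fun z => f z i) c z) (v : E) : f' v i = c v := by
  have h1 := (PiLp.proj 2 (𝕜 := ℝ) (fun _ : Fin m => Vec n) i).hasFDerivAt.comp z h
  exact congrArg (fun T => T v) (h1.unique hc)

end Partial

/-! ### Norms of block vectors -/

section Blocks
variable {m n : ℕ}

theorem norm_le_sum_norm (x : Blocks m n) : ‖x‖ ≤ ∑ i, ‖x i‖ := by
  rw [PiLp.norm_eq_of_L2]
  refine Real.sqrt_le_iff.2 ⟨Finset.sum_nonneg fun _ _ => norm_nonneg _, ?_⟩
  exact Finset.sum_sq_le_sq_sum_of_nonneg fun _ _ => norm_nonneg _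

/-- The `ℓ¹` norm of a block vector. -/
noncomputable def oneNorm (x : Blocks m n) : ℝ := ∑ i, ∑ j, |x i j|

theorem oneNorm_nonneg (x : Blocks m n) : 0 ≤ oneNorm x :=
  Finset.sum_nonneg fun _ _ => Finset.sum_nonneg fun _ _ => abs_nonneg _

theorem oneNorm_add_le (x y : Blocks m n) : oneNorm (x + y) ≤ oneNorm x + oneNorm y := by
  unfold oneNorm
  simp only [← Finset.sum_add_distrib]
  exact Finset.sum_le_sum fun i _ => Finset.sum_le_sum fun j _ => abs_add_le _ _

theorem oneNorm_smul (c : ℝ) (x : Blocks m n) : oneNorm (c • x) = |c| * oneNorm x := by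
  simp [oneNorm, Finset.mul_sum, abs_mul]

theorem oneNorm_le (x : Blocks m n) : oneNorm x ≤ m * n * ‖x‖ := by
  have h : ∀ i j, |x i j| ≤ ‖x‖ := fun i j =>
    (PiLp.norm_apply_le (x i) j).trans (PiLp.norm_apply_le x i)
  calc oneNorm x ≤ ∑ _i : Fin m, ∑ _j : Fin n, ‖x‖ :=
        Finset.sum_le_sum fun i _ => Finset.sum_le_sum fun j _ => h i j
    _ = _ := by
      simp
      ring

theorem norm_le_oneNorm (x : Blocks m n) : ‖x‖ ≤ oneNorm x :=
  (norm_le_sum_norm x).trans (Finset.sum_le_sum fun i _ => Problem.norm_le_sum_abs (x i))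

/-- Duality between block multipliers and the `ℓ¹` norm. -/
theorem inner_le_iSup_norm_mul_oneNorm (μ r : Blocks m n) :
    ⟪μ, r⟫_ℝ ≤ (⨆ i, ‖μ i‖) * oneNorm r := by
  rw [PiLp.inner_apply, oneNorm, Finset.mul_sum]
  refine Finset.sum_le_sum fun i _ => (real_inner_le_norm _ _).trans ?_
  exact mul_le_mul (le_ciSup (Set.finite_range fun i => ‖μ i‖).bddAbove i)
    (Problem.norm_le_sum_abs (r i)) (norm_nonneg _) (Real.iSup_nonneg fun _ => norm_nonneg _)

end Blocks

namespace Problem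
variable {n mu N me mi nR : ℕ} {P : Problem n mu N me mi nR}

/-! ### Trajectories with feasible controls -/

theorem viol_eq_oneNorm (G : Grid N) (L2 : ℝ) (θ : Blocks G.m n) (u : Blocks N mu) :
    P.viol G L2 θ u = oneNorm (P.res G L2 θ u) := rfl

variable (P) in
/-- Block vectors of feasible controls. -/
def ctrlSet : Set (Blocks N mu) := {u | ∀ k, u k ∈ P.X}

variable (P) in
/-- Trajectories with feasible controls. -/
def dom (G : Grid N) : Set (Blocks G.m n × Blocks N mu) := Set.univ ×ˢ P.ctrlSet

theorem convex_ctrlSet (hO : P.ObjectiveAssumption) : Convex ℝ P.ctrlSet :=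
  fun _ hu _ hv _ _ ha hb hab k => hO.convex (hu k) (hv k) ha hb hab

theorem convex_dom (hO : P.ObjectiveAssumption) (G : Grid N) : Convex ℝ (P.dom G) :=
  convex_univ.prod (convex_ctrlSet hO)

theorem isCompact_ctrlSet (hO : P.ObjectiveAssumption) : IsCompact P.ctrlSet := by
  have h := isCompact_univ_pi fun _ : Fin N => hO.compact
  have h2 := h.image (PiLp.continuous_toLp 2 fun _ : Fin N => Vec mu)
  convert h2 using 1
  ext u
  constructor
  · intro hu
    exact ⟨u.ofLp, fun k _ => hu k, rfl⟩
  · rintro ⟨v, hv, rfl⟩ k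
    exact hv k (Set.mem_univ k)

theorem isClosed_dom (hO : P.ObjectiveAssumption) (G : Grid N) : IsClosed (P.dom G) :=
  isClosed_univ.prod (isCompact_ctrlSet hO).isClosed

/-! ### Derivative of the residual -/

variable (P) in
/-- The linear part of the discretized inertial force on a trajectory that starts with `x` and
`x'`. -/
noncomputable def inertia (G : Grid N) (x' x : Vec n) (θ : Fin G.m → Vec n) (i : Fin G.m) : Vec n :=
  (1 / G.step P.δ i ^ 2) • P.Mop (θ i -
    (1 + G.step P.δ i / before P.δ (G.step P.δ) i) • before x θ i +
    (G.step P.δ i / before P.δ (G.step P.δ) i) • before x' (before x θ) i)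

theorem res_apply (hM : P.M.PosDef) (hR : P.RelaxationAssumption) {L2 : ℝ} (hL2 : 0 < L2)
    (G : Grid N) (θ : Blocks G.m n) (u : Blocks N mu) (i : Fin G.m) :
    P.res G L2 θ u i = P.inertia G P.θprev P.θ₀ θ i + (gradient (P.PbarG L2) (θ i) - P.g +
      gradient (fun x => P.ctrl.b x (u (G.ctrlIdx i))) (θ i)) := by
  rw [← gradient_Pbar hR hL2]
  exact gradient_Ebar hM hR hL2 _ _ _ _ _ _

variable (P) in
/-- Derivative of the inertial force. -/
noncomputable def inertiaCLM (G : Grid N) (i : Fin G.m) : Blocks G.m n →L[ℝ] Vec n :=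
  (1 / G.step P.δ i ^ 2) • P.Mop.comp (PiLp.proj 2 (𝕜 := ℝ) (fun _ : Fin G.m => Vec n) i -
    (1 + G.step P.δ i / before P.δ (G.step P.δ) i) •
      before 0 (fun j => PiLp.proj 2 (𝕜 := ℝ) (fun _ : Fin G.m => Vec n) j) i +
    (G.step P.δ i / before P.δ (G.step P.δ) i) •
      before 0 (before 0 (fun j => PiLp.proj 2 (𝕜 := ℝ) (fun _ : Fin G.m => Vec n) j)) i)

/-- The inertial force is affine in the trajectory, so its derivative is the same expression with
zero initial data. -/
theorem inertiaCLM_apply (G : Grid N) (i : Fin G.m) (v : Blocks G.m n) :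
    P.inertiaCLM G i v = P.inertia G 0 0 v i := by
  simp only [inertiaCLM, inertia, smul_apply, ContinuousLinearMap.comp_apply, add_apply, sub_apply,
    before_clm_apply, PiLp.proj_apply]

theorem hasFDerivAt_inertia (G : Grid N) (x' x : Vec n) (θ : Blocks G.m n) (i : Fin G.m) :
    HasFDerivAt (fun θ : Blocks G.m n => P.inertia G x' x θ i) (P.inertiaCLM G i) θ := by
  have h0 : ∀ j, HasFDerivAt (fun θ : Blocks G.m n => θ j)
      (PiLp.proj 2 (𝕜 := ℝ) (fun _ : Fin G.m => Vec n) j) θ := fun j =>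
    (PiLp.proj 2 (𝕜 := ℝ) (fun _ : Fin G.m => Vec n) j).hasFDerivAt
  have h1 := hasFDerivAt_before x h0
  have h2 := hasFDerivAt_before x' h1 i
  have h3 := ((h0 i).fun_sub ((h1 i).fun_const_smul
    (1 + G.step P.δ i / before P.δ (G.step P.δ) i))).fun_add
    (h2.fun_const_smul (G.step P.δ i / before P.δ (G.step P.δ) i))
  exact (P.Mop.hasFDerivAt.comp θ h3).fun_const_smul _

variable (P) in
/-- The gradient of the control energy, as a function of configuration and control. -/
noncomputable def gradB (z : Vec n × Vec mu) : Vec n := gradient (fun x => P.ctrl.b x z.2) z.1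

/-- The map `(θ, u) ↦ (θ_i, u_{ι(i)})`. -/
noncomputable def localCLM (n mu : ℕ) (G : Grid N) (i : Fin G.m) :
    (Blocks G.m n × Blocks N mu) →L[ℝ] Vec n × Vec mu :=
  ((PiLp.proj 2 (𝕜 := ℝ) (fun _ : Fin G.m => Vec n) i).comp (ContinuousLinearMap.fst ℝ _ _)).prod
    ((PiLp.proj 2 (𝕜 := ℝ) (fun _ : Fin N => Vec mu) (G.ctrlIdx i)).comp
      (ContinuousLinearMap.snd ℝ _ _))

/-- At a feasible control this is a full Fréchet derivative, not one relative to the control set.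
Its existence and continuity are known only on `dom`, hence the arguments on this closed convex set
below. -/
theorem hasFDerivAt_res_apply (hM : P.M.PosDef) (hR : P.RelaxationAssumption)
    (hC : P.ControlAssumption) {L2 : ℝ} (hL2 : 0 < L2) (G : Grid N)
    {z : Blocks G.m n × Blocks N mu} (hz : z ∈ P.dom G) (i : Fin G.m) :
    HasFDerivAt (fun z : Blocks G.m n × Blocks N mu => P.res G L2 z.1 z.2 i)
      ((P.inertiaCLM G i).comp (ContinuousLinearMap.fst ℝ _ _) +
        ((fderiv ℝ (gradient (P.PbarG L2)) (z.1 i)).comp ((ContinuousLinearMap.fst ℝ _ _).comp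
          (localCLM n mu G i)) +
        (fderiv ℝ P.gradB (z.1 i, z.2 (G.ctrlIdx i))).comp (localCLM n mu G i))) z := by
  simp only [res_apply hM hR hL2]
  have h1 := (hasFDerivAt_inertia (P := P) G P.θprev P.θ₀ z.1 i).comp z hasFDerivAt_fst
  have h2 : HasFDerivAt (gradient (P.PbarG L2)) (fderiv ℝ (gradient (P.PbarG L2)) (z.1 i)) (z.1 i) :=
    ((contDiff_gradient (contDiff_PbarG hR hL2)).differentiable (by norm_num) _).hasFDerivAt
  have h3 : HasFDerivAt P.gradB (fderiv ℝ P.gradB (z.1 i, z.2 (G.ctrlIdx i)))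
      (localCLM n mu G i z) := (hC.diff2 _ _ (hz.2 _)).hasFDerivAt
  have h4 := h2.comp z (f := fun z : Blocks G.m n × Blocks N mu => z.1 i)
    ((ContinuousLinearMap.fst ℝ _ _).comp (localCLM n mu G i)).hasFDerivAt
  exact h1.add ((h4.sub_const P.g).add (h3.comp z (localCLM n mu G i).hasFDerivAt))

theorem differentiableAt_res (hM : P.M.PosDef) (hR : P.RelaxationAssumption)
    (hC : P.ControlAssumption) {L2 : ℝ} (hL2 : 0 < L2) (G : Grid N)
    {z : Blocks G.m n × Blocks N mu} (hz : z ∈ P.dom G) :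
    DifferentiableAt ℝ (fun z : Blocks G.m n × Blocks N mu => P.res G L2 z.1 z.2) z :=
  (differentiableAt_piLp 2).2 fun i => (hasFDerivAt_res_apply hM hR hC hL2 G hz i).differentiableAt

variable (P) in
/-- The joint derivative of the residual. -/
noncomputable def resDeriv (G : Grid N) (L2 : ℝ) (z : Blocks G.m n × Blocks N mu) :
    (Blocks G.m n × Blocks N mu) →L[ℝ] Blocks G.m n :=
  fderiv ℝ (fun z : Blocks G.m n × Blocks N mu => P.res G L2 z.1 z.2) z

theorem hasFDerivAt_res (hM : P.M.PosDef) (hR : P.RelaxationAssumption)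
    (hC : P.ControlAssumption) {L2 : ℝ} (hL2 : 0 < L2) (G : Grid N)
    {z : Blocks G.m n × Blocks N mu} (hz : z ∈ P.dom G) :
    HasFDerivAt (fun z : Blocks G.m n × Blocks N mu => P.res G L2 z.1 z.2) (P.resDeriv G L2 z) z :=
  (differentiableAt_res hM hR hC hL2 G hz).hasFDerivAt

theorem resDeriv_apply (hM : P.M.PosDef) (hR : P.RelaxationAssumption)
    (hC : P.ControlAssumption) {L2 : ℝ} (hL2 : 0 < L2) (G : Grid N)
    {z : Blocks G.m n × Blocks N mu} (hz : z ∈ P.dom G) (v : Blocks G.m n × Blocks N mu)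
    (i : Fin G.m) : P.resDeriv G L2 z v i = P.inertia G 0 0 v.1 i +
      (fderiv ℝ (gradient (P.PbarG L2)) (z.1 i) (v.1 i) +
        fderiv ℝ P.gradB (z.1 i, z.2 (G.ctrlIdx i)) (v.1 i, v.2 (G.ctrlIdx i))) := by
  rw [fderiv_block_apply (hasFDerivAt_res hM hR hC hL2 G hz)
    (hasFDerivAt_res_apply hM hR hC hL2 G hz i) v, ← inertiaCLM_apply]
  rfl

/-- In finite dimensions continuity of an operator-valued map can be tested on each vector and in
each block. There the two Hessians are the only terms that vary with the point. -/
theorem continuousOn_resDeriv (hM : P.M.PosDef) (hR : P.RelaxationAssumption)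
    (hC : P.ControlAssumption) {L2 : ℝ} (hL2 : 0 < L2) (G : Grid N) :
    ContinuousOn (P.resDeriv G L2) (P.dom G) := by
  rw [continuousOn_clm_apply]
  intro v
  have hcomp : ∀ i, ContinuousOn (fun z => P.resDeriv G L2 z v i) (P.dom G) := by
    intro i
    refine ContinuousOn.congr (f := fun z : Blocks G.m n × Blocks N mu => P.inertia G 0 0 v.1 i +
      (fderiv ℝ (gradient (P.PbarG L2)) (z.1 i) (v.1 i) +
        fderiv ℝ P.gradB (z.1 i, z.2 (G.ctrlIdx i)) (v.1 i, v.2 (G.ctrlIdx i)))) ?_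
      fun z hz => resDeriv_apply hM hR hC hL2 G hz v i
    refine continuousOn_const.add (ContinuousOn.add ?_ ?_)
    · have h := (contDiff_gradient (contDiff_PbarG hR hL2)).continuous_fderiv (by norm_num)
      have h' : Continuous fun z : Blocks G.m n × Blocks N mu => z.1 i := by fun_prop
      exact ((h.comp h').clm_apply continuous_const).continuousOn
    · have h : ContinuousOn (fderiv ℝ P.gradB) (Set.univ ×ˢ P.X) := hC.lip2.continuousOn
      exact (h.comp (localCLM n mu G i).continuous.continuousOn
        fun z hz => ⟨Set.mem_univ _, hz.2 _⟩).clm_apply continuousOn_const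
  exact (PiLp.continuous_toLp 2 _).comp_continuousOn (continuousOn_pi.2 hcomp)

theorem jacθ_eq (hM : P.M.PosDef) (hR : P.RelaxationAssumption)
    (hC : P.ControlAssumption) {L2 : ℝ} (hL2 : 0 < L2) (G : Grid N) (θ : Blocks G.m n)
    {u : Blocks N mu} (hu : u ∈ P.ctrlSet) (v : Blocks G.m n) :
    P.jacθ G L2 θ u v = P.resDeriv G L2 (θ, u) (v, 0) :=
  fderiv_partial_fst_apply (f := fun z : Blocks G.m n × Blocks N mu => P.res G L2 z.1 z.2)
    (hasFDerivAt_res hM hR hC hL2 G (z := (θ, u)) ⟨Set.mem_univ _, hu⟩) v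

theorem jacu_eq (hM : P.M.PosDef) (hR : P.RelaxationAssumption)
    (hC : P.ControlAssumption) {L2 : ℝ} (hL2 : 0 < L2) (G : Grid N) (θ : Blocks G.m n)
    {u : Blocks N mu} (hu : u ∈ P.ctrlSet) (v : Blocks N mu) :
    P.jacu G L2 θ u v = P.resDeriv G L2 (θ, u) (0, v) :=
  fderiv_partial_snd_apply (f := fun z : Blocks G.m n × Blocks N mu => P.res G L2 z.1 z.2)
    (hasFDerivAt_res hM hR hC hL2 G (z := (θ, u)) ⟨Set.mem_univ _, hu⟩) v

theorem jac_add (hM : P.M.PosDef) (hR : P.RelaxationAssumption)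
    (hC : P.ControlAssumption) {L2 : ℝ} (hL2 : 0 < L2) (G : Grid N) (θ : Blocks G.m n)
    {u : Blocks N mu} (hu : u ∈ P.ctrlSet) (v : Blocks G.m n) (w : Blocks N mu) :
    P.jacθ G L2 θ u v + P.jacu G L2 θ u w = P.resDeriv G L2 (θ, u) (v, w) := by
  rw [jacθ_eq hM hR hC hL2 G θ hu, jacu_eq hM hR hC hL2 G θ hu, ← map_add]
  simp

theorem fderiv_gradient_Pbar_apply (hR : P.RelaxationAssumption) (hC : P.ControlAssumption)
    {L2 : ℝ} (hL2 : 0 < L2) {u : Vec mu} (hu : u ∈ P.X) (x v : Vec n) :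
    fderiv ℝ (gradient (P.Pbar L2 u)) x v =
      fderiv ℝ (gradient (P.PbarG L2)) x v + fderiv ℝ P.gradB (x, u) (v, 0) := by
  rw [show gradient (P.Pbar L2 u) = _ from funext (gradient_Pbar hR hL2 u)]
  have h2 : HasFDerivAt (gradient (P.PbarG L2)) (fderiv ℝ (gradient (P.PbarG L2)) x) x :=
    ((contDiff_gradient (contDiff_PbarG hR hL2)).differentiable (by norm_num) _).hasFDerivAt
  have h3 : HasFDerivAt P.gradB (fderiv ℝ P.gradB (x, u)) (x, u) := (hC.diff2 x u hu).hasFDerivAt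
  have h := ((h2.sub_const P.g).fun_add (hasFDerivAt_partial_fst h3)).fderiv
  unfold gradB at h
  rw [h]
  rfl

theorem fderiv_gradB_snd_apply (hC : P.ControlAssumption) {u : Vec mu} (hu : u ∈ P.X) (x : Vec n)
    (w : Vec mu) : fderiv ℝ (fun v => gradient (fun x => P.ctrl.b x v) x) u w =
      fderiv ℝ P.gradB (x, u) (0, w) := by
  have h3 : HasFDerivAt P.gradB (fderiv ℝ P.gradB (x, u)) (x, u) := (hC.diff2 x u hu).hasFDerivAt
  have h := (hasFDerivAt_partial_snd h3).fderiv
  exact congrArg (fun T => T w) h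

/-- This grouping makes each term globally bounded: the Hessian of `P̄` by the Lipschitz constant of
its gradient, the mixed derivative by assumption. -/
theorem resDeriv_apply_eq (hM : P.M.PosDef) (hR : P.RelaxationAssumption)
    (hC : P.ControlAssumption) {L2 : ℝ} (hL2 : 0 < L2) (G : Grid N)
    {z : Blocks G.m n × Blocks N mu} (hz : z ∈ P.dom G) (v : Blocks G.m n × Blocks N mu)
    (i : Fin G.m) : P.resDeriv G L2 z v i = P.inertia G 0 0 v.1 i +
      (fderiv ℝ (gradient (P.Pbar L2 (z.2 (G.ctrlIdx i)))) (z.1 i) (v.1 i) +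
        fderiv ℝ (fun v => gradient (fun x => P.ctrl.b x v) (z.1 i)) (z.2 (G.ctrlIdx i))
          (v.2 (G.ctrlIdx i))) := by
  rw [resDeriv_apply hM hR hC hL2 G hz, fderiv_gradient_Pbar_apply hR hC hL2 (hz.2 _),
    fderiv_gradB_snd_apply hC (hz.2 _), add_assoc, ← map_add]
  simp

/-- The Jacobian of the residual is bounded. -/
theorem exists_norm_resDeriv_le (hn : 0 < n) (hM : P.M.PosDef)
    (hO : P.ObjectiveAssumption) (hR : P.RelaxationAssumption) (hC : P.ControlAssumption)
    {L2 : ℝ} (hL2 : 0 < L2) (G : Grid N) :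
    ∃ C : ℝ, 0 ≤ C ∧ ∀ z ∈ P.dom G, ‖P.resDeriv G L2 z‖ ≤ C := by
  obtain ⟨q, hq⟩ := exists_poly_curvatureBounded_Pbar hn hO hR hC
  obtain ⟨hL0, hL⟩ := hq L2 hL2
  set L := q.eval L2
  obtain ⟨B, hB⟩ := hC.mixed
  obtain ⟨u₀, hu₀⟩ := hO.nonempty
  have hB0 : 0 ≤ B := (norm_nonneg _).trans (hB P.θ₀ u₀ hu₀)
  refine ⟨∑ i, (‖P.inertiaCLM G i‖ + (L + B)), Finset.sum_nonneg fun i _ => by positivity,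
    fun z hz => ?_⟩
  refine ContinuousLinearMap.opNorm_le_bound _ (Finset.sum_nonneg fun i _ => by positivity)
    fun v => ?_
  refine (norm_le_sum_norm _).trans ?_
  rw [Finset.sum_mul]
  refine Finset.sum_le_sum fun i _ => ?_
  rw [resDeriv_apply_eq hM hR hC hL2 G hz, ← inertiaCLM_apply, add_mul, add_mul]
  have hv1 : ‖v.1‖ ≤ ‖v‖ := norm_fst_le v
  have hv2 : ‖v.2‖ ≤ ‖v‖ := norm_snd_le v
  refine (norm_add_le _ _).trans (add_le_add ?_ ((norm_add_le _ _).trans (add_le_add ?_ ?_)))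
  · exact (ContinuousLinearMap.le_opNorm _ _).trans (by gcongr)
  · have h : ‖fderiv ℝ (gradient (P.Pbar L2 (z.2 (G.ctrlIdx i)))) (z.1 i)‖ ≤ L :=
      norm_fderiv_le_of_lip' ℝ hL0.le (Filter.Eventually.of_forall fun x => (hL _ (hz.2 _)).2 _ _)
    exact (ContinuousLinearMap.le_opNorm _ _).trans (mul_le_mul h
      ((PiLp.norm_apply_le v.1 i).trans hv1) (norm_nonneg _) hL0.le)
  · exact (ContinuousLinearMap.le_opNorm _ _).trans (mul_le_mul (hB _ _ (hz.2 _))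
      ((PiLp.norm_apply_le v.2 _).trans hv2) (norm_nonneg _) hB0)

theorem norm_res_sub_le (hM : P.M.PosDef)
    (hO : P.ObjectiveAssumption) (hR : P.RelaxationAssumption) (hC : P.ControlAssumption)
    {L2 : ℝ} (hL2 : 0 < L2) (G : Grid N) {C : ℝ} (hb : ∀ z ∈ P.dom G, ‖P.resDeriv G L2 z‖ ≤ C)
    {z w : Blocks G.m n × Blocks N mu} (hz : z ∈ P.dom G) (hw : w ∈ P.dom G) :
    ‖P.res G L2 w.1 w.2 - P.res G L2 z.1 z.2‖ ≤ C * ‖w - z‖ :=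
  (convex_dom hO G).norm_image_sub_le_of_norm_hasFDerivWithin_le
    (f := fun z : Blocks G.m n × Blocks N mu => P.res G L2 z.1 z.2)
    (fun _ hx => (hasFDerivAt_res hM hR hC hL2 G hx).hasFDerivWithinAt) hb hz hw

/-- Block lower triangular form: besides the diagonal, only the two predecessors occur, and with
coefficients that are independent of the state. -/
theorem jacθ_apply (hM : P.M.PosDef) (hR : P.RelaxationAssumption)
    (hC : P.ControlAssumption) {L2 : ℝ} (hL2 : 0 < L2) (G : Grid N) (θ : Blocks G.m n)
    {u : Blocks N mu} (hu : u ∈ P.ctrlSet) (v : Blocks G.m n) (i : Fin G.m) :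
    P.jacθ G L2 θ u v i = P.diagBlock G L2 θ u i (v i) + (1 / G.step P.δ i ^ 2) • P.Mop
      ((G.step P.δ i / before P.δ (G.step P.δ) i) • before 0 (before 0 v) i -
        (1 + G.step P.δ i / before P.δ (G.step P.δ) i) • before 0 v i) := by
  rw [jacθ_eq hM hR hC hL2 G θ hu, resDeriv_apply_eq hM hR hC hL2 G ⟨Set.mem_univ _, hu⟩,
    diagBlock_eq hM hR hC hL2 G θ hu]
  simp only [inertia, add_apply, smul_apply, map_add, map_sub, PiLp.zero_apply, map_zero, smul_add,
    smul_sub]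
  abel

/-- Uniform invertibility of the Jacobian, by forward substitution. -/
theorem exists_norm_le_norm_jacθ (hM : P.M.PosDef)
    (hR : P.RelaxationAssumption) (hC : P.ControlAssumption)
    {S : Params} (hL2 : 0 < S.L2) (hL3 : 0 < S.L3) (G : Grid N) :
    ∃ C : ℝ, 0 ≤ C ∧ ∀ (θ : Blocks G.m n), ∀ u ∈ P.ctrlSet, (∀ i, ¬ P.Singular S G θ u i) →
      ∀ v, ‖v‖ ≤ C * ‖P.jacθ G S.L2 θ u v‖ := by
  -- Forward substitution: `L₃‖v_k‖ ≤ ‖A_kk v_k‖`, and `A_kk v_k` is `(Av)_k` minus mass terms in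
  -- two blocks that are already bounded. The constants depend on the grid, not on `θ` or `u`.
  have key : ∀ k (hk : k < G.m), ∃ C : ℝ, 0 ≤ C ∧ ∀ (θ : Blocks G.m n), ∀ u ∈ P.ctrlSet,
      (∀ i, ¬ P.Singular S G θ u i) → ∀ v, ‖v ⟨k, hk⟩‖ ≤ C * ‖P.jacθ G S.L2 θ u v‖ := by
    intro k
    induction k using Nat.strong_induction_on with
    | _ k ih =>
      intro hk
      have hb1 : ∃ C : ℝ, 0 ≤ C ∧ ∀ (θ : Blocks G.m n), ∀ u ∈ P.ctrlSet,
          (∀ i, ¬ P.Singular S G θ u i) → ∀ v : Blocks G.m n,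
            ‖before 0 v ⟨k, hk⟩‖ ≤ C * ‖P.jacθ G S.L2 θ u v‖ := by
        rcases k with _ | k
        · exact ⟨0, le_rfl, fun θ u hu hs v => by simp [before_zero]⟩
        · exact ih k (by omega) (by omega)
      have hb2 : ∃ C : ℝ, 0 ≤ C ∧ ∀ (θ : Blocks G.m n), ∀ u ∈ P.ctrlSet,
          (∀ i, ¬ P.Singular S G θ u i) → ∀ v : Blocks G.m n,
            ‖before 0 (before 0 v) ⟨k, hk⟩‖ ≤ C * ‖P.jacθ G S.L2 θ u v‖ := by
        rcases k with _ | _ | k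
        · exact ⟨0, le_rfl, fun θ u hu hs v => by simp [before_zero]⟩
        · exact ⟨0, le_rfl, fun θ u hu hs v => by simp [before_zero, before_succ]⟩
        · exact ih k (by omega) (by omega)
      obtain ⟨C1, hC1, h1⟩ := hb1
      obtain ⟨C2, hC2, h2⟩ := hb2
      set i : Fin G.m := ⟨k, hk⟩
      set a := |G.step P.δ i / before P.δ (G.step P.δ) i|
      set a' := |1 + G.step P.δ i / before P.δ (G.step P.δ) i|
      refine ⟨(1 + |1 / G.step P.δ i ^ 2| * (‖P.Mop‖ * (a * C2 + a' * C1))) / S.L3, by positivity,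
        fun θ u hu hs v => ?_⟩
      have h1 := h1 θ u hu hs v
      have h2 := h2 θ u hu hs v
      have hσ := sigmaMin_mul_norm_le (P.diagBlock G S.L2 θ u i) (v i)
      have hL : S.L3 ≤ sigmaMin (P.diagBlock G S.L2 θ u i) := not_lt.1 (hs i)
      have hJ := PiLp.norm_apply_le (P.jacθ G S.L2 θ u v) i
      have hA := jacθ_apply hM hR hC hL2 G θ hu v i
      set R := ‖P.jacθ G S.L2 θ u v‖
      set w := (G.step P.δ i / before P.δ (G.step P.δ) i) • before 0 (before 0 v) i -
        (1 + G.step P.δ i / before P.δ (G.step P.δ) i) • before 0 v i with hw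
      have hwn : ‖w‖ ≤ (a * C2 + a' * C1) * R := by
        rw [hw]
        refine (norm_sub_le _ _).trans ?_
        rw [norm_smul, norm_smul, add_mul, mul_assoc, mul_assoc]
        exact add_le_add (mul_le_mul_of_nonneg_left h2 (abs_nonneg _))
          (mul_le_mul_of_nonneg_left h1 (abs_nonneg _))
      have hA' : P.diagBlock G S.L2 θ u i (v i) =
          P.jacθ G S.L2 θ u v i - (1 / G.step P.δ i ^ 2) • P.Mop w := by
        rw [hA]
        abel
      have hfin : S.L3 * ‖v i‖ ≤ R + |1 / G.step P.δ i ^ 2| * (‖P.Mop‖ * ((a * C2 + a' * C1) * R)) := by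
        calc S.L3 * ‖v i‖ ≤ sigmaMin (P.diagBlock G S.L2 θ u i) * ‖v i‖ := by gcongr
          _ ≤ ‖P.diagBlock G S.L2 θ u i (v i)‖ := hσ
          _ ≤ ‖P.jacθ G S.L2 θ u v i‖ + ‖(1 / G.step P.δ i ^ 2) • P.Mop w‖ := by
            rw [hA']
            exact norm_sub_le _ _
          _ ≤ _ := by
            refine add_le_add hJ ?_
            rw [norm_smul, Real.norm_eq_abs]
            gcongr
            exact (P.Mop.le_opNorm w).trans (by gcongr)
      rw [div_mul_eq_mul_div, le_div_iff₀ hL3]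
      linarith
  choose C hC0 hCb using key
  refine ⟨∑ i : Fin G.m, C i i.2, Finset.sum_nonneg fun i _ => hC0 _ _, fun θ u hu hs v => ?_⟩
  refine (norm_le_sum_norm v).trans ?_
  rw [Finset.sum_mul]
  exact Finset.sum_le_sum fun i _ => hCb i i.2 θ u hu hs v

end Problem

/-! ### First order expansion along convergent sequences -/

/-- On a small ball around the limit, intersected with `D`, `f'` is nearly constant, and the mean
value inequality applies. Both `z k` and `z k + s k • d k` end up there, as the directions are
bounded and the steps vanish. The directions need not converge. -/
theorem eventually_norm_image_sub_sub_le {E W : Type*} [NormedAddCommGroup E] [NormedSpace ℝ E]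
    [NormedAddCommGroup W] [NormedSpace ℝ W] {D : Set E} (hD : Convex ℝ D) {f : E → W}
    {f' : E → E →L[ℝ] W} (hf : ∀ z ∈ D, HasFDerivAt f (f' z) z) (hf' : ContinuousOn f' D)
    {z d : ℕ → E} {z₀ : E} {s : ℕ → ℝ} (hz : ∀ k, z k ∈ D) (hz₀ : z₀ ∈ D)
    (hlim : Tendsto z atTop (𝓝 z₀)) {C : ℝ} (hd : ∀ k, ‖d k‖ ≤ C)
    (hzd : ∀ k, z k + s k • d k ∈ D) (hs0 : ∀ k, 0 < s k) (hs : Tendsto s atTop (𝓝 0))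
    {ε : ℝ} (hε : 0 < ε) :
    ∀ᶠ k in atTop, ‖f (z k + s k • d k) - f (z k) - s k • f' (z k) (d k)‖ ≤ ε * s k := by
  have hC : 0 ≤ C := (norm_nonneg _).trans (hd 0)
  -- Two errors of size `ε' C s` have to fit into `ε s`; the `1` guards against `C = 0`.
  set ε' := ε / (2 * (C + 1)) with hε'
  have hε'0 : 0 < ε' := by positivity
  obtain ⟨r, hr, hball⟩ := Metric.continuousWithinAt_iff.1 (hf' z₀ hz₀) ε' hε'0
  have hlim2 : Tendsto (fun k => z k + s k • d k) atTop (𝓝 z₀) := by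
    have h0 : Tendsto (fun k => s k • d k) atTop (𝓝 0) := by
      refine squeeze_zero_norm (a := fun k => s k * C) (fun k => ?_) (by simpa using hs.mul_const C)
      rw [norm_smul, Real.norm_of_nonneg (hs0 k).le]
      exact mul_le_mul_of_nonneg_left (hd k) (hs0 k).le
    simpa using hlim.add h0
  filter_upwards [hlim (Metric.ball_mem_nhds z₀ hr), hlim2 (Metric.ball_mem_nhds z₀ hr)]
    with k h1 h2
  have hbound : ∀ x ∈ Metric.ball z₀ r ∩ D, ‖f' x - f' z₀‖ ≤ ε' := fun x hx => by
    rw [← dist_eq_norm]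
    exact (hball hx.2 hx.1).le
  have hmv := ((convex_ball z₀ r).inter hD).norm_image_sub_le_of_norm_hasFDerivWithin_le'
    (fun x hx => (hf x hx.2).hasFDerivWithinAt) hbound ⟨h1, hz k⟩ ⟨h2, hzd k⟩
  have hsd : ‖s k • d k‖ ≤ s k * C := by
    rw [norm_smul, Real.norm_of_nonneg (hs0 k).le]
    exact mul_le_mul_of_nonneg_left (hd k) (hs0 k).le
  rw [add_sub_cancel_left] at hmv
  have e : f (z k + s k • d k) - f (z k) - s k • f' (z k) (d k) =
      (f (z k + s k • d k) - f (z k) - f' z₀ (s k • d k)) - (f' (z k) - f' z₀) (s k • d k) := by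
    rw [sub_apply, map_smul, map_smul]
    abel
  rw [e]
  calc _ ≤ ε' * (s k * C) + ε' * (s k * C) := by
        refine (norm_sub_le _ _).trans (add_le_add (hmv.trans (by gcongr)) ?_)
        exact (ContinuousLinearMap.le_opNorm _ _).trans
          (mul_le_mul (hbound _ ⟨h1, hz k⟩) hsd (norm_nonneg _) hε'0.le)
    _ = 2 * ε' * C * s k := by ring
    _ ≤ ε * s k := by
      have := (hs0 k).le
      gcongr
      rw [hε']
      have : 2 * (ε / (2 * (C + 1))) * C = ε * (C / (C + 1)) := by field_simp
      rw [this]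
      refine mul_le_of_le_one_right hε.le ?_
      rw [div_le_one (by positivity)]
      linarith

/-! ### Quadratic programs -/

/-- A symmetric operator with quadratic form between `0` and `L‖·‖²` has norm at most `L`. -/
theorem norm_apply_le_of_hessianOK {E : Type*} [NormedAddCommGroup E] [InnerProductSpace ℝ E] {L : ℝ} (hL : 1 ≤ L)
    {H : E →L[ℝ] E} (h : Problem.HessianOK L H) (x : E) : ‖H x‖ ≤ L * ‖x‖ := by
  have hL0 : 0 < L := by linarith
  -- By polarization `4⟨Hx, y⟩ ≤ L‖x + y‖² ≤ 2L(‖x‖² + ‖y‖²)`, and this `y` turns the inequality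
  -- into the claim.
  set y := L⁻¹ • H x with hy
  have h1 := (h.2 (x + y)).2
  have h2 : 0 ≤ ⟪x - y, H (x - y)⟫_ℝ := le_trans (by positivity) (h.2 (x - y)).1
  have hs : ⟪x, H y⟫_ℝ = ⟪H x, y⟫_ℝ := (h.1 x y).symm
  have hs2 : ⟪y, H x⟫_ℝ = ⟪H x, y⟫_ℝ := real_inner_comm _ _
  have e : ⟪x + y, H (x + y)⟫_ℝ - ⟪x - y, H (x - y)⟫_ℝ = 4 * ⟪H x, y⟫_ℝ := by
    simp only [map_add, map_sub, inner_add_left, inner_add_right, inner_sub_left, inner_sub_right,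
      hs, hs2]
    ring
  have e2 : ⟪H x, y⟫_ℝ = L⁻¹ * ‖H x‖ ^ 2 := by
    rw [hy, real_inner_smul_right, real_inner_self_eq_norm_sq]
  have e3 : ‖x + y‖ ^ 2 ≤ 2 * ‖x‖ ^ 2 + 2 * ‖y‖ ^ 2 := by
    have := parallelogram_law_with_norm ℝ x y
    nlinarith [norm_nonneg (x - y)]
  have e4 : ‖y‖ = L⁻¹ * ‖H x‖ := by
    rw [hy, norm_smul, norm_inv, Real.norm_of_nonneg hL0.le]
  have h3 : 4 * (L⁻¹ * ‖H x‖ ^ 2) ≤ L * (2 * ‖x‖ ^ 2 + 2 * (L⁻¹ * ‖H x‖) ^ 2) := by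
    rw [← e2, ← e, ← e4]
    have := mul_le_mul_of_nonneg_left e3 hL0.le
    linarith
  have h4 : ‖H x‖ ^ 2 ≤ (L * ‖x‖) ^ 2 := by
    have h5 := mul_le_mul_of_nonneg_left h3 hL0.le
    have e5 : L * (4 * (L⁻¹ * ‖H x‖ ^ 2)) = 4 * ‖H x‖ ^ 2 := by field_simp
    have e6 : L * (L * (2 * ‖x‖ ^ 2 + 2 * (L⁻¹ * ‖H x‖) ^ 2)) =
        2 * (L * ‖x‖) ^ 2 + 2 * ‖H x‖ ^ 2 := by field_simp
    rw [e5, e6] at h5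
    linarith
  exact le_of_sq_le_sq h4 (by positivity)

section QP
variable {E F : Type*} [NormedAddCommGroup E] [InnerProductSpace ℝ E] [FiniteDimensional ℝ E]
  [NormedAddCommGroup F] [InnerProductSpace ℝ F] [FiniteDimensional ℝ F]

theorem exists_clm_inverse {A : E →L[ℝ] E} (hA : ∀ v, A v = 0 → v = 0) :
    ∃ T : E →L[ℝ] E, (∀ v, A (T v) = v) ∧ ∀ v, T (A v) = v := by
  have hinj : Function.Injective (A : E →ₗ[ℝ] E) := by
    rw [injective_iff_map_eq_zero]
    exact hA
  let e := LinearEquiv.ofInjectiveEndo (A : E →ₗ[ℝ] E) hinj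
  refine ⟨LinearMap.toContinuousLinearMap (e.symm : E →ₗ[ℝ] E), fun v => ?_, fun v => ?_⟩
  · exact e.apply_symm_apply v
  · exact e.symm_apply_apply v

/-- Divide by `t` and let it tend to `0`; for negative `a` the `t` chosen makes `t|c|` smaller than
`-a`. -/
theorem nonneg_of_forall_smul_add {a c : ℝ} (h : ∀ t : ℝ, 0 < t → t ≤ 1 → 0 ≤ t * a + t ^ 2 * c) :
    0 ≤ a := by
  by_contra! ha
  have hc : 0 < |c| + 1 := by positivity
  set t := min 1 (-a / (2 * (|c| + 1))) with ht
  have ht0 : 0 < t := lt_min one_pos (div_pos (neg_pos.2 ha) (by positivity))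
  have h1 := h t ht0 (min_le_left _ _)
  have h2 : t * (2 * (|c| + 1)) ≤ -a := by
    rw [← le_div_iff₀ (by positivity)]
    exact min_le_right _ _
  have h3 : t * c ≤ t * |c| := mul_le_mul_of_nonneg_left (le_abs_self c) ht0.le
  have h4 : 0 ≤ a + t * c := by
    have : 0 ≤ t * (a + t * c) := by linarith
    exact nonneg_of_mul_nonneg_right this ht0
  nlinarith

/-- Existence of a solution with multipliers for a quadratic program whose equality constraint
determines the first variable. -/
theorem exists_qp_solution {A : E →L[ℝ] E} (hA : ∀ v, A v = 0 → v = 0) (B : F →L[ℝ] E) (r gE : E)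
    (gF : F) {HE : E →L[ℝ] E} {HF : F →L[ℝ] F} (hE : (HE : E →ₗ[ℝ] E).IsSymmetric)
    (hF : (HF : F →ₗ[ℝ] F).IsSymmetric) {K : Set F} (hK : IsCompact K) (hKc : Convex ℝ K)
    (hKn : K.Nonempty) :
    ∃ (x : E) (y : F) (μ : E), (r + A x + B y = 0 ∧ y ∈ K) ∧
      (∀ x' y', r + A x' + B y' = 0 → y' ∈ K →
        ⟪x, gE⟫_ℝ + ⟪y, gF⟫_ℝ + 1 / 2 * ⟪x, HE x⟫_ℝ + 1 / 2 * ⟪y, HF y⟫_ℝ ≤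
          ⟪x', gE⟫_ℝ + ⟪y', gF⟫_ℝ + 1 / 2 * ⟪x', HE x'⟫_ℝ + 1 / 2 * ⟪y', HF y'⟫_ℝ) ∧
      gE + HE x + ContinuousLinearMap.adjoint A μ = 0 ∧
      ∃ ν : F, gF + HF y + ContinuousLinearMap.adjoint B μ + ν = 0 ∧ ∀ y' ∈ K, ⟪ν, y' - y⟫_ℝ ≤ 0 := by
  obtain ⟨T, hAT, hTA⟩ := exists_clm_inverse hA
  set q : E → F → ℝ := fun x y =>
    ⟪x, gE⟫_ℝ + ⟪y, gF⟫_ℝ + 1 / 2 * ⟪x, HE x⟫_ℝ + 1 / 2 * ⟪y, HF y⟫_ℝ with hq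
  -- The equality constraint determines `x = σ y`. A continuous function on the compact `K` remains
  -- to be minimized, so definiteness of the Hessians plays no role here.
  set σ : F → E := fun y => -T (r + B y) with hσ
  have hfeas : ∀ y, r + A (σ y) + B y = 0 := by
    intro y
    simp only [hσ, map_neg, hAT]
    abel
  have huniq : ∀ x y, r + A x + B y = 0 → x = σ y := by
    intro x y h
    have h' : A x = -(r + B y) := by
      rw [eq_neg_iff_add_eq_zero, ← h]
      abel
    rw [← hTA x, h', map_neg]
  obtain ⟨y, hy, hmin⟩ := hK.exists_isMinOn hKn (f := fun y => q (σ y) y) (by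
    simp only [hq, hσ]
    fun_prop)
  set x := σ y with hx
  set w := gE + HE x with hw
  -- Stationarity in `x` reads `A*μ = -w`; as `T` inverts `A`, this forces `μ = -T*w`.
  set μ := -ContinuousLinearMap.adjoint T w with hμ
  have hAμ : ContinuousLinearMap.adjoint A μ = -w := by
    refine ext_inner_right ℝ fun v => ?_
    rw [ContinuousLinearMap.adjoint_inner_left, hμ, inner_neg_left,
      ContinuousLinearMap.adjoint_inner_left, hTA, inner_neg_left]
  refine ⟨x, y, μ, ⟨hfeas y, hy⟩, ?_, ?_, -(gF + HF y + ContinuousLinearMap.adjoint B μ), ?_, ?_⟩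
  · intro x' y' h' hy'
    rw [huniq x' y' h']
    exact hmin hy'
  · rw [hAμ, add_neg_cancel]
  · abel
  · intro y' hy'
    set e := y' - y with he
    set v := -T (B e) with hv
    -- Along a segment in `K` the reduced objective is quadratic in `t`. Its linear coefficient is
    -- nonnegative at the minimizer, and written with `μ` this is the normal cone condition for `ν`.
    have hval : ∀ t : ℝ, q (σ (y + t • e)) (y + t • e) = q x y +
        t * (⟪w, v⟫_ℝ + ⟪gF + HF y, e⟫_ℝ) + t ^ 2 * (1 / 2 * ⟪v, HE v⟫_ℝ + 1 / 2 * ⟪e, HF e⟫_ℝ) := by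
      intro t
      have hs : σ (y + t • e) = x + t • v := by
        simp only [hx, hσ, hv, map_add, map_smul]
        module
      have s1 : ⟪v, HE x⟫_ℝ = ⟪HE x, v⟫_ℝ := real_inner_comm _ _
      have s2 : ⟪x, HE v⟫_ℝ = ⟪HE x, v⟫_ℝ := (hE x v).symm
      have s3 : ⟪e, HF y⟫_ℝ = ⟪HF y, e⟫_ℝ := real_inner_comm _ _
      have s4 : ⟪y, HF e⟫_ℝ = ⟪HF y, e⟫_ℝ := (hF y e).symm
      rw [hs]
      simp only [hq, hw, map_add, map_smul, inner_add_left, inner_add_right, real_inner_smul_left,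
        real_inner_smul_right, s1, s2, s3, s4]
      rw [real_inner_comm v gE, real_inner_comm e gF]
      ring
    have hpos : 0 ≤ ⟪w, v⟫_ℝ + ⟪gF + HF y, e⟫_ℝ := by
      refine nonneg_of_forall_smul_add (c := 1 / 2 * ⟪v, HE v⟫_ℝ + 1 / 2 * ⟪e, HF e⟫_ℝ)
        fun t ht0 ht1 => ?_
      have hmem : y + t • e ∈ K := hKc.add_smul_sub_mem hy hy' ⟨ht0.le, ht1⟩
      have h1 : q x y ≤ q (σ (y + t • e)) (y + t • e) := hmin hmem
      rw [hval] at h1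
      linarith
    have hwv : ⟪w, v⟫_ℝ = ⟪ContinuousLinearMap.adjoint B μ, e⟫_ℝ := by
      rw [← neg_neg w, ← hAμ, inner_neg_left, ContinuousLinearMap.adjoint_inner_left, hv, map_neg,
        hAT, inner_neg_right, neg_neg, ContinuousLinearMap.adjoint_inner_left]
    rw [inner_neg_left, inner_add_left _ _ e]
    linarith

end QP


namespace Problem
variable {n mu N me mi nR : ℕ} {P : Problem n mu N me mi nR}

/-! ### The quadratic program of the inner solver -/

theorem jacθ_injective (hM : P.M.PosDef) (hR : P.RelaxationAssumption) (hC : P.ControlAssumption)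
    {S : Params} (hL2 : 0 < S.L2) (hL3 : 0 < S.L3) (G : Grid N) (θ : Blocks G.m n)
    {u : Blocks N mu} (hu : u ∈ P.ctrlSet) (hs : ∀ i, ¬ P.Singular S G θ u i) (v : Blocks G.m n)
    (hv : P.jacθ G S.L2 θ u v = 0) : v = 0 := by
  obtain ⟨C, -, h⟩ := exists_norm_le_norm_jacθ hM hR hC hL2 hL3 G
  have := h θ u hu hs v
  rw [hv, norm_zero, mul_zero] at this
  exact norm_le_zero_iff.1 this

theorem exists_qpSolution (hM : P.M.PosDef) (hO : P.ObjectiveAssumption)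
    (hR : P.RelaxationAssumption) (hC : P.ControlAssumption) {S : Params} (hL2 : 0 < S.L2)
    (hL3 : 0 < S.L3) (G : Grid N) (θ : Blocks G.m n) {u : Blocks N mu} (hu : u ∈ P.ctrlSet)
    (hs : ∀ i, ¬ P.Singular S G θ u i) {Hθ : Blocks G.m n →L[ℝ] Blocks G.m n}
    {Hu : Blocks N mu →L[ℝ] Blocks N mu} (hHθ : HessianOK S.L5 Hθ) (hHu : HessianOK S.L5 Hu) :
    ∃ dθ du μ, P.QPSolution S G θ u Hθ Hu dθ du μ := by
  have hK : IsCompact ((fun d => u + d) ⁻¹' P.ctrlSet) :=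
    (Homeomorph.addLeft u).isCompact_preimage.2 (isCompact_ctrlSet hO)
  have hKc : Convex ℝ ((fun d => u + d) ⁻¹' P.ctrlSet) :=
    (convex_ctrlSet hO).translate_preimage_right u
  obtain ⟨x, y, μ, hfeas, hmin, hstat, ν, hν, hcone⟩ :=
    exists_qp_solution (jacθ_injective hM hR hC hL2 hL3 G θ hu hs) (P.jacu G S.L2 θ u)
      (P.res G S.L2 θ u) (gradient (fun θ => P.O G θ u) θ) (gradient (fun u => P.O G θ u) u)
      hHθ.1 hHu.1 hK hKc ⟨0, by simpa using hu⟩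
  refine ⟨x, y, μ, hfeas, fun eθ eu he => hmin eθ eu he.1 he.2, hstat, ν, hν, fun k c hc => ?_⟩
  -- Changing only block `k` turns the normal cone condition of the product set into one for each
  -- control.
  set y' : Blocks N mu := WithLp.toLp 2 (Function.update y.ofLp k (c - u k)) with hy'
  have hmem : u + y' ∈ P.ctrlSet := by
    intro l
    rcases eq_or_ne l k with rfl | hl
    · simpa [hy'] using hc
    · simpa [hy', hl] using hfeas.2 l
  have h := hcone y' hmem
  rw [PiLp.inner_apply, Finset.sum_eq_single k] at h
  · have e : (y' - y) k = c - (u k + y k) := by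
      simp [hy']
      abel
    rwa [e] at h
  · intro l _ hl
    simp [hy', hl]
  · intro hk
    exact absurd (Finset.mem_univ k) hk

theorem exists_ctrlSet_bound (hO : P.ObjectiveAssumption) :
    ∃ R : ℝ, 0 ≤ R ∧ ∀ u ∈ P.ctrlSet, ‖u‖ ≤ R := by
  obtain ⟨R, hR⟩ := (isCompact_ctrlSet hO).isBounded.exists_norm_le
  exact ⟨max R 0, le_max_right _ _, fun u hu => (hR u hu).trans (le_max_left _ _)⟩

/-- Search directions and multipliers are bounded in terms of the violation. -/
theorem exists_qpSolution_bound (hn : 0 < n) (hM : P.M.PosDef) (hO : P.ObjectiveAssumption)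
    (hR : P.RelaxationAssumption) (hC : P.ControlAssumption) {S : Params} (hL2 : 0 < S.L2)
    (hL3 : 0 < S.L3) (hL5 : 1 ≤ S.L5) (G : Grid N) (V : ℝ) :
    ∃ C : ℝ, ∀ (θ : Blocks G.m n), ∀ u ∈ P.ctrlSet, (∀ i, ¬ P.Singular S G θ u i) →
      P.viol G S.L2 θ u ≤ V → ∀ Hθ Hu dθ du μ, HessianOK S.L5 Hθ →
        P.QPSolution S G θ u Hθ Hu dθ du μ →
          ‖dθ‖ ≤ C ∧ ‖du‖ ≤ C ∧ (⨆ i, ‖μ i‖) ≤ C := by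
  obtain ⟨CA, hCA, hA⟩ := exists_norm_le_norm_jacθ hM hR hC hL2 hL3 G
  obtain ⟨CB, hCB, hB⟩ := exists_norm_resDeriv_le hn hM hO hR hC hL2 G
  obtain ⟨R, hR0, hRb⟩ := exists_ctrlSet_bound hO
  obtain ⟨L1, hL1⟩ := hO.bounded G
  set D := CA * (V + CB * (2 * R)) with hD
  set Cμ := CA * (L1 + S.L5 * D) with hCμ
  refine ⟨max D (max (2 * R) Cμ), fun θ u hu hs hV Hθ Hu dθ du μ hHθ hqp => ?_⟩
  -- Both `u` and `u + du` lie in the compact control set, so `du` is bounded without using the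
  -- objective.
  have hdu : ‖du‖ ≤ 2 * R := by
    have h1 := hRb u hu
    have h2 := hRb (u + du) hqp.1.2
    have h3 : ‖du‖ ≤ ‖u + du‖ + ‖u‖ := by simpa using norm_sub_le (u + du) u
    linarith
  have hdθ : ‖dθ‖ ≤ D := by
    refine (hA θ u hu hs dθ).trans ?_
    have e : P.jacθ G S.L2 θ u dθ = -(P.res G S.L2 θ u + P.jacu G S.L2 θ u du) := by
      rw [eq_neg_iff_add_eq_zero, ← hqp.1.1]
      abel
    rw [e, norm_neg, hD]
    gcongr
    refine (norm_add_le _ _).trans (add_le_add ((norm_le_oneNorm _).trans hV) ?_)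
    rw [jacu_eq hM hR hC hL2 G θ hu]
    refine (ContinuousLinearMap.le_opNorm _ _).trans
      (mul_le_mul (hB _ ⟨Set.mem_univ _, hu⟩) ?_ (norm_nonneg _) hCB)
    rwa [Prod.norm_mk, norm_zero, max_eq_right (norm_nonneg _)]
  have hμ : ‖μ‖ ≤ Cμ := by
    obtain ⟨T, hAT, -⟩ := exists_clm_inverse (jacθ_injective hM hR hC hL2 hL3 G θ hu hs)
    have hx := hA θ u hu hs (T μ)
    rw [hAT] at hx
    set w := gradient (fun θ => P.O G θ u) θ + Hθ dθ with hw
    have hwn : ‖w‖ ≤ L1 + S.L5 * D := by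
      refine (norm_add_le _ _).trans (add_le_add ?_ ?_)
      · have h := hL1 θ u hu
        linarith [norm_nonneg (gradient (fun u => P.O G θ u) u)]
      · exact (norm_apply_le_of_hessianOK hL5 hHθ dθ).trans (by gcongr)
    have hst : ContinuousLinearMap.adjoint (P.jacθ G S.L2 θ u) μ = -w := by
      rw [eq_neg_iff_add_eq_zero, add_comm]
      exact hqp.2.2.1
    -- The bound on `A⁻¹` passes to the adjoint by duality: `‖μ‖² = ⟨A*μ, A⁻¹μ⟩`.
    have h1 : ‖μ‖ ^ 2 = ⟪-w, T μ⟫_ℝ := by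
      rw [← hst, ContinuousLinearMap.adjoint_inner_left, hAT, real_inner_self_eq_norm_sq]
    have h2 : ‖μ‖ * ‖μ‖ ≤ Cμ * ‖μ‖ := by
      calc ‖μ‖ * ‖μ‖ = ⟪-w, T μ⟫_ℝ := by rw [← h1, sq]
        _ ≤ ‖-w‖ * ‖T μ‖ := real_inner_le_norm _ _
        _ ≤ (L1 + S.L5 * D) * (CA * ‖μ‖) := by
          rw [norm_neg]
          exact mul_le_mul hwn hx (norm_nonneg _) ((norm_nonneg _).trans hwn)
        _ = _ := by
          rw [hCμ]
          ring
    rcases (norm_nonneg μ).eq_or_lt with h0 | h0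
    · rw [← h0, hCμ]
      exact mul_nonneg hCA ((norm_nonneg _).trans hwn)
    · exact le_of_mul_le_mul_right h2 h0
  refine ⟨hdθ.trans (le_max_left _ _), hdu.trans ((le_max_left _ _).trans (le_max_right _ _)), ?_⟩
  exact (Real.iSup_le (fun i => PiLp.norm_apply_le μ i) (norm_nonneg _)).trans
    (hμ.trans ((le_max_right _ _).trans (le_max_right _ _)))

/-! ### Line searches -/

variable (P) in
/-- Derivative of the cost. -/
noncomputable def objDeriv (G : Grid N) (z : Blocks G.m n × Blocks N mu) :
    (Blocks G.m n × Blocks N mu) →L[ℝ] ℝ :=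
  fderiv ℝ (fun z : Blocks G.m n × Blocks N mu => P.O G z.1 z.2) z

theorem hasFDerivAt_obj (hO : P.ObjectiveAssumption) (G : Grid N)
    (z : Blocks G.m n × Blocks N mu) :
    HasFDerivAt (fun z : Blocks G.m n × Blocks N mu => P.O G z.1 z.2) (P.objDeriv G z) z :=
  ((hO.contDiff G).differentiable (by norm_num) z).hasFDerivAt

theorem continuous_objDeriv (hO : P.ObjectiveAssumption) (G : Grid N) :
    Continuous (P.objDeriv G) := (hO.contDiff G).continuous_fderiv (by norm_num)

theorem objDeriv_apply (hO : P.ObjectiveAssumption) (G : Grid N) (θ dθ : Blocks G.m n)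
    (u du : Blocks N mu) : P.objDeriv G (θ, u) (dθ, du) =
      ⟪gradient (fun θ => P.O G θ u) θ, dθ⟫_ℝ + ⟪gradient (fun u => P.O G θ u) u, du⟫_ℝ := by
  have h := hasFDerivAt_obj hO G (θ, u)
  have h1 := fderiv_partial_fst_apply h dθ
  have h2 := fderiv_partial_snd_apply h du
  rw [inner_gradient_left, inner_gradient_left, h1, h2, ← map_add]
  simp

/-- The search direction is a descent direction of the merit function. -/
theorem objDeriv_le (hO : P.ObjectiveAssumption) {S : Params} (G : Grid N) {θ : Blocks G.m n}
    {u : Blocks N mu} (hu : u ∈ P.ctrlSet) {Hθ : Blocks G.m n →L[ℝ] Blocks G.m n}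
    {Hu : Blocks N mu →L[ℝ] Blocks N mu} (hHθ : HessianOK S.L5 Hθ) (hHu : HessianOK S.L5 Hu)
    {dθ : Blocks G.m n} {du : Blocks N mu} {μ : Blocks G.m n}
    (hqp : P.QPSolution S G θ u Hθ Hu dθ du μ) :
    P.objDeriv G (θ, u) (dθ, du) ≤
      -(1 / S.L5) * normD G dθ du ^ 2 + (⨆ i, ‖μ i‖) * P.viol G S.L2 θ u := by
  obtain ⟨⟨hfeas, hX⟩, -, hst, ν, hstu, hcone⟩ := hqp
  rw [objDeriv_apply hO]
  have e1 : gradient (fun θ => P.O G θ u) θ =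
      -(Hθ dθ + ContinuousLinearMap.adjoint (P.jacθ G S.L2 θ u) μ) := by
    rw [eq_neg_iff_add_eq_zero, ← hst]
    abel
  have e2 : gradient (fun u => P.O G θ u) u =
      -(Hu du + ContinuousLinearMap.adjoint (P.jacu G S.L2 θ u) μ + ν) := by
    rw [eq_neg_iff_add_eq_zero, ← hstu]
    abel
  have e3 : ⟪μ, P.jacθ G S.L2 θ u dθ⟫_ℝ + ⟪μ, P.jacu G S.L2 θ u du⟫_ℝ = -⟪μ, P.res G S.L2 θ u⟫_ℝ := by
    rw [← inner_add_right, ← inner_neg_right]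
    congr 1
    rw [eq_neg_iff_add_eq_zero, ← hfeas]
    abel
  -- The current control is itself feasible and serves as test point in the normal cone condition.
  have hν : -⟪ν, du⟫_ℝ ≤ 0 := by
    rw [PiLp.inner_apply, ← Finset.sum_neg_distrib]
    refine Finset.sum_nonpos fun k _ => ?_
    have h := hcone k (u k) (hu k)
    rwa [sub_add_cancel_left, inner_neg_right] at h
  have h1 := (hHθ.2 dθ).1
  have h2 := (hHu.2 du).1
  have h3 : normD G dθ du ^ 2 = ‖dθ‖ ^ 2 + ‖du‖ ^ 2 := Real.sq_sqrt (by positivity)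
  have h4 := inner_le_iSup_norm_mul_oneNorm μ (P.res G S.L2 θ u)
  rw [e1, e2, inner_neg_left, inner_neg_left, inner_add_left, inner_add_left, inner_add_left,
    ContinuousLinearMap.adjoint_inner_left, ContinuousLinearMap.adjoint_inner_left, h3,
    real_inner_comm, real_inner_comm du (Hu du), viol_eq_oneNorm]
  linarith

theorem res_expansion {G : Grid N} {L2 s ε : ℝ} {θ dθ : Blocks G.m n} {u du : Blocks N mu}
    (hfeas : P.resDeriv G L2 (θ, u) (dθ, du) = -P.res G L2 θ u)
    (h : ‖P.res G L2 (θ + s • dθ) (u + s • du) - P.res G L2 θ u -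
      s • P.resDeriv G L2 (θ, u) (dθ, du)‖ ≤ ε * s) :
    ∃ e : Blocks G.m n, P.res G L2 (θ + s • dθ) (u + s • du) = (1 - s) • P.res G L2 θ u + e ∧
      ‖e‖ ≤ ε * s := by
  refine ⟨_, ?_, h⟩
  rw [hfeas]
  module

/-- To first order the direction carries `r` to `(1 - s)r`; the factor `m·n` passes from the
Euclidean norm of the remainder to the `ℓ¹` norm. -/
theorem viol_expansion {G : Grid N} {L2 s ε : ℝ} {θ dθ : Blocks G.m n} {u du : Blocks N mu}
    (hs : s ≤ 1) (hfeas : P.resDeriv G L2 (θ, u) (dθ, du) = -P.res G L2 θ u)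
    (h : ‖P.res G L2 (θ + s • dθ) (u + s • du) - P.res G L2 θ u -
      s • P.resDeriv G L2 (θ, u) (dθ, du)‖ ≤ ε * s) :
    P.viol G L2 (θ + s • dθ) (u + s • du) ≤ (1 - s) * P.viol G L2 θ u + G.m * n * (ε * s) := by
  obtain ⟨e, he, hen⟩ := res_expansion hfeas h
  rw [viol_eq_oneNorm, viol_eq_oneNorm, he]
  refine (oneNorm_add_le _ _).trans (add_le_add ?_ ?_)
  · rw [oneNorm_smul, abs_of_nonneg (by linarith)]
  · exact (oneNorm_le e).trans (by gcongr)

theorem viol_nonneg (G : Grid N) (L2 : ℝ) (θ : Blocks G.m n) (u : Blocks N mu) :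
    0 ≤ P.viol G L2 θ u := oneNorm_nonneg _

/-- If the termination test fails, the predicted decrease is bounded from below. -/
theorem exists_decrease_of_not_converged {S : Params} (hS : P.Admissible S) :
    ∃ c : ℝ, 0 < c ∧ ∀ (G : Grid N) (θ : Blocks G.m n) (u : Blocks N mu) (dθ : Blocks G.m n)
      (du : Blocks N mu), ¬ P.Converged S G θ u dθ du →
        c ≤ 1 / S.L5 * normD G dθ du ^ 2 + S.L10 * P.viol G S.L2 θ u := by
  have hL5 : 0 < S.L5 := by linarith [hS.one_le_L5]
  have hε := εSQP_pos (nR := nR) hS.ε_pos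
  have hL10 := hS.L10_pos
  refine ⟨min (1 / S.L5 * (εSQP (nR := nR) S / S.L5) ^ 2) (S.L10 * εSQP (nR := nR) S),
    lt_min (by positivity) (by positivity), fun G θ u dθ du h => ?_⟩
  have hv := viol_nonneg (P := P) G S.L2 θ u
  rcases not_and_or.1 h with h | h
  · refine (min_le_left _ _).trans ?_
    have : 1 / S.L5 * (εSQP (nR := nR) S / S.L5) ^ 2 ≤ 1 / S.L5 * normD G dθ du ^ 2 := by
      gcongr
      exact not_lt.1 h
    have : 0 ≤ S.L10 * P.viol G S.L2 θ u := by positivity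
    linarith
  · refine (min_le_right _ _).trans ?_
    have : S.L10 * εSQP (nR := nR) S ≤ S.L10 * P.viol G S.L2 θ u := by
      gcongr
      exact not_lt.1 h
    have : 0 ≤ 1 / S.L5 * normD G dθ du ^ 2 := by positivity
    linarith

/-- Small steps are accepted in the inner solver, uniformly along convergent sequences. -/
theorem eventually_lineSearch (hM : P.M.PosDef) (hO : P.ObjectiveAssumption)
    (hR : P.RelaxationAssumption) (hC : P.ControlAssumption) {S : Params} (hS : P.Admissible S)
    (G : Grid N) {θ dθ μ : ℕ → Blocks G.m n} {u du : ℕ → Blocks N mu} {ρ s : ℕ → ℝ}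
    {z₀ : Blocks G.m n × Blocks N mu} {Hθ : ℕ → Blocks G.m n →L[ℝ] Blocks G.m n}
    {Hu : ℕ → Blocks N mu →L[ℝ] Blocks N mu} (hu : ∀ k, u k ∈ P.ctrlSet)
    (hlim : Tendsto (fun k => (θ k, u k)) atTop (𝓝 z₀))
    (hHθ : ∀ k, HessianOK S.L5 (Hθ k)) (hHu : ∀ k, HessianOK S.L5 (Hu k))
    (hqp : ∀ k, P.QPSolution S G (θ k) (u k) (Hθ k) (Hu k) (dθ k) (du k) (μ k))
    (hnc : ∀ k, ¬ P.Converged S G (θ k) (u k) (dθ k) (du k)) {C : ℝ}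
    (hdθ : ∀ k, ‖dθ k‖ ≤ C) (hdu : ∀ k, ‖du k‖ ≤ C)
    (hρ : ∀ k, (⨆ i, ‖μ k i‖) + S.L10 ≤ ρ k) {Rρ : ℝ} (hρR : ∀ k, ρ k ≤ Rρ)
    (hs0 : ∀ k, 0 < s k) (hs1 : ∀ k, s k ≤ 1) (hs : Tendsto s atTop (𝓝 0)) :
    ∀ᶠ k in atTop, P.LineSearch S G (ρ k) (θ k) (u k) (dθ k) (du k) (s k) := by
  have hL2 := hS.L2_pos
  obtain ⟨c, hc, hdec⟩ := exists_decrease_of_not_converged hS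
  have hz : ∀ k, (θ k, u k) ∈ P.dom G := fun k => ⟨Set.mem_univ _, hu k⟩
  have hz₀ : z₀ ∈ P.dom G :=
    (isClosed_dom hO G).mem_of_tendsto hlim (Eventually.of_forall hz)
  have hd : ∀ k, ‖(dθ k, du k)‖ ≤ C := fun k => max_le (hdθ k) (hdu k)
  have hzd : ∀ k, (θ k, u k) + s k • (dθ k, du k) ∈ P.dom G := by
    intro k
    refine ⟨Set.mem_univ _, ?_⟩
    have h := (convex_ctrlSet hO).add_smul_mem (hu k) (hqp k).1.2 ⟨(hs0 k).le, hs1 k⟩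
    exact h
  have hRρ : 0 ≤ Rρ := by
    have h1 := hρ 0
    have h2 := hρR 0
    have h3 : 0 ≤ ⨆ i, ‖μ 0 i‖ := Real.iSup_nonneg fun _ => norm_nonneg _
    linarith [hS.L10_pos]
  have hα : 0 < 1 - S.α := sub_pos.2 hS.α_lt
  set κ : ℝ := G.m * n with hκ
  have hκ0 : 0 ≤ κ := by positivity
  -- The tolerance keeps the remainder `ε(1 + ρκ)` below half of `(1 - α)` times the minimal
  -- predicted decrease `c`. The second bound, `L₄/(κ+1)`, serves the condition that the violation
  -- must not grow.
  set ε₁ := (1 - S.α) * c / (2 * (1 + Rρ * κ)) with hε₁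
  have hε₁0 : 0 < ε₁ := by positivity
  set ε := min ε₁ (S.L4 / (κ + 1)) with hε
  have hL4 := hS.L4_pos
  have hε0 : 0 < ε := lt_min hε₁0 (by positivity)
  filter_upwards [eventually_norm_image_sub_sub_le (convex_dom hO G)
    (fun z hz => hasFDerivAt_res hM hR hC hL2 G hz) (continuousOn_resDeriv hM hR hC hL2 G)
    hz hz₀ hlim hd hzd hs0 hs hε0, eventually_norm_image_sub_sub_le (convex_dom hO G)
    (fun z _ => hasFDerivAt_obj hO G z) (continuous_objDeriv hO G).continuousOn
    hz hz₀ hlim hd hzd hs0 hs hε0] with k hk1 hk2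
  have hfeas : P.resDeriv G S.L2 (θ k, u k) (dθ k, du k) = -P.res G S.L2 (θ k) (u k) := by
    rw [← jac_add hM hR hC hL2 G (θ k) (hu k), eq_neg_iff_add_eq_zero, ← (hqp k).1.1]
    abel
  have hviol := viol_expansion (hs1 k) hfeas hk1
  have hobj : P.O G (θ k + s k • dθ k) (u k + s k • du k) - P.O G (θ k) (u k) -
      s k * P.objDeriv G (θ k, u k) (dθ k, du k) ≤ ε * s k := (le_abs_self _).trans hk2
  have hdesc := objDeriv_le hO G (hu k) (hHθ k) (hHu k) (hqp k)
  have hΔ := hdec G (θ k) (u k) (dθ k) (du k) (hnc k)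
  have hv0 := viol_nonneg (P := P) G S.L2 (θ k) (u k)
  have hsk := hs0 k
  have hρk := hρ k
  have hρ0 : 0 ≤ ρ k := by
    have h3 : 0 ≤ ⨆ i, ‖μ k i‖ := Real.iSup_nonneg fun _ => norm_nonneg _
    linarith [hS.L10_pos]
  set v := P.viol G S.L2 (θ k) (u k)
  set v' := P.viol G S.L2 (θ k + s k • dθ k) (u k + s k • du k)
  set t := s k
  set μm := ⨆ i, ‖μ k i‖
  set Q := 1 / S.L5 * normD G (dθ k) (du k) ^ 2 with hQ
  constructor
  · have h1 : t * P.objDeriv G (θ k, u k) (dθ k, du k) ≤ t * (-Q + μm * v) :=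
      mul_le_mul_of_nonneg_left (hdesc.trans (le_of_eq (by rw [hQ]; ring))) hsk.le
    have h2 : ρ k * v' ≤ ρ k * ((1 - t) * v + κ * (ε * t)) := mul_le_mul_of_nonneg_left hviol hρ0
    -- As `ρ` exceeds the multiplier norm by `L₁₀`, the gain `-ρtv` outweighs `μm·tv` and leaves
    -- `-L₁₀tv`.
    have h3 : t * v * (μm + S.L10) ≤ t * v * ρ k := mul_le_mul_of_nonneg_left hρk (by positivity)
    have h4 : ε * (1 + ρ k * κ) ≤ (1 - S.α) * c / 2 := by
      calc ε * (1 + ρ k * κ) ≤ ε₁ * (1 + Rρ * κ) := by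
            gcongr
            · exact min_le_left _ _
            · exact hρR k
        _ = _ := by
          rw [hε₁]
          field_simp
    have h5 : t * (ε * (1 + ρ k * κ)) < t * ((1 - S.α) * (Q + S.L10 * v)) := by
      refine mul_lt_mul_of_pos_left (h4.trans_lt ?_) hsk
      have : (1 - S.α) * c ≤ (1 - S.α) * (Q + S.L10 * v) := mul_le_mul_of_nonneg_left hΔ hα.le
      have : 0 < (1 - S.α) * c := by positivity
      linarith
    have e : -(1 / S.L5) * normD G (dθ k) (du k) ^ 2 - S.L10 * v = -(Q + S.L10 * v) := by
      rw [hQ]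
      ring
    unfold merit
    rw [e]
    change P.O G (θ k + t • dθ k) (u k + t • du k) + ρ k * v' <
      P.O G (θ k) (u k) + ρ k * v + S.α * t * -(Q + S.L10 * v)
    linarith
  · intro hlt
    have h6 : κ * ε ≤ S.L4 := by
      calc κ * ε ≤ κ * (S.L4 / (κ + 1)) := by
            gcongr
            exact min_le_right _ _
        _ = S.L4 * (κ / (κ + 1)) := by ring
        _ ≤ S.L4 := by
          refine mul_le_of_le_one_right hL4.le ?_
          rw [div_le_one (by positivity)]
          linarith
    have h7 : t * (κ * ε) ≤ t * v := mul_le_mul_of_nonneg_left (h6.trans hlt.le) hsk.le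
    refine hviol.trans ?_
    linarith

theorem Lam_eq (G : Grid N) (L2 : ℝ) (θ : Blocks G.m n) (u : Blocks N mu) :
    P.Lam G L2 θ u = ‖P.res G L2 θ u‖ ^ 2 / 2 := by
  rw [Lam, PiLp.norm_sq_eq_of_L2, Finset.sum_div]

/-- Small steps are accepted in the constraint solver, uniformly along convergent sequences. -/
theorem eventually_wolfe (hM : P.M.PosDef) (hO : P.ObjectiveAssumption)
    (hR : P.RelaxationAssumption) (hC : P.ControlAssumption) {S : Params} (hS : P.Admissible S)
    (G : Grid N) {θ d : ℕ → Blocks G.m n} {u : Blocks N mu} {s : ℕ → ℝ} {θ₀ : Blocks G.m n}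
    (hu : u ∈ P.ctrlSet) (hlim : Tendsto θ atTop (𝓝 θ₀))
    (hd : ∀ k, P.jacθ G S.L2 (θ k) u (d k) = -P.res G S.L2 (θ k) u)
    (hv : ∀ k, S.L4 ≤ P.viol G S.L2 (θ k) u) {C : ℝ} (hdC : ∀ k, ‖d k‖ ≤ C)
    (hs0 : ∀ k, 0 < s k) (hs1 : ∀ k, s k ≤ 1) (hs : Tendsto s atTop (𝓝 0)) :
    ∀ᶠ k in atTop, P.Wolfe S G (θ k) (d k) u (s k) := by
  have hL2 := hS.L2_pos
  have hL4 := hS.L4_pos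
  have hα := hS.α_pos
  have hα1 : 0 < 1 - S.α := sub_pos.2 hS.α_lt
  have hz : ∀ θ, (θ, u) ∈ P.dom G := fun θ => ⟨Set.mem_univ _, hu⟩
  set κ : ℝ := G.m * n with hκ
  have hκ0 : 0 ≤ κ := by positivity
  -- While `‖r‖₁ ≥ L₄`, the Euclidean residual is at least `R₀`, so an absolute remainder becomes a
  -- relative one.
  set R₀ := S.L4 / (κ + 1) with hR₀
  have hR₀0 : 0 < R₀ := by positivity
  have hd0 : ∀ k, ‖(d k, (0 : Blocks N mu))‖ ≤ C := fun k => by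
    rw [Prod.norm_mk, norm_zero, max_eq_left (norm_nonneg _)]
    exact hdC k
  have hε0 : 0 < (1 - S.α) / 2 * R₀ := by positivity
  have hsmall : ∀ᶠ k in atTop, s k < 1 - S.α := hs (Iio_mem_nhds hα1)
  filter_upwards [eventually_norm_image_sub_sub_le (convex_dom hO G)
    (fun z hz => hasFDerivAt_res hM hR hC hL2 G hz) (continuousOn_resDeriv hM hR hC hL2 G)
    (z := fun k => (θ k, u)) (fun k => hz (θ k)) (hz θ₀) (hlim.prodMk_nhds tendsto_const_nhds)
    hd0 (fun k => by simpa using hz _) hs0 hs hε0, hsmall] with k hk hsk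
  have hfeas : P.resDeriv G S.L2 (θ k, u) (d k, 0) = -P.res G S.L2 (θ k) u := by
    rw [← jacθ_eq hM hR hC hL2 G (θ k) hu, hd k]
  obtain ⟨e, he, hen⟩ := res_expansion hfeas hk
  rw [smul_zero, add_zero] at he
  have hrk : R₀ ≤ ‖P.res G S.L2 (θ k) u‖ := by
    have h1 := (hv k).trans (oneNorm_le (P.res G S.L2 (θ k) u))
    rw [hR₀, div_le_iff₀ (by positivity)]
    nlinarith [norm_nonneg (P.res G S.L2 (θ k) u)]
  have ht := hs0 k
  have ht1 := hs1 k
  unfold Wolfe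
  rw [Lam_eq, Lam_eq, he]
  set r := ‖P.res G S.L2 (θ k) u‖
  set t := s k
  -- `β` lies midway between `α` and `1`. Then `(1 - βt)² < 1 - 2αt` as soon as `β²t < 2(β - α) = 1
  -- - α`.
  set β := (1 + S.α) / 2 with hβ
  have hr0 : 0 < r := hR₀0.trans_le hrk
  have h1 : ‖(1 - t) • P.res G S.L2 (θ k) u + e‖ ≤ (1 - β * t) * r := by
    refine (norm_add_le _ _).trans ?_
    rw [norm_smul, Real.norm_of_nonneg (by linarith)]
    have : (1 - S.α) / 2 * R₀ * t ≤ (1 - S.α) / 2 * r * t := by gcongr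
    have e1 : (1 - t) * r + (1 - S.α) / 2 * r * t = (1 - β * t) * r := by
      rw [hβ]
      ring
    linarith
  have h2 : ‖(1 - t) • P.res G S.L2 (θ k) u + e‖ ^ 2 ≤ ((1 - β * t) * r) ^ 2 := by gcongr
  have h3 : (1 - β * t) ^ 2 < 1 - 2 * S.α * t := by
    have hβ1 : β ^ 2 ≤ 1 := by nlinarith
    have : β ^ 2 * t ≤ t := mul_le_of_le_one_left ht.le hβ1
    have : t * (β ^ 2 * t) < t * (1 - S.α) := mul_lt_mul_of_pos_left (by linarith) ht
    rw [hβ] at *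
    nlinarith
  have h4 : (1 - β * t) ^ 2 * r ^ 2 < (1 - 2 * S.α * t) * r ^ 2 :=
    mul_lt_mul_of_pos_right h3 (by positivity)
  rw [mul_pow] at h2
  linarith

end Problem

/-! ### Subdivision of grids -/

namespace Grid
variable {N : ℕ}

/-- Distance of the `i`-th time index from its predecessor. -/
noncomputable def gap (G : Grid N) (i : Fin G.m) : ℝ := G.t i - before 0 G.t i

theorem step_eq (G : Grid N) (δ : ℝ) (i : Fin G.m) : G.step δ i = δ * G.gap i := rfl

theorem subdivide_t_of_lt (G : Grid N) (i : Fin G.m) {k : ℕ} (hk : k < i)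
    (h : k < (G.subdivide i).m) : (G.subdivide i).t ⟨k, h⟩ = G.t ⟨k, hk.trans i.2⟩ := by
  have e : (⟨k, h⟩ : Fin (G.m + 1)) = i.castSucc.succAbove ⟨k, hk.trans i.2⟩ := by
    rw [Fin.succAbove_of_castSucc_lt _ _ (show (⟨k, _⟩ : Fin (G.m + 1)) < i.castSucc from hk)]
    rfl
  change Fin.insertNth (α := fun _ => ℝ) i.castSucc (G.mid i) G.t ⟨k, h⟩ = _
  rw [e, Fin.insertNth_apply_succAbove]

theorem subdivide_t_self (G : Grid N) (i : Fin G.m) (h : (i : ℕ) < (G.subdivide i).m) :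
    (G.subdivide i).t ⟨i, h⟩ = G.mid i :=
  Fin.insertNth_apply_same (α := fun _ => ℝ) i.castSucc (G.mid i) G.t

theorem subdivide_t_of_gt (G : Grid N) (i : Fin G.m) {k : ℕ} (hk : i ≤ k)
    (h : k + 1 < (G.subdivide i).m) :
    (G.subdivide i).t ⟨k + 1, h⟩ = G.t ⟨k, Nat.lt_of_succ_lt_succ h⟩ := by
  have e : (⟨k + 1, h⟩ : Fin (G.m + 1)) = i.castSucc.succAbove ⟨k, Nat.lt_of_succ_lt_succ h⟩ := by
    rw [Fin.succAbove_of_le_castSucc _ _ (show i.castSucc ≤ (⟨k, _⟩ : Fin (G.m + 1)) from hk)]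
    rfl
  change Fin.insertNth (α := fun _ => ℝ) i.castSucc (G.mid i) G.t ⟨k + 1, h⟩ = _
  rw [e, Fin.insertNth_apply_succAbove]

theorem gap_zero (G : Grid N) (h : 0 < G.m) : G.gap ⟨0, h⟩ = G.t ⟨0, h⟩ := sub_zero _

theorem gap_succ (G : Grid N) {k : ℕ} (h : k + 1 < G.m) :
    G.gap ⟨k + 1, h⟩ = G.t ⟨k + 1, h⟩ - G.t ⟨k, by omega⟩ := rfl

theorem mid_sub_before (G : Grid N) (i : Fin G.m) : G.mid i - before 0 G.t i = G.gap i / 2 := by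
  unfold mid gap
  ring

/-- Subdivision halves one gap and keeps the others. -/
theorem gap_subdivide (G : Grid N) (i : Fin G.m) (k : Fin (G.subdivide i).m) :
    (G.subdivide i).gap k = G.gap i / 2 ∨ ∃ j, (G.subdivide i).gap k = G.gap j := by
  obtain ⟨k, hk⟩ := k
  have hk' : k < G.m + 1 := hk
  rcases lt_trichotomy k i with h | h | h
  · right
    refine ⟨⟨k, h.trans i.2⟩, ?_⟩
    rcases k with _ | k
    · rw [gap_zero, gap_zero]
      exact subdivide_t_of_lt G i h hk
    · rw [gap_succ, gap_succ]
      exact congrArg₂ (· - ·) (subdivide_t_of_lt G i h hk)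
        (subdivide_t_of_lt G i ((Nat.lt_succ_self k).trans h) _)
  · left
    obtain ⟨i, hi⟩ := i
    have h : k = i := h
    subst h
    have h1 := subdivide_t_self G ⟨k, hi⟩ hk
    rw [← mid_sub_before]
    rcases k with _ | k
    · rw [gap_zero, before_zero, sub_zero]
      exact h1
    · rw [gap_succ, before_succ]
      exact congrArg₂ (· - ·) h1 (subdivide_t_of_lt G ⟨k + 1, hi⟩ (Nat.lt_succ_self k) _)
  · obtain ⟨k, rfl⟩ : ∃ l, k = l + 1 := ⟨k - 1, by omega⟩
    have h1 := subdivide_t_of_gt G i (Nat.lt_succ_iff.1 h) hk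
    rw [gap_succ, h1]
    -- The point right after the inserted one has the second half of the divided gap; later gaps are
    -- shifted copies.
    rcases (Nat.lt_succ_iff.1 h).eq_or_lt with h | h
    · left
      subst h
      refine (congrArg (G.t i - ·) (subdivide_t_self G i _)).trans ?_
      unfold mid gap
      ring
    · right
      obtain ⟨k, rfl⟩ : ∃ l, k = l + 1 := ⟨k - 1, by omega⟩
      exact ⟨⟨k + 1, by omega⟩, congrArg (G.t ⟨k + 1, _⟩ - ·)
        (subdivide_t_of_gt G i (Nat.lt_succ_iff.1 h) _)⟩

/-- All gaps are powers of `1/2` with exponent at most `K`. -/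
def Dyadic (K : ℕ) (G : Grid N) : Prop := ∀ i, ∃ k ≤ K, G.gap i = (1 / 2) ^ k

theorem dyadic_uniform (K : ℕ) : (uniform N).Dyadic K := by
  rintro ⟨i, hi⟩
  refine ⟨0, Nat.zero_le _, ?_⟩
  rcases i with _ | i
  · rw [gap_zero]
    simp [uniform]
  · rw [gap_succ]
    simp [uniform]

/-- A gap `2^{-l}` with `δ2^{-l} > ℓ` has `l < log₂(δ/ℓ)`, so `l + 1 ≤ K` after halving. The
natural-number ceiling accounts for the maximum with `0`. -/
theorem Dyadic.subdivide {K : ℕ} {G : Grid N} (h : G.Dyadic K) {δ ℓ : ℝ} (hδ : 0 < δ) (hℓ : 0 < ℓ)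
    (hK : K = ⌈Real.logb 2 (δ / ℓ)⌉₊) {i : Fin G.m} (hi : ℓ < G.step δ i) :
    (G.subdivide i).Dyadic K := by
  intro k
  rcases G.gap_subdivide i k with hk | ⟨j, hj⟩
  · obtain ⟨l, -, hl⟩ := h i
    refine ⟨l + 1, ?_, ?_⟩
    · rw [step_eq, hl] at hi
      rw [hK, Nat.add_one_le_iff, Nat.lt_ceil, Real.lt_logb_iff_rpow_lt (by norm_num) (by positivity),
        Real.rpow_natCast, lt_div_iff₀ hℓ]
      rw [one_div, inv_pow, ← div_eq_mul_inv, lt_div_iff₀ (by positivity)] at hi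
      linarith
    · rw [hk, hl, pow_succ]
      ring
  · obtain ⟨l, hl, he⟩ := h j
    exact ⟨l, hl, hj.trans he⟩

theorem Dyadic.le_t {K : ℕ} {G : Grid N} (h : G.Dyadic K) (k : ℕ) (hk : k < G.m) :
    (k + 1) * (1 / 2 : ℝ) ^ K ≤ G.t ⟨k, hk⟩ := by
  have hgap : ∀ i, (1 / 2 : ℝ) ^ K ≤ G.gap i := by
    intro i
    obtain ⟨l, hl, he⟩ := h i
    rw [he]
    exact pow_le_pow_of_le_one (by norm_num) (by norm_num) hl
  induction k with
  | zero =>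
    have := hgap ⟨0, hk⟩
    rw [gap_zero] at this
    simpa using this
  | succ k ih =>
    have h1 := hgap ⟨k + 1, hk⟩
    rw [gap_succ] at h1
    have h2 := ih (by omega)
    push_cast
    linarith

/-- The `m` gaps add up to at most `N`, and each is at least `2^{-K}`. -/
theorem Dyadic.m_le {K : ℕ} {G : Grid N} (h : G.Dyadic K) : G.m ≤ N * 2 ^ K := by
  rcases Nat.eq_zero_or_pos G.m with h0 | h0
  · omega
  have h1 := (h.le_t (G.m - 1) (by omega)).trans (G.le _)
  rw [one_div, inv_pow, ← div_eq_mul_inv, div_le_iff₀ (by positivity)] at h1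
  have h2 : ((G.m - 1 : ℕ) : ℝ) + 1 = G.m := by
    rw [Nat.cast_sub h0]
    simp
  rw [h2] at h1
  exact_mod_cast h1

/-- The grids that arise from the user's grid by `j` subdivisions. -/
def level (N : ℕ) : ℕ → Set (Grid N)
  | 0 => {uniform N}
  | j + 1 => ⋃ G ∈ level N j, Set.range G.subdivide

theorem finite_level (N j : ℕ) : (level N j).Finite := by
  induction j with
  | zero => exact Set.finite_singleton _
  | succ j ih => exact ih.biUnion fun G _ => Set.finite_range _

theorem subdivide_mem_level {G : Grid N} {j : ℕ} (h : G ∈ level N j) (i : Fin G.m) :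
    G.subdivide i ∈ level N (j + 1) := Set.mem_biUnion h ⟨i, rfl⟩

end Grid

/-! ### Backtracking -/

theorem exists_isLeast {α : Type*} [LinearOrder α] [WellFoundedLT α] {s : Set α} (h : s.Nonempty) :
    ∃ a, IsLeast s a :=
  ⟨wellFounded_lt.min s h, wellFounded_lt.min_mem s h,
    fun _ hb => not_lt.1 (wellFounded_lt.not_lt_min s hb)⟩

theorem summable_of_descent {φ s : ℕ → ℝ} {c : ℝ} (hc : 0 < c) (hφ : ∀ k, 0 ≤ φ k)
    (hs : ∀ k, 0 ≤ s k) (h : ∀ k, c * s k ≤ φ k - φ (k + 1)) : Summable s := by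
  refine summable_of_sum_range_le (c := φ 0 / c) hs fun m => ?_
  rw [le_div_iff₀ hc, mul_comm, Finset.mul_sum]
  calc ∑ k ∈ Finset.range m, c * s k ≤ ∑ k ∈ Finset.range m, (φ k - φ (k + 1)) :=
        Finset.sum_le_sum fun k _ => h k
    _ = φ 0 - φ m := Finset.sum_range_sub' φ m
    _ ≤ φ 0 := by linarith [hφ m]

/-- A backtracking line search with sufficient decrease of a potential that is bounded from below
cannot go on for ever if small steps are accepted along convergent sequences. -/
theorem false_of_backtracking {E : Type*} [NormedAddCommGroup E] [NormedSpace ℝ E] [CompleteSpace E]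
    {z d : ℕ → E} {j : ℕ → ℕ} {η : ℝ} (hη0 : 0 < η) (hη1 : η < 1) {Q : ℕ → ℝ → Prop}
    (hj : ∀ k, IsLeast {j : ℕ | 1 ≤ j ∧ Q k (η ^ j)} (j k))
    (hz : ∀ k, z (k + 1) = z k + η ^ j k • d k) {C : ℝ} (hd : ∀ k, ‖d k‖ ≤ C) {φ : ℕ → ℝ} {c : ℝ}
    (hc : 0 < c) (hφ : ∀ k, 0 ≤ φ k) (hdec : ∀ k, c * η ^ j k ≤ φ k - φ (k + 1))
    (hacc : ∀ (z₀ : E) (s : ℕ → ℝ), Tendsto z atTop (𝓝 z₀) → (∀ k, 0 < s k) → (∀ k, s k ≤ 1) →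
      Tendsto s atTop (𝓝 0) → ∀ᶠ k in atTop, Q k (s k)) : False := by
  -- The total decrease is finite, so the step sizes are summable; with bounded directions the
  -- iterates form a Cauchy sequence.
  have hsum : Summable fun k => η ^ j k :=
    summable_of_descent hc hφ (fun k => (pow_pos hη0 _).le) hdec
  have hcau : CauchySeq z := by
    refine cauchySeq_of_dist_le_of_summable (fun k => η ^ j k * C) (fun k => ?_) (hsum.mul_right C)
    rw [hz k, dist_eq_norm, sub_add_cancel_left, norm_neg, norm_smul,
      Real.norm_of_nonneg (pow_pos hη0 _).le]
    exact mul_le_mul_of_nonneg_left (hd k) (pow_pos hη0 _).le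
  obtain ⟨z₀, hz₀⟩ := cauchySeq_tendsto_of_complete hcau
  have hs0 := hsum.tendsto_atTop_zero
  -- The trial before the accepted one is larger only by the factor `η⁻¹`, so these trials also tend
  -- to `0` and are eventually acceptable.
  have he : ∀ k, η ^ (j k - 1) = η⁻¹ * η ^ j k := by
    intro k
    obtain ⟨l, hl⟩ : ∃ l, j k = l + 1 := ⟨j k - 1, by have := (hj k).1.1; omega⟩
    rw [hl, pow_succ]
    simp only [Nat.add_sub_cancel]
    field_simp
  have hev := hacc z₀ (fun k => η ^ (j k - 1)) hz₀ (fun k => pow_pos hη0 _)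
    (fun k => pow_le_one₀ hη0.le hη1.le) (by
      simp only [he]
      simpa using hs0.const_mul η⁻¹)
  obtain ⟨k, hk1, hk2⟩ := (hev.and (hs0 (Iio_mem_nhds hη0))).exists
  have hk3 : η ^ j k < η := hk2
  -- The search starts at exponent `1`; only for `j k ≥ 2` is `j k - 1` a competitor that
  -- contradicts minimality.
  have hj2 : 2 ≤ j k := by
    by_contra! hlt
    have := (hj k).1.1
    have e : j k = 1 := by omega
    rw [e, pow_one] at hk3
    exact lt_irrefl _ hk3
  have := (hj k).2 (show 1 ≤ j k - 1 ∧ Q k (η ^ (j k - 1)) from ⟨by omega, hk1⟩)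
  omega


namespace Problem
variable {n mu N me mi nR : ℕ} {P : Problem n mu N me mi nR}

/-! ### Every step can be carried out -/

theorem hessianOK_id {E : Type*} [NormedAddCommGroup E] [InnerProductSpace ℝ E] {L : ℝ}
    (hL : 1 ≤ L) : HessianOK L (ContinuousLinearMap.id ℝ E) := by
  refine ⟨fun x y => rfl, fun x => ?_⟩
  rw [ContinuousLinearMap.id_apply, real_inner_self_eq_norm_sq]
  have h0 : 0 ≤ ‖x‖ ^ 2 := by positivity
  have h1 : 1 / L ≤ 1 := by
    rw [div_le_one (by linarith)]
    exact hL
  exact ⟨mul_le_of_le_one_left h0 h1, le_mul_of_one_le_left h0 hL⟩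

theorem tendsto_pow_succ {η : ℝ} (h0 : 0 < η) (h1 : η < 1) :
    Tendsto (fun k : ℕ => η ^ (k + 1)) atTop (𝓝 0) :=
  (tendsto_add_atTop_iff_nat 1).2 (tendsto_pow_atTop_nhds_zero_of_lt_one h0.le h1)

theorem exists_step_solve (hM : P.M.PosDef) (hO : P.ObjectiveAssumption)
    (hR : P.RelaxationAssumption) (hC : P.ControlAssumption) {S : Params} (hS : P.Admissible S)
    {G : Grid N} {θ : Blocks G.m n} {u : Blocks N mu} (hu : u ∈ P.ctrlSet) (ρ : ℝ) (K : ℕ) :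
    ∃ s', P.Step S ⟨.solve, G, θ, u, ρ, K⟩ s' := by
  by_cases hsing : ∃ i, P.Singular S G θ u i
  · obtain ⟨i, hi⟩ := exists_isLeast (s := {i | P.Singular S G θ u i}) hsing
    exact ⟨_, .solveSubdivide i hi⟩
  push Not at hsing
  rcases lt_or_ge (P.viol G S.L2 θ u) S.L4 with hv | hv
  · exact ⟨_, .solveReturn hsing hv⟩
  obtain ⟨T, hT, -⟩ :=
    exists_clm_inverse (jacθ_injective hM hR hC hS.L2_pos hS.L3_pos G θ hu hsing)
  set d := T (-P.res G S.L2 θ u) with hd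
  have hev := eventually_wolfe hM hO hR hC hS G (θ := fun _ => θ) (d := fun _ => d) hu
    tendsto_const_nhds (fun _ => hT _) (fun _ => hv) (fun _ => le_rfl)
    (fun k => pow_pos hS.η_pos (k + 1)) (fun k => pow_le_one₀ hS.η_pos.le hS.η_lt.le)
    (tendsto_pow_succ hS.η_pos hS.η_lt)
  obtain ⟨k, hk⟩ := hev.exists
  obtain ⟨j, hj⟩ := exists_isLeast (s := {j : ℕ | 1 ≤ j ∧ P.Wolfe S G θ d u (S.η ^ j)})
    ⟨k + 1, by omega, hk⟩
  exact ⟨_, .solveNewton hsing hv d (hT _) j hj⟩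

/-- The identity is an admissible Hessian because `L₅ ≥ 1`. A successful exponent comes from the
sequence statement `eventually_lineSearch`, applied to constant iterates. -/
theorem exists_step_inner (hM : P.M.PosDef) (hO : P.ObjectiveAssumption)
    (hR : P.RelaxationAssumption) (hC : P.ControlAssumption) {S : Params} (hS : P.Admissible S)
    {G : Grid N} {θ : Blocks G.m n} {u : Blocks N mu} (hu : u ∈ P.ctrlSet) (ρ : ℝ) (K : ℕ) :
    ∃ s', P.Step S ⟨.inner, G, θ, u, ρ, K⟩ s' := by
  by_cases hsing : ∃ i, P.Singular S G θ u i
  · obtain ⟨i, hi⟩ := exists_isLeast (s := {i | P.Singular S G θ u i}) hsing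
    exact ⟨_, .innerSubdivide i hi⟩
  push Not at hsing
  have hHθ := hessianOK_id (E := Blocks G.m n) hS.one_le_L5
  have hHu := hessianOK_id (E := Blocks N mu) hS.one_le_L5
  obtain ⟨dθ, du, μ, hqp⟩ := exists_qpSolution hM hO hR hC hS.L2_pos hS.L3_pos G θ hu hsing hHθ hHu
  by_cases hc : P.Converged S G θ u dθ du
  · exact ⟨_, .innerReturn hsing _ _ hHθ hHu dθ du μ hqp hc⟩
  have hev := eventually_lineSearch hM hO hR hC hS G (θ := fun _ => θ) (u := fun _ => u)
    (dθ := fun _ => dθ) (du := fun _ => du) (μ := fun _ => μ)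
    (ρ := fun _ => max ρ ((⨆ i, ‖μ i‖) + S.L10)) (fun _ => hu)
    tendsto_const_nhds (fun _ => hHθ) (fun _ => hHu) (fun _ => hqp) (fun _ => hc)
    (C := max ‖dθ‖ ‖du‖) (fun _ => le_max_left _ _) (fun _ => le_max_right _ _)
    (fun _ => le_max_right _ _) (fun _ => le_rfl)
    (fun k => pow_pos hS.η_pos (k + 1)) (fun k => pow_le_one₀ hS.η_pos.le hS.η_lt.le)
    (tendsto_pow_succ hS.η_pos hS.η_lt)
  obtain ⟨k, hk⟩ := hev.exists
  obtain ⟨j, hj⟩ := exists_isLeast (s := {j : ℕ | 1 ≤ j ∧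
    P.LineSearch S G (max ρ ((⨆ i, ‖μ i‖) + S.L10)) θ u dθ du (S.η ^ j)}) ⟨k + 1, by omega, hk⟩
  exact ⟨_, .innerStep hsing _ _ hHθ hHu dθ du μ hqp hc _ rfl j hj⟩

theorem exists_step (hM : P.M.PosDef) (hO : P.ObjectiveAssumption)
    (hR : P.RelaxationAssumption) (hC : P.ControlAssumption) {S : Params} (hS : P.Admissible S)
    (s : State n mu N) (hu : s.u ∈ P.ctrlSet) (hp : s.phase ≠ Phase.done) :
    ∃ s', P.Step S s s' := by
  obtain ⟨ph, G, θ, u, ρ, K⟩ := s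
  cases ph with
  | sqp =>
    rcases lt_or_ge (P.viol G S.L2 θ u) S.L4 with hv | hv
    · exact ⟨_, .toInner hv⟩
    · exact ⟨_, .toSolve hv⟩
  | solve => exact exists_step_solve hM hO hR hC hS hu ρ K
  | inner => exact exists_step_inner hM hO hR hC hS hu ρ K
  | check =>
    by_cases h : ∃ i, P.CheckFails S G θ i
    · obtain ⟨i, hi⟩ := exists_isLeast (s := {i | P.CheckFails S G θ i}) h
      exact ⟨_, .checkFail i hi⟩
    · push Not at h
      exact ⟨_, .checkPass h⟩
  | done => exact absurd rfl hp

/-! ### Invariants of a run -/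

theorem add_smul_mem_ctrlSet (hO : P.ObjectiveAssumption) {u du : Blocks N mu} (hu : u ∈ P.ctrlSet)
    (hud : u + du ∈ P.ctrlSet) {t : ℝ} (h0 : 0 ≤ t) (h1 : t ≤ 1) : u + t • du ∈ P.ctrlSet :=
  (convex_ctrlSet hO).add_smul_mem hu hud ⟨h0, h1⟩

/-- Invariants on the grid: subdivisions were made at large timesteps only, and there were at least
as many as further calls to SQP. -/
structure GridInv (P : Problem n mu N me mi nR) (S : Params) (K : ℕ) (s : State n mu N) : Prop where
  mem_ctrlSet : s.u ∈ P.ctrlSet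
  dyadic : s.G.Dyadic K
  level : ∃ j, s.G ∈ Grid.level N j ∧ s.G.m = N + j ∧ s.calls ≤ j + 1
  viol_lt : s.phase = .check → P.viol s.G S.L2 s.θ s.u < εSQP (nR := nR) S

/-- Each subdivision adds one grid point, and `calls` increases only together with one. The clause
`viol_lt` carries the small residual from the convergence test of SQP-Inner to the final checks,
where it excludes failures at short steps. -/
theorem GridInv.step (hn : 0 < n) (hN : 0 < N) (hM : P.M.PosDef) (hδ : 0 < P.δ)
    (hO : P.ObjectiveAssumption) (hR : P.RelaxationAssumption) (hC : P.ControlAssumption)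
    (hSl : P.SlaterAssumption) {S : Params} (hS : P.Admissible S) {L : ℝ} (hL0 : 0 < L)
    (hL : ∀ v ∈ P.X, CurvatureBounded L (P.Pbar S.L2 v)) {K : ℕ}
    (hK : K = ⌈Real.logb 2 (P.δ / P.L16 S L)⌉₊) {s s' : State n mu N} (h : P.GridInv S K s)
    (hst : P.Step S s s') : P.GridInv S K s' := by
  have h16 := L16_pos hn hN hM hδ hR hS hL0
  obtain ⟨hu, hdy, ⟨j, hj, hm, hc⟩, hv⟩ := h
  have hη := fun k => (pow_pos hS.η_pos k).le
  have hη1 := fun k : ℕ => pow_le_one₀ (n := k) hS.η_pos.le hS.η_lt.le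
  cases hst with
  | toSolve _ => exact ⟨hu, hdy, ⟨j, hj, hm, hc⟩, by simp⟩
  | toInner _ => exact ⟨hu, hdy, ⟨j, hj, hm, hc⟩, by simp⟩
  | solveSubdivide i hs =>
    exact ⟨hu, hdy.subdivide hδ h16 hK
      (lt_step_of_singular hn hM hδ hR hC hS.L2_pos hS.L3_pos hL0 hL _ _ hu i hs.1),
      ⟨j + 1, Grid.subdivide_mem_level hj i, congrArg (· + 1) hm, hc.trans (Nat.le_succ _)⟩, by simp⟩
  | solveReturn _ _ => exact ⟨hu, hdy, ⟨j, hj, hm, hc⟩, by simp⟩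
  | solveNewton _ _ _ _ _ _ => exact ⟨hu, hdy, ⟨j, hj, hm, hc⟩, by simp⟩
  | innerSubdivide i hs =>
    exact ⟨hu, hdy.subdivide hδ h16 hK
      (lt_step_of_singular hn hM hδ hR hC hS.L2_pos hS.L3_pos hL0 hL _ _ hu i hs.1),
      ⟨j + 1, Grid.subdivide_mem_level hj i, congrArg (· + 1) hm, hc.trans (Nat.le_succ _)⟩, by simp⟩
  | innerReturn _ _ _ _ _ _ _ _ _ hconv => exact ⟨hu, hdy, ⟨j, hj, hm, hc⟩, fun _ => hconv.2⟩
  | innerStep _ _ _ _ _ dθ du _ hqp _ _ _ k _ =>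
    exact ⟨add_smul_mem_ctrlSet hO hu hqp.1.2 (hη k) (hη1 k), hdy, ⟨j, hj, hm, hc⟩, by simp⟩
  | checkFail i hi =>
    exact ⟨hu, hdy.subdivide hδ h16 hK
      (lt_step_of_checkFails hn hN hM hδ hR hSl hS hL0 hL _ _ hu (hv rfl) i hi),
      ⟨j + 1, Grid.subdivide_mem_level hj i, congrArg (· + 1) hm, Nat.succ_le_succ hc⟩, by simp⟩
  | checkPass _ => exact ⟨hu, hdy, ⟨j, hj, hm, hc⟩, by simp⟩

theorem gridInv_start {S : Params} (K : ℕ) (θ : Blocks N n) {u : Blocks N mu}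
    (hu : u ∈ P.ctrlSet) : P.GridInv S K (start θ u) :=
  ⟨hu, Grid.dyadic_uniform K, ⟨0, rfl, rfl, le_rfl⟩, by simp [start]⟩

/-- In the inner solver on the grid `G` the violation stays below `V`, and search directions and
multipliers are bounded by `C`. -/
def InnerBounds (P : Problem n mu N me mi nR) (S : Params) (G : Grid N) (V C : ℝ) : Prop :=
  S.L4 ≤ V ∧ ∀ (θ : Blocks G.m n), ∀ u ∈ P.ctrlSet, (∀ i, ¬ P.Singular S G θ u i) →
      P.viol G S.L2 θ u ≤ V → ∀ Hθ Hu dθ du μ, HessianOK S.L5 Hθ →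
        P.QPSolution S G θ u Hθ Hu dθ du μ →
          (‖dθ‖ ≤ C ∧ ‖du‖ ≤ C ∧ (⨆ i, ‖μ i‖) ≤ C) ∧
          ∀ ρ t, 0 ≤ t → t ≤ 1 → P.LineSearch S G ρ θ u dθ du t →
            P.viol G S.L2 (θ + t • dθ) (u + t • du) ≤ V

/-- Bounds on the violation and on the multipliers in the inner solver, for a fixed grid. -/
theorem exists_inner_bounds (hn : 0 < n) (hM : P.M.PosDef) (hO : P.ObjectiveAssumption)
    (hR : P.RelaxationAssumption) (hC : P.ControlAssumption) {S : Params} (hS : P.Admissible S)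
    (G : Grid N) :
    ∃ V C : ℝ, P.InnerBounds S G V C := by
  have hL2 := hS.L2_pos
  obtain ⟨D, hD⟩ := exists_qpSolution_bound hn hM hO hR hC hL2 hS.L3_pos hS.one_le_L5 G S.L4
  obtain ⟨CB, hCB, hB⟩ := exists_norm_resDeriv_le hn hM hO hR hC hL2 G
  -- From a violation of at most `L₄`, one step adds at most the Lipschitz constant times the step
  -- length; above `L₄` the line search forbids any increase.
  set V := S.L4 + G.m * n * (CB * max D 0) with hV
  obtain ⟨C, hCb⟩ := exists_qpSolution_bound hn hM hO hR hC hL2 hS.L3_pos hS.one_le_L5 G V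
  refine ⟨V, C, le_add_of_nonneg_right (by positivity), fun θ u hu hs hv Hθ Hu dθ du μ hHθ hqp =>
    ⟨hCb θ u hu hs hv Hθ Hu dθ du μ hHθ hqp, fun ρ t ht0 ht1 hls => ?_⟩⟩
  rcases le_or_gt (P.viol G S.L2 θ u) S.L4 with h4 | h4
  · obtain ⟨h1, h2, -⟩ := hD θ u hu hs h4 Hθ Hu dθ du μ hHθ hqp
    have hlip := norm_res_sub_le hM hO hR hC hL2 G hB (z := (θ, u))
      (w := (θ + t • dθ, u + t • du)) ⟨Set.mem_univ _, hu⟩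
      ⟨Set.mem_univ _, add_smul_mem_ctrlSet hO hu hqp.1.2 ht0 ht1⟩
    have hn1 : ‖(θ + t • dθ, u + t • du) - (θ, u)‖ ≤ max D 0 := by
      have e : (θ + t • dθ, u + t • du) - (θ, u) = t • (dθ, du) := by simp
      rw [e, norm_smul, Real.norm_of_nonneg ht0]
      exact (mul_le_of_le_one_left (norm_nonneg _) ht1).trans
        ((max_le h1 h2).trans (le_max_left _ _))
    have h5 := oneNorm_add_le (P.res G S.L2 θ u)
      (P.res G S.L2 (θ + t • dθ) (u + t • du) - P.res G S.L2 θ u)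
    rw [add_sub_cancel] at h5
    have h6 : oneNorm (P.res G S.L2 (θ + t • dθ) (u + t • du) - P.res G S.L2 θ u) ≤
        G.m * n * (CB * max D 0) := by
      refine (oneNorm_le _).trans ?_
      gcongr
      exact hlip.trans (by gcongr)
    exact h5.trans (add_le_add h4 h6)
  · exact (hls.2 h4).trans hv

/-- Invariants on the violation in the inner solver and on the penalty coefficient. -/
structure PenaltyInv (P : Problem n mu N me mi nR) (S : Params) (V : Grid N → ℝ) (B : ℝ)
    (s : State n mu N) : Prop where
  viol_le : s.phase = .inner → P.viol s.G S.L2 s.θ s.u ≤ V s.G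
  nonneg : 0 ≤ s.ρ
  le : s.ρ ≤ B

theorem PenaltyInv.step {S : Params} (hS : P.Admissible S) {V C : Grid N → ℝ}
    (hVC : ∀ G, P.InnerBounds S G (V G) (C G)) {B : ℝ} {s s' : State n mu N}
    (hu : s.u ∈ P.ctrlSet) (hB : C s.G + S.L10 ≤ B) (h : P.PenaltyInv S V B s)
    (hst : P.Step S s s') : P.PenaltyInv S V B s' := by
  obtain ⟨hv, h0, hle⟩ := h
  cases hst with
  | toSolve _ => exact ⟨by simp, h0, hle⟩
  | toInner hlt => exact ⟨fun _ => hlt.le.trans (hVC _).1, h0, hle⟩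
  | solveSubdivide i hs => exact ⟨by simp, h0, hle⟩
  | solveReturn _ _ => exact ⟨by simp, h0, hle⟩
  | solveNewton _ _ _ _ _ _ => exact ⟨by simp, h0, hle⟩
  | innerSubdivide i hs => exact ⟨by simp, h0, hle⟩
  | innerReturn _ _ _ _ _ _ _ _ _ _ => exact ⟨by simp, h0, hle⟩
  | innerStep hs Hθ Hu hHθ hHu dθ du μ hqp hc ρ' hρ k hk =>
    obtain ⟨⟨-, -, hμ⟩, hls⟩ := (hVC _).2 _ _ hu hs (hv rfl) Hθ Hu dθ du μ hHθ hqp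
    refine ⟨fun _ => hls ρ' _ (pow_pos hS.η_pos k).le (pow_le_one₀ hS.η_pos.le hS.η_lt.le) hk.1.2,
      ?_, ?_⟩
    · rw [hρ]
      exact h0.trans (le_max_left _ _)
    · rw [hρ]
      refine max_le hle ?_
      have : C _ + S.L10 ≤ B := hB
      linarith
  | checkFail i hi => exact ⟨by simp, h0, hle⟩
  | checkPass _ => exact ⟨by simp, h0, hle⟩

/-! ### Termination -/

/-- Backtracking with potential `Λ`: its monotonicity bounds the Newton directions, and `‖r‖₁ ≥ L₄`
keeps it away from `0`, so the decrease is at least a constant times the step size. -/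
theorem not_infinite_newton (hM : P.M.PosDef) (hO : P.ObjectiveAssumption)
    (hR : P.RelaxationAssumption) (hC : P.ControlAssumption) {S : Params} (hS : P.Admissible S)
    {G : Grid N} {u : Blocks N mu} (hu : u ∈ P.ctrlSet) (θ : ℕ → Blocks G.m n)
    (h : ∀ k, (∀ i, ¬ P.Singular S G (θ k) u i) ∧ S.L4 ≤ P.viol G S.L2 (θ k) u ∧
      ∃ (d : Blocks G.m n) (j : ℕ), P.jacθ G S.L2 (θ k) u d = -P.res G S.L2 (θ k) u ∧
        IsLeast {j : ℕ | 1 ≤ j ∧ P.Wolfe S G (θ k) d u (S.η ^ j)} j ∧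
        θ (k + 1) = θ k + S.η ^ j • d) : False := by
  choose hs hv d j hd hj hθ using h
  obtain ⟨CA, hCA, hA⟩ := exists_norm_le_norm_jacθ hM hR hC hS.L2_pos hS.L3_pos G
  have hLam0 : ∀ k, 0 ≤ P.Lam G S.L2 (θ k) u := fun k => by
    rw [Lam_eq]
    positivity
  have hdec : ∀ k, 2 * S.α * S.η ^ j k * P.Lam G S.L2 (θ k) u ≤
      P.Lam G S.L2 (θ k) u - P.Lam G S.L2 (θ (k + 1)) u := by
    intro k
    have h1 : P.Lam G S.L2 (θ k + S.η ^ j k • d k) u < _ := (hj k).1.2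
    rw [← hθ k] at h1
    linarith
  have hα := hS.α_pos
  have hL4 := hS.L4_pos
  have hη := fun k => pow_pos hS.η_pos (j k)
  have hanti : Antitone fun k => P.Lam G S.L2 (θ k) u := by
    refine antitone_nat_of_succ_le fun k => ?_
    have h1 := hdec k
    have h2 : 0 ≤ 2 * S.α * S.η ^ j k * P.Lam G S.L2 (θ k) u :=
      mul_nonneg (mul_nonneg (by positivity) (hη k).le) (hLam0 k)
    linarith
  have hres : ∀ k, ‖P.res G S.L2 (θ k) u‖ ≤ ‖P.res G S.L2 (θ 0) u‖ := by
    intro k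
    have h1 := hanti (Nat.zero_le k)
    simp only [Lam_eq] at h1
    exact le_of_sq_le_sq (by linarith) (norm_nonneg _)
  set κ : ℝ := G.m * n with hκ
  have hκ0 : 0 ≤ κ := by positivity
  set R₀ := S.L4 / (κ + 1) with hR₀
  have hR₀0 : 0 < R₀ := by positivity
  have hlow : ∀ k, R₀ ^ 2 / 2 ≤ P.Lam G S.L2 (θ k) u := by
    intro k
    have h1 := (hv k).trans (oneNorm_le (P.res G S.L2 (θ k) u))
    have h2 : R₀ ≤ ‖P.res G S.L2 (θ k) u‖ := by
      rw [hR₀, div_le_iff₀ (by positivity)]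
      nlinarith [norm_nonneg (P.res G S.L2 (θ k) u)]
    rw [Lam_eq]
    gcongr
  refine false_of_backtracking hS.η_pos hS.η_lt hj hθ (C := CA * ‖P.res G S.L2 (θ 0) u‖)
    (fun k => ?_) (c := S.α * R₀ ^ 2) (by positivity) hLam0 (fun k => ?_)
    (fun z₀ s hz hs0 hs1 hs2 => eventually_wolfe hM hO hR hC hS G hu hz hd hv
      (C := CA * ‖P.res G S.L2 (θ 0) u‖) (fun k => ?_) hs0 hs1 hs2)
  · refine (hA _ u hu (hs k) (d k)).trans ?_
    rw [hd k, norm_neg]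
    exact mul_le_mul_of_nonneg_left (hres k) hCA
  · refine le_trans ?_ (hdec k)
    have := mul_le_mul_of_nonneg_left (hlow k) (mul_nonneg (by positivity : 0 ≤ 2 * S.α) (hη k).le)
    linarith
  · refine (hA _ u hu (hs k) (d k)).trans ?_
    rw [hd k, norm_neg]
    exact mul_le_mul_of_nonneg_left (hres k) hCA

/-- The merit function changes with `ρ`, so by itself it need not decrease. Raising `ρ` by `Δ` adds
at most `ΔV` to it, which is what the extra term `V(B - ρ)` loses. -/
theorem not_infinite_inner (hM : P.M.PosDef) (hO : P.ObjectiveAssumption)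
    (hR : P.RelaxationAssumption) (hC : P.ControlAssumption) {S : Params} (hS : P.Admissible S)
    {G : Grid N} (θ : ℕ → Blocks G.m n) (u : ℕ → Blocks N mu) (ρ : ℕ → ℝ) {V C B : ℝ}
    (hVC : P.InnerBounds S G V C) (hu : ∀ k, u k ∈ P.ctrlSet)
    (hV : ∀ k, P.viol G S.L2 (θ k) (u k) ≤ V) (hρ0 : ∀ k, 0 ≤ ρ k) (hρB : ∀ k, ρ k ≤ B)
    (h : ∀ k, (∀ i, ¬ P.Singular S G (θ k) (u k) i) ∧
      ∃ (Hθ : Blocks G.m n →L[ℝ] Blocks G.m n) (Hu : Blocks N mu →L[ℝ] Blocks N mu)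
        (dθ : Blocks G.m n) (du : Blocks N mu) (μ : Blocks G.m n) (j : ℕ),
        HessianOK S.L5 Hθ ∧ HessianOK S.L5 Hu ∧ P.QPSolution S G (θ k) (u k) Hθ Hu dθ du μ ∧
        ¬ P.Converged S G (θ k) (u k) dθ du ∧ ρ (k + 1) = max (ρ k) ((⨆ i, ‖μ i‖) + S.L10) ∧
        IsLeast {j : ℕ | 1 ≤ j ∧ P.LineSearch S G (ρ (k + 1)) (θ k) (u k) dθ du (S.η ^ j)} j ∧
        θ (k + 1) = θ k + S.η ^ j • dθ ∧ u (k + 1) = u k + S.η ^ j • du) : False := by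
  choose hs Hθ Hu dθ du μ j hHθ hHu hqp hnc hρ hj hθ hu' using h
  obtain ⟨c, hc, hdec⟩ := exists_decrease_of_not_converged hS
  have hb := fun k => (hVC.2 _ _ (hu k) (hs k) (hV k) _ _ _ _ _ (hHθ k) (hqp k)).1
  have hα := hS.α_pos
  have hη := fun k => pow_pos hS.η_pos (j k)
  refine false_of_backtracking (z := fun k => (θ k, u k)) (d := fun k => (dθ k, du k))
    hS.η_pos hS.η_lt (Q := fun k t => P.LineSearch S G (ρ (k + 1)) (θ k) (u k) (dθ k) (du k) t)
    hj (fun k => by rw [hθ k, hu' k]; rfl) (C := C) (fun k => max_le (hb k).1 (hb k).2.1)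
    (φ := fun k => P.merit G S.L2 (ρ k) (θ k) (u k) + V * (B - ρ k)) (c := S.α * c)
    (by positivity) (fun k => ?_) (fun k => ?_)
    (fun z₀ s hz hs0 hs1 hs2 => eventually_lineSearch hM hO hR hC hS G hu hz hHθ hHu hqp hnc
      (fun k => (hb k).1) (fun k => (hb k).2.1) (fun k => (hρ k).symm ▸ le_max_right _ _)
      (fun k => hρB (k + 1)) hs0 hs1 hs2)
  · have h1 := hO.nonneg G (θ k) (u k) (hu k)
    have h2 := mul_nonneg (hρ0 k) (viol_nonneg (P := P) G S.L2 (θ k) (u k))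
    have h3 : 0 ≤ V * (B - ρ k) :=
      mul_nonneg (hS.L4_pos.le.trans hVC.1) (sub_nonneg.2 (hρB k))
    unfold merit
    linarith
  · have h1 := (hj k).1.2.1
    rw [← hθ k, ← hu' k] at h1
    have h2 := mul_le_mul_of_nonneg_left (hdec G (θ k) (u k) (dθ k) (du k) (hnc k))
      (mul_nonneg hα.le (hη k).le)
    have h3 : ρ k ≤ ρ (k + 1) := (hρ k).symm ▸ le_max_left _ _
    have h4 : 0 ≤ (ρ (k + 1) - ρ k) * (V - P.viol G S.L2 (θ k) (u k)) :=
      mul_nonneg (sub_nonneg.2 h3) (sub_nonneg.2 (hV k))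
    unfold merit at h1 ⊢
    linarith

open Classical in
/-- Progress within the phases of the solver on a fixed grid. -/
noncomputable def phaseRank (P : Problem n mu N me mi nR) (S : Params) (s : State n mu N) : ℕ :=
  match s.phase with
  -- Two values for the head of SQP: `5` leads to Constraint-Solve at `4`, whose normal return gives
  -- `3`, which leads to SQP-Inner at `2`.
  | .sqp => if P.viol s.G S.L2 s.θ s.u < S.L4 then 3 else 5
  | .solve => 4
  | .inner => 2
  | .check => 1
  | .done => 0

theorem phaseRank_le (S : Params) (s : State n mu N) : P.phaseRank S s ≤ 5 := by
  obtain ⟨ph, G, θ, u, ρ, K⟩ := s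
  cases ph <;> simp only [phaseRank] <;> (try split_ifs) <;> omega

/-- A quantity that no step increases on grids with at most `b` points. -/
noncomputable def rank (P : Problem n mu N me mi nR) (S : Params) (b : ℕ) (s : State n mu N) : ℕ :=
  -- The weight `6` exceeds every phase rank, so a new grid point outweighs a return to the first
  -- phase.
  6 * (b - s.G.m) + P.phaseRank S s

theorem rank_subdivide_lt {S : Params} {b : ℕ} {s s' : State n mu N} (hm : s'.G.m = s.G.m + 1)
    (hb : s'.G.m ≤ b) (h : 1 ≤ P.phaseRank S s) : P.rank S b s' < P.rank S b s := by
  have := phaseRank_le (P := P) S s'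
  unfold rank
  omega

theorem rank_lt_of_phaseRank_lt {S : Params} {b : ℕ} {s s' : State n mu N} (hm : s'.G = s.G)
    (h : P.phaseRank S s' < P.phaseRank S s) : P.rank S b s' < P.rank S b s := by
  unfold rank
  rw [hm]
  omega

theorem step_solve {S : Params} {b : ℕ} {G : Grid N} {θ : Blocks G.m n} {u : Blocks N mu} {ρ : ℝ}
    {K : ℕ} {s' : State n mu N} (h : P.Step S ⟨.solve, G, θ, u, ρ, K⟩ s') (hb : s'.G.m ≤ b) :
    P.rank S b s' < P.rank S b ⟨.solve, G, θ, u, ρ, K⟩ ∨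
    ((∀ i, ¬ P.Singular S G θ u i) ∧ S.L4 ≤ P.viol G S.L2 θ u ∧
      ∃ (d : Blocks G.m n) (j : ℕ), P.jacθ G S.L2 θ u d = -P.res G S.L2 θ u ∧
        IsLeast {j : ℕ | 1 ≤ j ∧ P.Wolfe S G θ d u (S.η ^ j)} j ∧
        s' = ⟨.solve, G, θ + S.η ^ j • d, u, ρ, K⟩) := by
  cases h with
  | solveSubdivide i hs => exact Or.inl (rank_subdivide_lt rfl hb (by simp [phaseRank]))
  | solveReturn hs hv => exact Or.inl (rank_lt_of_phaseRank_lt rfl (by simp [phaseRank, hv]))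
  | solveNewton hs hv d hd j hj => exact Or.inr ⟨hs, hv, d, j, hd, hj, rfl⟩

theorem step_inner {S : Params} {b : ℕ} {G : Grid N} {θ : Blocks G.m n} {u : Blocks N mu} {ρ : ℝ}
    {K : ℕ} {s' : State n mu N} (h : P.Step S ⟨.inner, G, θ, u, ρ, K⟩ s') (hb : s'.G.m ≤ b) :
    P.rank S b s' < P.rank S b ⟨.inner, G, θ, u, ρ, K⟩ ∨
    ((∀ i, ¬ P.Singular S G θ u i) ∧
      ∃ (Hθ : Blocks G.m n →L[ℝ] Blocks G.m n) (Hu : Blocks N mu →L[ℝ] Blocks N mu)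
        (dθ : Blocks G.m n) (du : Blocks N mu) (μ : Blocks G.m n) (j : ℕ) (ρ' : ℝ),
        HessianOK S.L5 Hθ ∧ HessianOK S.L5 Hu ∧ P.QPSolution S G θ u Hθ Hu dθ du μ ∧
        ¬ P.Converged S G θ u dθ du ∧ ρ' = max ρ ((⨆ i, ‖μ i‖) + S.L10) ∧
        IsLeast {j : ℕ | 1 ≤ j ∧ P.LineSearch S G ρ' θ u dθ du (S.η ^ j)} j ∧
        s' = ⟨.inner, G, θ + S.η ^ j • dθ, u + S.η ^ j • du, ρ', K⟩) := by
  cases h with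
  | innerSubdivide i hs => exact Or.inl (rank_subdivide_lt rfl hb (by simp [phaseRank]))
  | innerReturn _ _ _ _ _ _ _ _ _ _ =>
    exact Or.inl (rank_lt_of_phaseRank_lt rfl (by simp [phaseRank]))
  | innerStep hs Hθ Hu hHθ hHu dθ du μ hqp hc ρ' hρ j hj =>
    exact Or.inr ⟨hs, Hθ, Hu, dθ, du, μ, j, ρ', hHθ, hHu, hqp, hc, hρ, hj, rfl⟩

theorem rank_lt_of_step {S : Params} {b : ℕ} {s s' : State n mu N} (h : P.Step S s s')
    (hb : s'.G.m ≤ b) (h1 : s.phase ≠ .solve) (h2 : s.phase ≠ .inner) :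
    P.rank S b s' < P.rank S b s := by
  cases h with
  | toSolve hv => exact rank_lt_of_phaseRank_lt rfl (by simp [phaseRank, not_lt.2 hv])
  | toInner hv => exact rank_lt_of_phaseRank_lt rfl (by simp [phaseRank, hv])
  | checkFail i hi => exact rank_subdivide_lt rfl hb (by simp [phaseRank])
  | checkPass _ => exact rank_lt_of_phaseRank_lt rfl (by simp [phaseRank])
  | _ => simp at h1 h2

theorem rank_le_of_step {S : Params} {b : ℕ} {s s' : State n mu N} (h : P.Step S s s')
    (hb : s'.G.m ≤ b) : P.rank S b s' ≤ P.rank S b s := by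
  obtain ⟨ph, G, θ, u, ρ, K⟩ := s
  cases ph with
  | solve =>
    rcases step_solve h hb with h | ⟨-, -, d, j, -, -, rfl⟩
    · exact h.le
    · exact le_rfl
  | inner =>
    rcases step_inner h hb with h | ⟨-, _, _, _, _, _, _, _, -, -, -, -, -, -, rfl⟩
    · exact h.le
    · exact le_rfl
  | sqp => exact (rank_lt_of_step h hb (by simp) (by simp)).le
  | check => exact (rank_lt_of_step h hb (by simp) (by simp)).le
  | done => exact (rank_lt_of_step h hb (by simp) (by simp)).le

theorem exists_forall_eq_of_antitone {f : ℕ → ℕ} (hf : Antitone f) : ∃ k₀, ∀ k, f (k₀ + k) = f k₀ := by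
  obtain ⟨a, ⟨k₀, rfl⟩, hmin⟩ := exists_isLeast (Set.range_nonempty f)
  exact ⟨k₀, fun k => le_antisymm (hf (Nat.le_add_right _ _)) (hmin ⟨_, rfl⟩)⟩

/-- The rank becomes constant along an infinite run. From then on the run stays in one of the two
loops on one grid, which the preceding results exclude. -/
theorem not_infinite_run (hM : P.M.PosDef) (hO : P.ObjectiveAssumption)
    (hR : P.RelaxationAssumption) (hC : P.ControlAssumption) {S : Params} (hS : P.Admissible S)
    {V C : Grid N → ℝ} (hVC : ∀ G, P.InnerBounds S G (V G) (C G)) {b : ℕ} {B : ℝ}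
    {run : ℕ → State n mu N} (hrun : ∀ k, P.Step S (run k) (run (k + 1)))
    (hu : ∀ k, (run k).u ∈ P.ctrlSet) (hb : ∀ k, (run k).G.m ≤ b)
    (hB : ∀ k, P.PenaltyInv S V B (run k)) : False := by
  have hanti : Antitone fun k => P.rank S b (run k) :=
    antitone_nat_of_succ_le fun k => rank_le_of_step (hrun k) (hb (k + 1))
  obtain ⟨k₀, hk₀⟩ := exists_forall_eq_of_antitone hanti
  have hnlt : ∀ k, ¬ P.rank S b (run (k₀ + k + 1)) < P.rank S b (run (k₀ + k)) := fun k => by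
    rw [hk₀ k, add_assoc, hk₀ (k + 1)]
    exact lt_irrefl _
  -- With the grid at time `k₀` as a variable, all later iterates live in one fixed space.
  obtain ⟨s, hs⟩ : ∃ s, run k₀ = s := ⟨_, rfl⟩
  obtain ⟨ph, G, θ, u, ρ, K⟩ := s
  by_cases h1 : ph = .solve
  · subst h1
    have hall : ∀ k, ∃ θ : Blocks G.m n, run (k₀ + k) = ⟨.solve, G, θ, u, ρ, K⟩ := by
      intro k
      induction k with
      | zero => exact ⟨θ, hs⟩
      | succ k ih =>
        obtain ⟨θ', hθ'⟩ := ih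
        have hst := hrun (k₀ + k)
        have hn := hnlt k
        rw [hθ'] at hst hn
        rcases step_solve hst (hb _) with h | ⟨-, -, d, j, -, -, h⟩
        · exact absurd h hn
        · exact ⟨_, h⟩
    choose Θ hΘ using hall
    have hu0 : u ∈ P.ctrlSet := by
      have := hu k₀
      rwa [hs] at this
    refine not_infinite_newton hM hO hR hC hS hu0 Θ fun k => ?_
    have hst := hrun (k₀ + k)
    have hn := hnlt k
    rw [hΘ k] at hst hn
    rcases step_solve hst (hb _) with h | ⟨hsing, hv, d, j, hd, hj, h⟩
    · exact absurd h hn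
    · refine ⟨hsing, hv, d, j, hd, hj, ?_⟩
      have h' := (hΘ (k + 1)).symm.trans h
      simpa using h'
  by_cases h2 : ph = .inner
  · subst h2
    have hall : ∀ k, ∃ (θ : Blocks G.m n) (u : Blocks N mu) (ρ : ℝ),
        run (k₀ + k) = ⟨.inner, G, θ, u, ρ, K⟩ := by
      intro k
      induction k with
      | zero => exact ⟨θ, u, ρ, hs⟩
      | succ k ih =>
        obtain ⟨θ', u', ρ', hθ'⟩ := ih
        have hst := hrun (k₀ + k)
        have hn := hnlt k
        rw [hθ'] at hst hn
        rcases step_inner hst (hb _) with h | ⟨-, _, _, dθ, du, μ, j, ρ'', -, -, -, -, -, -, h⟩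
        · exact absurd h hn
        · exact ⟨_, _, _, h⟩
    choose Θ U ρs hΘ using hall
    have hinv := fun k => hB (k₀ + k)
    have huk := fun k => hu (k₀ + k)
    simp only [hΘ] at hinv huk
    refine not_infinite_inner hM hO hR hC hS Θ U ρs (hVC G) huk (fun k => (hinv k).viol_le rfl)
      (fun k => (hinv k).nonneg) (fun k => (hinv k).le) fun k => ?_
    have hst := hrun (k₀ + k)
    have hn := hnlt k
    rw [hΘ k] at hst hn
    rcases step_inner hst (hb _) with h |
      ⟨hsing, Hθ, Hu, dθ, du, μ, j, ρ', hHθ, hHu, hqp, hc, hρ, hj, h⟩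
    · exact absurd h hn
    · have h' := (hΘ (k + 1)).symm.trans h
      simp only [State.mk.injEq, heq_eq_eq, true_and, and_true] at h'
      obtain ⟨e1, e2, e3⟩ := h'
      rw [e1, e2, e3]
      exact ⟨hsing, Hθ, Hu, dθ, du, μ, j, hHθ, hHu, hqp, hc, hρ, hj, rfl, rfl⟩
  · have := hnlt 0
    rw [add_zero] at this
    refine this (rank_lt_of_step (hrun k₀) (hb _) ?_ ?_) <;> rw [hs] <;> assumption

/-! ### Main theorem -/

theorem gridInv_of_reachable (hn : 0 < n) (hN : 0 < N) (hM : P.M.PosDef) (hδ : 0 < P.δ)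
    (hO : P.ObjectiveAssumption) (hR : P.RelaxationAssumption) (hC : P.ControlAssumption)
    (hSl : P.SlaterAssumption) {S : Params} (hS : P.Admissible S) {L : ℝ} (hL0 : 0 < L)
    (hL : ∀ v ∈ P.X, CurvatureBounded L (P.Pbar S.L2 v)) {θ : Blocks N n} {u : Blocks N mu}
    (hu : u ∈ P.ctrlSet) {s : State n mu N} (h : P.Reachable S θ u s) :
    P.GridInv S ⌈Real.logb 2 (P.δ / P.L16 S L)⌉₊ s := by
  induction h with
  | refl => exact gridInv_start _ θ hu
  | tail _ hst ih => exact ih.step hn hN hM hδ hO hR hC hSl hS hL0 hL rfl hst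

/-- The number of subdivisions is `m - N ≤ N·2^K - N`. -/
theorem GridInv.calls_le {S : Params} {K : ℕ} {s : State n mu N} (h : P.GridInv S K s) :
    s.calls ≤ (2 ^ K - 1) * N + 1 := by
  obtain ⟨j, -, hm, hc⟩ := h.level
  have h1 := h.dyadic.m_le
  have h2 : 1 ≤ 2 ^ K := Nat.one_le_two_pow
  have h3 : (2 ^ K - 1) * N + N = N * 2 ^ K := by
    rw [← Nat.succ_mul, Nat.succ_eq_add_one, Nat.sub_add_cancel h2, mul_comm]
  omega

/-- At most `N·2^K` subdivisions leave finitely many grids, chosen independently of the initial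
guess; a grid-dependent constant therefore has a uniform bound. -/
theorem exists_bound_of_level (K : ℕ) (f : Grid N → ℝ) :
    ∃ B : ℝ, 0 ≤ B ∧ ∀ {S : Params} {s : State n mu N}, P.GridInv S K s → f s.G ≤ B := by
  have hfin : (⋃ j ∈ Set.Iic (N * 2 ^ K), Grid.level N j).Finite :=
    (Set.finite_Iic _).biUnion fun j _ => Grid.finite_level N j
  obtain ⟨B, hB⟩ := (hfin.image f).bddAbove
  refine ⟨max B 0, le_max_right _ _, fun h => ?_⟩
  obtain ⟨j, hj, hm, -⟩ := h.level
  have h1 := h.dyadic.m_le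
  exact (hB ⟨_, Set.mem_biUnion (show j ≤ N * 2 ^ K by omega) hj, rfl⟩).trans (le_max_left _ _)

end Problem
end WhiteBoxTO

theorem mainTheorem2 {n mu N me mi nR : ℕ} (hn : 0 < n) (hN : 0 < N)
    (P : WhiteBoxTO.Problem n mu N me mi nR) (hM : P.M.PosDef) (hδ : 0 < P.δ)
    (hO : P.ObjectiveAssumption) (hR : P.RelaxationAssumption) (hC : P.ControlAssumption)
    (hS : P.SlaterAssumption) :
    -- `P̄` has a curvature bound that is polynomial in `L₂`
    (∃ q : Polynomial ℝ, ∀ L2 : ℝ, 0 < L2 → 0 < q.eval L2 ∧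
      ∀ u ∈ P.X, WhiteBoxTO.CurvatureBounded (q.eval L2) (P.Pbar L2 u)) ∧
    ∀ S : WhiteBoxTO.Params, P.Admissible S →
      -- the solver is well defined and terminates, with the stated number of calls to SQP
      (∀ (θ : WhiteBoxTO.Blocks N n) (u : WhiteBoxTO.Blocks N mu), (∀ k, u k ∈ P.X) →
        (∀ s, P.Reachable S θ u s → s.phase ≠ WhiteBoxTO.Phase.done → ∃ s', P.Step S s s') ∧
        (¬ ∃ run : ℕ → WhiteBoxTO.State n mu N,
          run 0 = WhiteBoxTO.Problem.start θ u ∧ ∀ k, P.Step S (run k) (run (k + 1))) ∧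
        (∀ L : ℝ, 0 < L → (∀ v ∈ P.X, WhiteBoxTO.CurvatureBounded L (P.Pbar S.L2 v)) →
          0 < P.L16 S L ∧ ∀ s, P.Reachable S θ u s →
            s.calls ≤ (2 ^ ⌈Real.logb 2 (P.δ / P.L16 S L)⌉₊ - 1) * N + 1)) ∧
      -- the penalty coefficients are bounded
      (∃ B : ℝ, ∀ (θ : WhiteBoxTO.Blocks N n) (u : WhiteBoxTO.Blocks N mu), (∀ k, u k ∈ P.X) →
        ∀ s, P.Reachable S θ u s → |s.ρ| ≤ B) := by
  have hpoly := WhiteBoxTO.Problem.exists_poly_curvatureBounded_Pbar hn hO hR hC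
  refine ⟨hpoly, fun S hA => ?_⟩
  obtain ⟨q, hq⟩ := hpoly
  obtain ⟨hL0, hL⟩ := hq S.L2 hA.L2_pos
  have hgrid : ∀ {θ : WhiteBoxTO.Blocks N n} {u : WhiteBoxTO.Blocks N mu}, (∀ k, u k ∈ P.X) →
      ∀ {s}, P.Reachable S θ u s → P.GridInv S _ s := fun hu _ h =>
    WhiteBoxTO.Problem.gridInv_of_reachable hn hN hM hδ hO hR hC hS hA hL0 hL hu h
  choose V C hVC using WhiteBoxTO.Problem.exists_inner_bounds hn hM hO hR hC hA
  -- Termination and the bound on `ρ` use the polynomial curvature bound at `L₂`. The count of calls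
  -- is proved afresh for an arbitrary curvature bound `L`.
  obtain ⟨B, hB0, hB⟩ := WhiteBoxTO.Problem.exists_bound_of_level (P := P)
    ⌈Real.logb 2 (P.δ / P.L16 S (q.eval S.L2))⌉₊ fun G => C G + S.L10
  have hpen : ∀ {θ : WhiteBoxTO.Blocks N n} {u : WhiteBoxTO.Blocks N mu}, (∀ k, u k ∈ P.X) →
      ∀ {s}, P.Reachable S θ u s → P.PenaltyInv S V B s := by
    intro θ u hu s h
    induction h with
    | refl => exact ⟨by simp [WhiteBoxTO.Problem.start], le_rfl, hB0⟩
    | tail hr hst ih =>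
      exact ih.step hA hVC (hgrid hu hr).mem_ctrlSet (hB (hgrid hu hr)) hst
  refine ⟨fun θ u hu => ⟨fun s hs hp => ?_, ?_, fun L hL0' hL' => ⟨?_, fun s hs => ?_⟩⟩,
    B, fun θ u hu s hs => ?_⟩
  · exact WhiteBoxTO.Problem.exists_step hM hO hR hC hA s (hgrid hu hs).mem_ctrlSet hp
  · rintro ⟨run, h0, hrun⟩
    have hreach : ∀ k, P.Reachable S θ u (run k) := by
      intro k
      induction k with
      | zero =>
        rw [h0]
        exact Relation.ReflTransGen.refl
      | succ k ih => exact ih.tail (hrun k)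
    exact WhiteBoxTO.Problem.not_infinite_run hM hO hR hC hA hVC hrun
      (fun k => (hgrid hu (hreach k)).mem_ctrlSet) (fun k => (hgrid hu (hreach k)).dyadic.m_le)
      (fun k => hpen hu (hreach k))
  · exact WhiteBoxTO.Problem.L16_pos hn hN hM hδ hR hA hL0'
  · exact (WhiteBoxTO.Problem.gridInv_of_reachable hn hN hM hδ hO hR hC hS hA hL0' hL' hu hs).calls_le
  · rw [abs_of_nonneg (hpen hu hs).nonneg]
    exact (hpen hu hs).le
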